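/- Notation. Fix $\chi,\varphi\in C^\infty(\mathbb R^3)$, $\varphi\ge 0$ radial, $\operatorname{supp}\varphi\subset\{3/4\le|\xi|\le 8/3\}$, $\chi\in C_0^\infty(B(0,4/3))$, with $\chi(\xi)+\sum_{j\ge0}\varphi(2^{-j}\xi)=1$ for all $\xi$ and $\sum_{j\in\mathbb Z}\varphi(2^{-j}\xi)=1$ for $\xi\neq0$; put $\dot\Delta_j=\varphi(2^{-j}D)$, $\dot S_j=\chi(2^{-j}D)$. Let $\|f\|_{\dot B^s_{p,q}}=\|(2^{js}\|\dot\Delta_jf\|_{L^p})_j\|_{\ell^q(\mathbb Z)}$; $\dot B^s_{p,q}$ consists of the tempered distributions $f$ of finite norm with $\sum_j\dot\Delta_jf=f$ in $\mathcal S'$. Let $\|u\|_{\tilde L^r_T(\dot B^s_{p,q})}=\|(2^{js}\|\dot\Delta_ju\|_{L^r(0,T;L^p)})_j\|_{\ell^q(\mathbb Z)}$. Let $J(\mathbb R^3)$ be the space of divergence-free fields in $L^2(\mathbb R^3;\mathbb R^3)$, let $(a\otimes b)_{ik}=a_ib_k$, and let $e^{t\Delta}$ be the heat flow. Proposition. There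 are functions $c(\cdot)$, $C(\cdot)$, $C'(\cdot)$ of one real variable (depending only on $\chi,\varphi$) such that the following holds. Let $\alpha\in(0,\tfrac32)$, $0<T<\infty$, $4<p<\infty$, $\delta\in(0,1-\tfrac3p)$, and let $$U\in\tilde L^\infty_T\dot B^{-1}_{\infty,\infty}\cap\tilde L^1_T\dot B^1_{\infty,\infty}\cap L^\infty_TH^\alpha,\qquad u_0^2\in\dot B^{-1+\frac3p+\delta}_{p,p}\cap J(\mathbb R^3),$$ where $U$ takes values in $\mathbb R^3$. Write $e=e^{t\Delta}u_0^2$ and define the Reynolds stress $$\begin{aligned}F_j={}&\big[\dot S_jU\otimes\dot S_jU-\dot S_j(U\otimes U)\big]+(e-\dot S_je)\otimes\dot S_jU+\big[\dot S_je\otimes\dot S_jU-\dot S_j(e\otimes U)\big]\\&+\dot S_jU\otimes(e-\dot S_je)+\big[\dot S_jU\otimes\dot S_je-\dot S_j(U\otimes e)\big]+\big[e\otimes e-\dot S_j(e\otimes e)\big].\end{aligned}$$ Then for every integer $j\ge1$ $$\begin{aligned}\|F_j\|_{L^2_TL^2_x}\le{}& c(\alpha)2^{-j\alpha}\|U\|_{L^\infty_T\dot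 H^\alpha}\big(j\|U\|_{\tilde L^2_T(\dot B^0_{\infty,\infty})}+T^{\frac12}\|U\|_{L^\infty_T(\dot B^{-1}_{\infty,\infty})}\big)\\&+c(\alpha)2^{-j\alpha}\|U\|_{L^\infty_T\dot H^\alpha}\big(j\|e\|_{\tilde L^2_T(\dot B^0_{\infty,\infty})}+T^{\frac12}\|e\|_{L^\infty_T(\dot B^{-1}_{\infty,\infty})}\big)\\&+C(p)2^{-\frac jp}\|e\|_{\tilde L^2_T(\dot B^{3/p}_{p,\infty})}\|U\|_{\tilde L^\infty_T(\dot B^{-1}_{\infty,\infty})}^{\frac2p}\|U\|_{L^\infty_TL^2}^{1-\frac2p}\\&+C'(\delta)T^{\frac\delta4}2^{-j\frac\delta2}\|u_0^2\|_{L^2}\|u_0^2\|_{\dot B^{-1+\frac3p+\delta}_{p,p}}.\end{aligned}$$ Moreover, with $\gamma=\min(\tfrac\alpha2,\tfrac1p,\tfrac\delta2)>0$, there is a finite constant $K$ (depending on $U,u_0^2,\alpha,p,\delta,T$ and $\chi,\varphi$, but not on $j$) such that $\|F_j\|_{L^2_TL^2_x}\le K2^{-j\gamma}$ for every integer $j\ge1$.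 -/

import Mathlib

open MeasureTheory Set Filter Topology FourierTransform
open scoped ENNReal NNReal Convolution SchwartzMap ContDiff

noncomputable section

namespace ReynoldsStress

/-- Physical space `ℝ³` with its Euclidean norm. -/
abbrev R3 : Type := EuclideanSpace ℝ (Fin 3)

/-- Real `3 × 3` matrices with the norm `|F| = √(F : F)`. -/
abbrev M3 : Type := EuclideanSpace ℝ (Fin 3 × Fin 3)

/-- Vector fields in `L²(ℝ³; ℝ³)`. -/
abbrev L2Field : Type := Lp R3 2 (volume : Measure R3)

/-! ### Littlewood–Paley theory -/

/-- A dyadic partition of unity `(χ, φ)` on the frequency space `ℝ³`. -/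
structure DyadicPartition where
  /-- the low frequency cut-off -/
  χ : R3 → ℝ
  /-- the cut-off to an annulus -/
  φ : R3 → ℝ
  χ_smooth : ContDiff ℝ ∞ χ
  φ_smooth : ContDiff ℝ ∞ φ
  χ_supp : tsupport χ ⊆ Metric.ball 0 (4 / 3)
  φ_supp : tsupport φ ⊆ {ξ | 3 / 4 ≤ ‖ξ‖ ∧ ‖ξ‖ ≤ 8 / 3}
  φ_nonneg : ∀ ξ, 0 ≤ φ ξ
  φ_radial : ∀ ξ η, ‖ξ‖ = ‖η‖ → φ ξ = φ η
  sum_nat : ∀ ξ, HasSum (fun j : ℕ => φ ((2 : ℝ) ^ (-(j : ℤ)) • ξ)) (1 - χ ξ)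
  sum_int : ∀ ξ, ξ ≠ 0 → HasSum (fun j : ℤ => φ ((2 : ℝ) ^ (-j) • ξ)) 1

section Existence

def bump (ξ : R3) : ℝ := Real.smoothTransition (25 / 16 - ‖ξ‖ ^ 2)

lemma bump_one {ξ : R3} (h : ‖ξ‖ ≤ 3 / 4) : bump ξ = 1 :=
  Real.smoothTransition.one_of_one_le (by nlinarith [norm_nonneg ξ])

lemma bump_zero {ξ : R3} (h : 5 / 4 ≤ ‖ξ‖) : bump ξ = 0 :=
  Real.smoothTransition.zero_of_nonpos (by nlinarith [norm_nonneg ξ])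

lemma bump_smooth : ContDiff ℝ ∞ bump :=
  Real.smoothTransition.contDiff.comp (contDiff_const.sub (contDiff_norm_sq ℝ))

lemma bump_diff_nonneg (ξ : R3) : 0 ≤ bump ((2 : ℝ)⁻¹ • ξ) - bump ξ := by
  rw [sub_nonneg]
  apply Real.smoothTransition.monotone
  rw [norm_smul]
  norm_num
  nlinarith [norm_nonneg ξ]

lemma bump_step (ξ : R3) (j : ℤ) :
    bump ((2 : ℝ)⁻¹ • (2 : ℝ) ^ (-j) • ξ) - bump ((2 : ℝ) ^ (-j) • ξ) =
      bump ((2 : ℝ) ^ (-(j + 1)) • ξ) - bump ((2 : ℝ) ^ (-j) • ξ) := by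
  rw [smul_smul, neg_add, zpow_add₀ two_ne_zero, mul_comm, zpow_neg_one]

lemma bump_sum_nat (ξ : R3) :
    HasSum (fun j : ℕ => bump ((2 : ℝ)⁻¹ • (2 : ℝ) ^ (-(j : ℤ)) • ξ) -
      bump ((2 : ℝ) ^ (-(j : ℤ)) • ξ)) (1 - bump ξ) := by
  rw [hasSum_iff_tendsto_nat_of_nonneg (fun _ => bump_diff_nonneg _)]
  have h : ∀ n : ℕ, ∑ j ∈ Finset.range n, (bump ((2 : ℝ)⁻¹ • (2 : ℝ) ^ (-(j : ℤ)) • ξ) -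
      bump ((2 : ℝ) ^ (-(j : ℤ)) • ξ)) = bump ((2⁻¹ : ℝ) ^ n • ξ) - bump ξ := by
    intro n
    have := Finset.sum_range_sub (fun j : ℕ => bump ((2 : ℝ) ^ (-(j : ℤ)) • ξ)) n
    simp only [Nat.cast_zero, neg_zero, zpow_zero, one_smul] at this
    rw [inv_pow, ← zpow_natCast, ← zpow_neg, ← this]
    refine Finset.sum_congr rfl fun j _ => ?_
    rw [bump_step, Nat.cast_succ]
  simp only [h]
  refine Tendsto.sub_const ?_ _
  have h0 : Tendsto (fun n : ℕ => (2⁻¹ : ℝ) ^ n • ξ) atTop (𝓝 ((0 : ℝ) • ξ)) :=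
    (tendsto_pow_atTop_nhds_zero_of_lt_one (by norm_num) (by norm_num)).smul_const ξ
  have h1 := (bump_smooth.continuous.tendsto ((0 : ℝ) • ξ)).comp h0
  rwa [bump_one (by norm_num)] at h1

lemma bump_sum_neg (ξ : R3) (hξ : ξ ≠ 0) :
    HasSum (fun j : ℕ => bump ((2 : ℝ)⁻¹ • (2 : ℝ) ^ (-(-((j : ℤ) + 1))) • ξ) -
      bump ((2 : ℝ) ^ (-(-((j : ℤ) + 1))) • ξ)) (bump ξ) := by
  rw [hasSum_iff_tendsto_nat_of_nonneg (fun _ => bump_diff_nonneg _)]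
  have h : ∀ n : ℕ, ∑ j ∈ Finset.range n,
      (bump ((2 : ℝ)⁻¹ • (2 : ℝ) ^ (-(-((j : ℤ) + 1))) • ξ) -
        bump ((2 : ℝ) ^ (-(-((j : ℤ) + 1))) • ξ)) = bump ξ - bump ((2 : ℝ) ^ n • ξ) := by
    intro n
    have := Finset.sum_range_sub' (fun j : ℕ => bump ((2 : ℝ) ^ j • ξ)) n
    simp only [pow_zero, one_smul] at this
    rw [← this]
    refine Finset.sum_congr rfl fun j _ => ?_
    rw [bump_step, ← zpow_natCast, ← zpow_natCast]
    simp
  simp only [h]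
  have h0 : ∀ᶠ n : ℕ in atTop, bump ((2 : ℝ) ^ n • ξ) = 0 := by
    have hpos : 0 < ‖ξ‖ := norm_pos_iff.mpr hξ
    have := (tendsto_pow_atTop_atTop_of_one_lt (one_lt_two : (1 : ℝ) < 2)).eventually_ge_atTop
      (5 / 4 / ‖ξ‖)
    filter_upwards [this] with n hn
    apply bump_zero
    rw [norm_smul, norm_pow, Real.norm_two]
    exact (div_le_iff₀ hpos).mp hn
  refine Tendsto.congr' ?_ tendsto_const_nhds
  filter_upwards [h0] with n hn
  simp [hn]

/-- Dyadic partitions of unity exist. -/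
theorem DyadicPartition.nonempty : Nonempty DyadicPartition :=
  ⟨{ χ := bump
     φ := fun ξ => bump ((2 : ℝ)⁻¹ • ξ) - bump ξ
     χ_smooth := bump_smooth
     φ_smooth := (bump_smooth.comp (contDiff_const_smul _)).sub bump_smooth
     χ_supp := by
       have h : tsupport bump ⊆ Metric.closedBall 0 (5 / 4) := by
         refine closure_minimal (fun ξ hξ => ?_) Metric.isClosed_closedBall
         rw [mem_closedBall_zero_iff]
         by_contra hc
         exact hξ (bump_zero (not_le.mp hc).le)
       exact h.trans (Metric.closedBall_subset_ball (by norm_num))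
     φ_supp := by
       refine closure_minimal (fun ξ hξ => ?_) ((isClosed_le continuous_const continuous_norm).inter
         (isClosed_le continuous_norm continuous_const))
       have hn : ‖(2 : ℝ)⁻¹ • ξ‖ = 2⁻¹ * ‖ξ‖ := by rw [norm_smul]; norm_num
       constructor
       · by_contra hc
         apply hξ
         have hc' : ‖ξ‖ < 3 / 4 := not_le.mp hc
         simp only [bump_one hc'.le, bump_one (ξ := (2 : ℝ)⁻¹ • ξ)
           (by rw [hn]; linarith [norm_nonneg ξ]), sub_self]
       · by_contra hc
         apply hξ
         have hc' : 8 / 3 < ‖ξ‖ := not_le.mp hc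
         simp only [bump_zero (ξ := ξ) (by linarith), bump_zero (ξ := (2 : ℝ)⁻¹ • ξ)
           (by rw [hn]; linarith), sub_self]
     φ_nonneg := bump_diff_nonneg
     φ_radial := fun ξ η h => by simp only [bump, norm_smul, h]
     sum_nat := bump_sum_nat
     sum_int := fun ξ hξ => by
       have := HasSum.of_nat_of_neg_add_one
         (f := fun j : ℤ => bump ((2 : ℝ)⁻¹ • (2 : ℝ) ^ (-j) • ξ) - bump ((2 : ℝ) ^ (-j) • ξ))
         (bump_sum_nat ξ) (bump_sum_neg ξ hξ)
       simpa using this }⟩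

end Existence

variable {V : Type*} [NormedAddCommGroup V] [NormedSpace ℝ V]

/-- The convolution kernel of the Fourier multiplier `m(D)` for a real and even symbol `m`: the
inverse Fourier transform `x ↦ (2π)⁻³ ∫ m(ξ) exp(i x·ξ) dξ`, which is real-valued. The library's
`𝓕⁻` has the phase `exp(2πi x·v)`, whence the substitution `ξ = 2πv`. -/
def kernel (m : R3 → ℝ) (x : R3) : ℝ :=
  (𝓕⁻ (fun v : R3 => ((m ((2 * Real.pi) • v) : ℝ) : ℂ)) x).re

/-- The Fourier multiplier `m(D) f`: convolution of `f` with the kernel of `m`. -/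
def multiplier (m : R3 → ℝ) (f : R3 → V) : R3 → V :=
  kernel m ⋆[ContinuousLinearMap.lsmul ℝ ℝ, volume] f

namespace DyadicPartition

variable (P : DyadicPartition)

/-- The homogeneous Littlewood–Paley block `Δ̇_j f = φ(2^{-j} D) f`. -/
def block (j : ℤ) (f : R3 → V) : R3 → V :=
  multiplier (fun ξ => P.φ ((2 : ℝ) ^ (-j) • ξ)) f

/-- The low frequency truncation `Ṡ_j f = χ(2^{-j} D) f`. -/
def trunc (j : ℤ) (f : R3 → V) : R3 → V :=
  multiplier (fun ξ => P.χ ((2 : ℝ) ^ (-j) • ξ)) f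

/-- The homogeneous Besov norm `‖(2^{js} ‖Δ̇_j f‖_{L^p})_j‖_{ℓ^q(ℤ)}`. -/
def besovNorm (s : ℝ) (p q : ℝ≥0∞) (f : R3 → V) : ℝ≥0∞ :=
  eLpNorm (fun j : ℤ => (2 : ℝ≥0∞) ^ ((j : ℝ) * s) * eLpNorm (P.block j f) p volume)
    q Measure.count

/-- A function `f` (as a tempered distribution) belongs to the homogeneous Besov space
`Ḃ^s_{p,q}(ℝ³)`: its norm is finite and `∑_j Δ̇_j f` converges to `f` in the sense of tempered
distributions. -/
def MemBesov (s : ℝ) (p q : ℝ≥0∞) (f : R3 → V) : Prop :=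
  P.besovNorm s p q f < ⊤ ∧
    ∀ ψ : 𝓢(R3, ℝ), HasSum (fun j : ℤ => ∫ x, ψ x • P.block j f x) (∫ x, ψ x • f x)

end DyadicPartition

/-! ### Norms in space-time -/

/-- The `L^r(0,T)` norm of a function of time with values in `[0,∞]`. -/
def timeNorm (r : ℝ≥0∞) (T : ℝ) (g : ℝ → ℝ≥0∞) : ℝ≥0∞ :=
  eLpNorm g r (volume.restrict (Ioo 0 T))

/-- The Chemin–Lerner norm `‖(2^{js} ‖Δ̇_j u‖_{L^r(0,T;L^p)})_j‖_{ℓ^q(ℤ)}` of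
`L̃^r_T(Ḃ^s_{p,q})`. -/
def DyadicPartition.cheminLernerNorm (P : DyadicPartition) (r : ℝ≥0∞) (T s : ℝ) (p q : ℝ≥0∞)
    (u : ℝ → R3 → V) : ℝ≥0∞ :=
  eLpNorm (fun j : ℤ => (2 : ℝ≥0∞) ^ ((j : ℝ) * s) *
    timeNorm r T (fun t => eLpNorm (P.block j (u t)) p volume)) q Measure.count

/-! ### Sobolev norms -/

/-- The inclusion `ℝ³ → ℂ³`. -/
def toComplex : R3 →L[ℝ] EuclideanSpace ℂ (Fin 3) :=
  LinearMap.toContinuousLinearMap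
    { toFun := fun x => WithLp.toLp 2 fun i => ((x i : ℝ) : ℂ)
      map_add' := fun x y => by ext i; simp
      map_smul' := fun a x => by ext i; simp }

/-- The unitary Fourier transform of an `L²` vector field, in the variable `v = ξ / 2π`. -/
def fourierL2 (f : L2Field) : Lp (EuclideanSpace ℂ (Fin 3)) 2 (volume : Measure R3) :=
  𝓕 (toComplex.compLp f)

/-- The homogeneous norm `‖ |ξ|^α f̂ ‖_{L²}` of `Ḣ^α`. -/
def homSobolevNorm (α : ℝ) (f : L2Field) : ℝ≥0∞ :=
  eLpNorm (fun v : R3 => (2 * Real.pi * ‖v‖) ^ α • fourierL2 f v) 2 volume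

/-- The inhomogeneous norm `‖ (1 + |ξ|²)^{α/2} f̂ ‖_{L²}` of `H^α`. -/
def sobolevNorm (α : ℝ) (f : L2Field) : ℝ≥0∞ :=
  eLpNorm (fun v : R3 => (1 + (2 * Real.pi * ‖v‖) ^ 2) ^ (α / 2) • fourierL2 f v) 2 volume

/-- `U ∈ L^∞(0,T; H^α)`. -/
def MemLinftySobolev (T α : ℝ) (U : ℝ → L2Field) : Prop :=
  AEStronglyMeasurable U (volume.restrict (Ioo 0 T)) ∧
    timeNorm ∞ T (fun t => sobolevNorm α (U t)) < ⊤

/-! ### Solenoidal fields, the heat flow and the Reynolds stress -/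

/-- The space `J(ℝ³)` of square integrable vector fields whose distributional divergence
vanishes. -/
def J : Set L2Field :=
  {u | ∀ ψ : R3 → ℝ, ContDiff ℝ ∞ ψ → HasCompactSupport ψ → ∫ x, fderiv ℝ ψ x (u x) = 0}

/-- The heat kernel `(4πt)^{-3/2} exp(-|x|²/4t)` on `ℝ³`, for `t > 0`. -/
def heatKernel (t : ℝ) (x : R3) : ℝ :=
  (4 * Real.pi * t) ^ (-(3 / 2) : ℝ) * Real.exp (-‖x‖ ^ 2 / (4 * t))

/-- The heat flow `t ↦ e^{tΔ} u`, for `t > 0`. -/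
def heatFlow (u : R3 → R3) (t : ℝ) : R3 → R3 :=
  heatKernel t ⋆[ContinuousLinearMap.lsmul ℝ ℝ, volume] u

/-- The tensor product `(a ⊗ b)_{ik} = a_i b_k` of two vector fields. -/
def tensor (a b : R3 → R3) : R3 → M3 :=
  fun x => WithLp.toLp 2 fun ik => a x ik.1 * b x ik.2

/-- The Reynolds stress `F_j = F_j^{(1)} + ⋯ + F_j^{(6)}` at a fixed time, where `U` is the velocity
and `e = e^{tΔ} u₀²` the heat flow at that time. -/
def stress (P : DyadicPartition) (j : ℤ) (U e : R3 → R3) : R3 → M3 :=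
  (tensor (P.trunc j U) (P.trunc j U) - P.trunc j (tensor U U))
    + tensor (e - P.trunc j e) (P.trunc j U)
    + (tensor (P.trunc j e) (P.trunc j U) - P.trunc j (tensor e U))
    + tensor (P.trunc j U) (e - P.trunc j e)
    + (tensor (P.trunc j U) (P.trunc j e) - P.trunc j (tensor U e))
    + (tensor e e - P.trunc j (tensor e e))

end ReynoldsStress

end

open ReynoldsStress

/-!
The stress `F_j` is a sum of commutators `Ṡ_j a ⊗ Ṡ_j b - Ṡ_j (a ⊗ b)`, of
`e ⊗ e - Ṡ_j (e ⊗ e)` and of products `(e - Ṡ_j e) ⊗ Ṡ_j U`, all of which only see high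
frequencies. With `J = j - 3`, the product `Ṡ_J a ⊗ Ṡ_J b` has its frequencies in the sum of two
balls of radius `2^J · 4/3`, where the symbol of `Ṡ_j` is one, and so `Ṡ_j` leaves it unchanged
(`trunc_tensor_trunc`). The commutator therefore does not change when `Ṡ_J a ⊗ Ṡ_J b` is subtracted
from both of its terms, and what remains is estimated through the telescoping identity
`a ⊗ b - Ṡ_J a ⊗ Ṡ_J b = ∑_{k ≥ J} (Δ̇_k a ⊗ Ṡ_{k+1} b + Ṡ_k a ⊗ Δ̇_k b)`.
In this way `‖F_j‖_{L²}` is bounded by the paraproducts `Δ̇_k a ⊗ Ṡ_l b`, `l ≤ k + 1`, `k ≥ j - 3`,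
with `a, b ∈ {U, e}`; see `eLpNorm_stress_le`.

Each kind of paraproduct is bounded by Hölder's inequality and summed geometrically over `k`.

* For `a = U`, the block `Δ̇_k U` gains `2^{-kα}` on `Ḣ^α`, and `Ṡ_l b` is bounded in `L^∞` by the
  frequencies below one, in `Ḃ^{-1}_{∞,∞}`, and by at most `k + 1` further blocks, each in
  `L²(0,T; L^∞)`. The number of these blocks is the origin of the factor `j`
  (`dominatedSeries_homSobolev`).
* For `a = e` and `b = U`, the block is measured in `L^p` and `Ṡ_l U` in the conjugate `L^q`,
  `1/p + 1/q = 1/2`, between `L²` and the bound `2^k ‖U‖` in `L^∞` that comes from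
  `Ḃ^{-1}_{∞,∞}` (`dominatedSeries_interpolation`).
* For `a = b = e`, the second factor is bounded in `L²`, and the first one in `L^∞` by Bernstein's
  inequality and the smoothing of the heat flow (`dominatedSeries_heat`).

The smoothing estimate `‖e^{tΔ} Δ̇_k u‖_{L^p} ≲ min(1, 4^{-k}/t) ‖Δ̇_k u‖_{L^p}`
(`eLpNorm_block_heat_le`) follows from `0 ≤ h_t ≤ (s/t)^{3/2} h_s` for `t ≤ s`: as both heat
kernels have mass one, `h_t - h_{t + 4^{-k}}` is of size `4^{-k}/t` in `L¹` for `t ≥ 4^{-k}`, and on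
the frequencies `|ξ| ∼ 2^k` the operator `1 - exp(4^{-k} Δ)` is inverted by a multiplier with a
smooth compactly supported symbol.

For the second assertion it remains to check that all the norms are finite and that the factor `j`
is absorbed by half of the decay `2^{-jα}`.
-/

noncomputable section

namespace ReynoldsStress

/-! ### Convolution inequalities -/

section Young

variable {V : Type*} [NormedAddCommGroup V] [NormedSpace ℝ V]

/-- Convolution on `ℝ³` of a real kernel with a vector-valued function. -/
abbrev conv (K : R3 → ℝ) (f : R3 → V) : R3 → V :=
  K ⋆[ContinuousLinearMap.lsmul ℝ ℝ, volume] f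

lemma conv_apply (K : R3 → ℝ) (f : R3 → V) (x : R3) :
    conv K f x = ∫ y, K y • f (x - y) := rfl

lemma conv_congr_ae (K : R3 → ℝ) {f g : R3 → V} (h : f =ᵐ[volume] g) : conv K f = conv K g := by
  ext x
  rw [conv_apply, conv_apply]
  refine integral_congr_ae ?_
  have := (quasiMeasurePreserving_sub_left (volume : Measure R3) x).ae_eq_comp h
  filter_upwards [this] with y hy
  simp only [Function.comp] at hy
  rw [hy]

lemma enorm_conv_le (K : R3 → ℝ) (f : R3 → V) (x : R3) :
    ‖conv K f x‖ₑ ≤ ∫⁻ y, ‖K y‖ₑ * ‖f (x - y)‖ₑ := by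
  rw [conv_apply]
  refine (enorm_integral_le_lintegral_enorm _).trans (le_of_eq ?_)
  simp only [enorm_smul]

lemma aestronglyMeasurable_conv {K : R3 → ℝ} {f : R3 → V} (hK : AEStronglyMeasurable K volume)
    (hf : AEStronglyMeasurable f volume) : AEStronglyMeasurable (conv K f) volume :=
  (hK.convolution_integrand (ContinuousLinearMap.lsmul ℝ ℝ) hf).integral_prod_right'

/-- Hölder's inequality against a density `k`. -/
lemma lintegral_mul_rpow_le {α : Type*} [MeasurableSpace α] {μ : Measure α} {k g : α → ℝ≥0∞}
    (hk : AEMeasurable k μ) (hg : AEMeasurable g μ) {p : ℝ} (hp : 1 ≤ p) :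
    ∫⁻ x, k x * g x ∂μ ≤ (∫⁻ x, k x ∂μ) ^ (1 - 1 / p) * (∫⁻ x, k x * g x ^ p ∂μ) ^ (1 / p) := by
  have hp0 : 0 < p := by linarith
  have h1 : 0 ≤ 1 - 1 / p := by
    rw [sub_nonneg, div_le_one hp0]; exact hp
  refine le_trans (le_of_eq ?_) (ENNReal.lintegral_mul_norm_pow_le hk (hk.mul (hg.pow_const p))
    h1 (by positivity) (by ring))
  refine lintegral_congr fun x => ?_
  simp only [Pi.mul_apply]
  rw [ENNReal.mul_rpow_of_nonneg _ _ (by positivity : 0 ≤ 1 / p), ← mul_assoc,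
    ← ENNReal.rpow_add_of_nonneg _ _ h1 (by positivity), ← ENNReal.rpow_mul,
    mul_one_div_cancel hp0.ne']
  simp

/-- Young's convolution inequality `L¹ ⋆ Lᵖ ⊆ Lᵖ`. -/
theorem eLpNorm_conv_le {K : R3 → ℝ} {f : R3 → V} (hKi : Integrable K volume)
    (hf : AEStronglyMeasurable f volume) {p : ℝ≥0∞} (hp : 1 ≤ p) :
    eLpNorm (conv K f) p volume ≤ (∫⁻ y, ‖K y‖ₑ) * eLpNorm f p volume := by
  have hK := hKi.aestronglyMeasurable
  rcases eq_or_ne p ∞ with rfl | hpt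
  · rw [eLpNorm_exponent_top, eLpNorm_exponent_top]
    refine essSup_le_of_ae_le _ (Eventually.of_forall fun x => ?_)
    refine (enorm_conv_le K f x).trans ?_
    rw [← lintegral_mul_const'' _ hK.enorm]
    refine lintegral_mono_ae ?_
    have := (quasiMeasurePreserving_sub_left (volume : Measure R3) x).ae
      (enorm_ae_le_eLpNormEssSup f volume)
    filter_upwards [this] with y hy
    gcongr
  · have hp0 : p ≠ 0 := (zero_lt_one.trans_le hp).ne'
    have hr : 1 ≤ p.toReal := by
      rw [← ENNReal.toReal_one]; exact ENNReal.toReal_mono hpt hp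
    set r := p.toReal with hrdef
    have hr0 : 0 < r := by linarith
    rw [eLpNorm_eq_lintegral_rpow_enorm_toReal hp0 hpt,
      eLpNorm_eq_lintegral_rpow_enorm_toReal hp0 hpt, ← hrdef]
    have hA : ∀ x, ‖conv K f x‖ₑ ^ r ≤
        (∫⁻ y, ‖K y‖ₑ) ^ (r - 1) * ∫⁻ y, ‖K y‖ₑ * ‖f (x - y)‖ₑ ^ r := by
      intro x
      have hfx : AEMeasurable (fun y => ‖f (x - y)‖ₑ) volume :=
        (hf.comp_quasiMeasurePreserving
          (quasiMeasurePreserving_sub_left (volume : Measure R3) x)).enorm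
      refine (ENNReal.rpow_le_rpow ((enorm_conv_le K f x).trans
        (lintegral_mul_rpow_le hK.enorm hfx hr)) hr0.le).trans (le_of_eq ?_)
      rw [ENNReal.mul_rpow_of_nonneg _ _ hr0.le, ← ENNReal.rpow_mul, ← ENNReal.rpow_mul,
        one_div_mul_cancel hr0.ne', ENNReal.rpow_one]
      congr 2
      field_simp
    have hB : ∫⁻ x, ∫⁻ y, ‖K y‖ₑ * ‖f (x - y)‖ₑ ^ r = (∫⁻ y, ‖K y‖ₑ) * ∫⁻ x, ‖f x‖ₑ ^ r := by
      rw [lintegral_lintegral_swap, ← lintegral_mul_const'' _ hK.enorm]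
      · refine lintegral_congr fun y => ?_
        rw [lintegral_const_mul' _ _ enorm_ne_top,
          lintegral_sub_right_eq_self (fun x => ‖f x‖ₑ ^ r) y]
      · have h1 : AEMeasurable (fun z : R3 × R3 => ‖K z.2‖ₑ) (volume.prod volume) :=
          hK.comp_snd.enorm
        have h2 : AEMeasurable (fun z : R3 × R3 => ‖f (z.1 - z.2)‖ₑ) (volume.prod volume) :=
          (hf.comp_quasiMeasurePreserving
            (quasiMeasurePreserving_sub_of_right_invariant volume volume)).enorm
        exact h1.mul (h2.pow_const r)
    calc (∫⁻ x, ‖conv K f x‖ₑ ^ r) ^ (1 / r)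
        ≤ (∫⁻ x, (∫⁻ y, ‖K y‖ₑ) ^ (r - 1) * ∫⁻ y, ‖K y‖ₑ * ‖f (x - y)‖ₑ ^ r) ^ (1 / r) := by
          gcongr with x
          exact hA x
      _ ≤ ((∫⁻ y, ‖K y‖ₑ) ^ (r - 1) * ((∫⁻ y, ‖K y‖ₑ) * ∫⁻ x, ‖f x‖ₑ ^ r)) ^ (1 / r) := by
          rw [lintegral_const_mul' _ _ (ENNReal.rpow_ne_top_of_nonneg (by linarith) hKi.2.ne), hB]
      _ = (∫⁻ y, ‖K y‖ₑ) * (∫⁻ x, ‖f x‖ₑ ^ r) ^ (1 / r) := by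
          rw [← mul_assoc, ENNReal.mul_rpow_of_nonneg _ _ (by positivity)]
          congr 1
          nth_rewrite 2 [← ENNReal.rpow_one (∫⁻ y, ‖K y‖ₑ)]
          rw [← ENNReal.rpow_add_of_nonneg _ _ (by linarith) zero_le_one, ← ENNReal.rpow_mul]
          have : (r - 1 + 1) * (1 / r) = 1 := by field_simp; ring
          rw [this, ENNReal.rpow_one]

/-- The endpoint of Young's inequality with values in `L^∞`, the conjugate norm of the kernel being
interpolated between `L¹` and `L^∞`. -/
theorem enorm_conv_le_of_eLpNorm {K : R3 → ℝ} {f : R3 → V} (hK : AEStronglyMeasurable K volume)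
    (hf : AEStronglyMeasurable f volume) {p : ℝ} (hp : 1 ≤ p) (x : R3) :
    ‖conv K f x‖ₑ ≤ (∫⁻ y, ‖K y‖ₑ) ^ (1 - 1 / p) * eLpNorm K ∞ volume ^ (1 / p) *
      eLpNorm f (ENNReal.ofReal p) volume := by
  have hp0 : 0 < p := by linarith
  have hfx : AEMeasurable (fun y => ‖f (x - y)‖ₑ) volume :=
    (hf.comp_quasiMeasurePreserving
      (quasiMeasurePreserving_sub_left (volume : Measure R3) x)).enorm
  refine (enorm_conv_le K f x).trans ((lintegral_mul_rpow_le hK.enorm hfx hp).trans ?_)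
  rw [mul_assoc]
  gcongr
  rw [eLpNorm_eq_lintegral_rpow_enorm_toReal (by simpa using hp0) ENNReal.ofReal_ne_top,
    ENNReal.toReal_ofReal hp0.le, ← ENNReal.mul_rpow_of_nonneg _ _ (by positivity)]
  gcongr
  rw [← lintegral_sub_left_eq_self (fun y => ‖f y‖ₑ ^ p) x,
    ← lintegral_const_mul'' _ (hfx.pow_const p)]
  refine lintegral_mono_ae ?_
  filter_upwards [enorm_ae_le_eLpNormEssSup K volume] with y hy
  rw [eLpNorm_exponent_top]
  gcongr

/-- Interpolation of `L^q`, `q ≥ 2`, between `L²` and `L^∞`. -/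
theorem eLpNorm_le_interpolation {α E : Type*} [NormedAddCommGroup E] [MeasurableSpace α]
    {μ : Measure α} {g : α → E}
    (hg : AEStronglyMeasurable g μ) {q : ℝ} (hq : 2 ≤ q) :
    eLpNorm g (ENNReal.ofReal q) μ ≤
      eLpNorm g ∞ μ ^ (1 - 2 / q) * eLpNorm g 2 μ ^ (2 / q) := by
  have hq0 : 0 < q := by linarith
  rw [eLpNorm_eq_lintegral_rpow_enorm_toReal (by simpa using hq0) ENNReal.ofReal_ne_top,
    ENNReal.toReal_ofReal hq0.le,
    eLpNorm_eq_lintegral_rpow_enorm_toReal two_ne_zero ENNReal.ofNat_ne_top, eLpNorm_exponent_top]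
  simp only [ENNReal.toReal_ofNat]
  rw [← ENNReal.rpow_mul]
  have e1 : (1 - 2 / q) = (q - 2) * (1 / q) := by field_simp
  have e2 : 1 / (2 : ℝ) * (2 / q) = 1 / q := by field_simp
  rw [e1, e2, ENNReal.rpow_mul, ← ENNReal.mul_rpow_of_nonneg _ _ (by positivity)]
  gcongr
  rw [← lintegral_const_mul'' _ (hg.enorm.pow_const _)]
  refine lintegral_mono_ae ?_
  filter_upwards [enorm_ae_le_eLpNormEssSup g μ] with y hy
  calc ‖g y‖ₑ ^ q = ‖g y‖ₑ ^ (q - 2) * ‖g y‖ₑ ^ (2 : ℝ) := by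
        rw [← ENNReal.rpow_add_of_nonneg _ _ (by linarith) (by norm_num)]
        congr 1; ring
    _ ≤ _ := by gcongr

end Young

/-! ### Norms of functions of time -/

/-- Minkowski's inequality for a series of nonnegative functions of time. -/
theorem timeNorm_tsum_le {T : ℝ} {f : ℕ → ℝ → ℝ≥0∞}
    (hf : ∀ i, AEMeasurable (f i) (volume.restrict (Ioo 0 T))) :
    timeNorm 2 T (fun t => ∑' i, f i t) ≤ ∑' i, timeNorm 2 T (f i) := by
  unfold timeNorm
  have hfin : ∀ n : ℕ, eLpNorm (fun t => ∑ i ∈ Finset.range n, f i t) 2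
      (volume.restrict (Ioo 0 T)) ≤ ∑' i, eLpNorm (f i) 2 (volume.restrict (Ioo 0 T)) := by
    intro n
    refine le_trans ?_ (ENNReal.sum_le_tsum (Finset.range n))
    induction n with
    | zero => simp
    | succ n ih =>
      simp only [Finset.sum_range_succ]
      refine (eLpNorm_add_le ?_ (hf n).aestronglyMeasurable (by norm_num)).trans
        (add_le_add_left ih _)
      exact (Finset.aemeasurable_fun_sum _ fun i _ => hf i).aestronglyMeasurable
  have hsup : ∀ t, (∑' i, f i t) ^ (2 : ℝ) =
      ⨆ n : ℕ, (∑ i ∈ Finset.range n, f i t) ^ (2 : ℝ) := by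
    intro t
    rw [ENNReal.tsum_eq_iSup_nat]
    exact (ENNReal.orderIsoRpow 2 two_pos).map_iSup _
  rw [eLpNorm_eq_lintegral_rpow_enorm_toReal two_ne_zero ENNReal.ofNat_ne_top]
  simp only [enorm_eq_self, ENNReal.toReal_ofNat, hsup]
  rw [lintegral_iSup' (fun n => (Finset.aemeasurable_fun_sum _ fun i _ => hf i).pow_const _)
    (Eventually.of_forall fun t => fun a b hab => by
      dsimp only
      gcongr)]
  rw [show (⨆ n : ℕ, ∫⁻ t in Ioo 0 T, (∑ i ∈ Finset.range n, f i t) ^ (2 : ℝ)) ^ (1 / 2 : ℝ) =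
      ⨆ n : ℕ, (∫⁻ t in Ioo 0 T, (∑ i ∈ Finset.range n, f i t) ^ (2 : ℝ)) ^ (1 / 2 : ℝ) from
      (ENNReal.orderIsoRpow (1 / 2) (by norm_num)).map_iSup _]
  refine iSup_le fun n => ?_
  have := hfin n
  rw [eLpNorm_eq_lintegral_rpow_enorm_toReal two_ne_zero ENNReal.ofNat_ne_top] at this
  simpa only [enorm_eq_self, ENNReal.toReal_ofNat] using this

lemma timeNorm_mono {r : ℝ≥0∞} {T : ℝ} {f g : ℝ → ℝ≥0∞}
    (h : ∀ᵐ t ∂(volume.restrict (Ioo 0 T)), f t ≤ g t) : timeNorm r T f ≤ timeNorm r T g :=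
  eLpNorm_mono_enorm_ae (by simpa only [enorm_eq_self] using h)

lemma ae_le_timeNorm_top (T : ℝ) (f : ℝ → ℝ≥0∞) :
    ∀ᵐ t ∂(volume.restrict (Ioo 0 T)), f t ≤ timeNorm ∞ T f := by
  have := enorm_ae_le_eLpNormEssSup f (volume.restrict (Ioo 0 T))
  simpa only [enorm_eq_self, timeNorm, eLpNorm_exponent_top] using this

lemma timeNorm_top_le {T : ℝ} {f : ℝ → ℝ≥0∞} {C : ℝ≥0∞}
    (h : ∀ᵐ t ∂(volume.restrict (Ioo 0 T)), f t ≤ C) : timeNorm ∞ T f ≤ C := by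
  rw [timeNorm, eLpNorm_exponent_top]
  exact essSup_le_of_ae_le _ (by simpa only [enorm_eq_self, EventuallyLE] using h)

lemma timeNorm_two_eq (T : ℝ) (f : ℝ → ℝ≥0∞) :
    timeNorm 2 T f = (∫⁻ t in Ioo 0 T, f t ^ (2 : ℝ)) ^ (1 / 2 : ℝ) := by
  rw [timeNorm, eLpNorm_eq_lintegral_rpow_enorm_toReal two_ne_zero ENNReal.ofNat_ne_top]
  simp only [enorm_eq_self, ENNReal.toReal_ofNat]

lemma timeNorm_const_mul {T : ℝ} {c : ℝ≥0∞} {f : ℝ → ℝ≥0∞}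
    (hf : AEMeasurable f (volume.restrict (Ioo 0 T))) :
    timeNorm 2 T (fun t => c * f t) = c * timeNorm 2 T f := by
  simp only [timeNorm_two_eq, ENNReal.mul_rpow_of_nonneg _ _ (zero_le_two (α := ℝ))]
  rw [lintegral_const_mul'' _ (hf.pow_const _), ENNReal.mul_rpow_of_nonneg _ _ (by norm_num),
    ← ENNReal.rpow_mul]
  norm_num

lemma timeNorm_const {T : ℝ} (c : ℝ≥0∞) :
    timeNorm 2 T (fun _ => c) = ENNReal.ofReal T ^ (1 / 2 : ℝ) * c := by
  rw [timeNorm_two_eq, lintegral_const, ENNReal.mul_rpow_of_nonneg _ _ (by norm_num),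
    ← ENNReal.rpow_mul, mul_comm]
  norm_num

/-- A seminorm-like functional on `L²` that is bounded by the `L²` norm is continuous. -/
lemma continuous_of_subadditive {N : L2Field → ℝ≥0∞} {C : ℝ≥0∞} (hC : C ≠ ⊤)
    (hsub : ∀ u v, N u ≤ N v + N (u - v)) (hN : ∀ u, N u ≤ C * ‖u‖ₑ) : Continuous N := by
  have hfin : ∀ u, N u ≠ ⊤ := fun u =>
    ((hN u).trans_lt (ENNReal.mul_lt_top hC.lt_top enorm_lt_top)).ne
  rw [continuous_iff_continuousAt]
  intro v
  have hb : Tendsto (fun u : L2Field => C * ‖u - v‖ₑ) (𝓝 v) (𝓝 0) := by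
    have h1 : Tendsto (fun u : L2Field => ‖u - v‖ₑ) (𝓝 v) (𝓝 0) := by
      have : Continuous fun u : L2Field => ‖u - v‖ₑ := by fun_prop
      simpa using this.tendsto v
    simpa using ENNReal.Tendsto.const_mul h1 (Or.inr hC)
  rw [ContinuousAt, ENNReal.tendsto_nhds (hfin v)]
  intro ε hε
  filter_upwards [ENNReal.tendsto_nhds_zero.1 hb ε hε] with u hu
  constructor
  · rw [tsub_le_iff_right]
    refine (hsub v u).trans (add_le_add_right ((hN _).trans ?_) _)
    rw [← neg_sub, enorm_neg]; exact hu
  · exact (hsub u v).trans (add_le_add_right ((hN _).trans hu) _)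

/-! ### The Fourier transform of convolutions of square integrable fields -/

/-- Complex vectors. -/
abbrev C3 : Type := EuclideanSpace ℂ (Fin 3)

/-- The Fourier integral is symmetric for the bilinear pairing of functions. -/
lemma integral_fourier_smul_eq {F : Type*} [NormedAddCommGroup F] [NormedSpace ℂ F]
    [CompleteSpace F] {f : R3 → ℂ} {g : R3 → F} (hf : Integrable f) (hg : Integrable g) :
    ∫ ξ, 𝓕 f ξ • g ξ = ∫ x, f x • 𝓕 g x := by
  have := VectorFourier.integral_fourierIntegral_smul_eq_flip (μ := (volume : Measure R3))
    (ν := (volume : Measure R3)) (L := innerₗ R3) Real.continuous_fourierChar continuous_inner hf hg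
  rwa [flip_innerₗ] at this

/-- The Fourier transform on `L²` is given by the Fourier integral on integrable functions. -/
theorem fourier_Lp_ae_eq {F : Type*} [NormedAddCommGroup F] [InnerProductSpace ℂ F]
    [CompleteSpace F] (g : Lp F 2 (volume : Measure R3)) (hg : Integrable g) :
    ((𝓕 g : Lp F 2 (volume : Measure R3)) : R3 → F) =ᵐ[volume] 𝓕 (g : R3 → F) := by
  have hc : Continuous (𝓕 (g : R3 → F)) :=
    VectorFourier.fourierIntegral_continuous Real.continuous_fourierChar continuous_inner hg
  -- Both sides are locally integrable and agree against real test functions.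
  refine ae_eq_of_integral_contDiff_smul_eq
    ((Lp.memLp (𝓕 g : Lp F 2 (volume : Measure R3))).locallyIntegrable (by norm_num))
    hc.locallyIntegrable fun φ hφ hφc => ?_
  have hs : HasCompactSupport (fun x => (φ x : ℂ)) := hφc.comp_left (g := Complex.ofReal) rfl
  let ψ : 𝓢(R3, ℂ) := hs.toSchwartzMap (Complex.ofRealCLM.contDiff.comp hφ)
  have hψ : ∀ x, ψ x = (φ x : ℂ) := fun x => rfl
  have key := congrArg (fun D : 𝓢'(R3, F) => D ψ) (Lp.fourier_toTemperedDistribution_eq g)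
  simp only [TemperedDistribution.fourier_apply, Lp.toTemperedDistribution_apply,
    SchwartzMap.fourier_coe] at key
  rw [integral_fourier_smul_eq ψ.integrable hg] at key
  simpa only [hψ, Complex.coe_smul] using key.symm

/-- The inverse Fourier transform on `L²` is given by the inverse Fourier integral on integrable
functions. -/
theorem fourierInv_Lp_ae_eq {F : Type*} [NormedAddCommGroup F] [InnerProductSpace ℂ F]
    [CompleteSpace F] (g : Lp F 2 (volume : Measure R3)) (hg : Integrable g) :
    ((𝓕⁻ g : Lp F 2 (volume : Measure R3)) : R3 → F) =ᵐ[volume] 𝓕⁻ (g : R3 → F) := by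
  have hc : Continuous (𝓕⁻ (g : R3 → F)) := by
    have : 𝓕⁻ (g : R3 → F) = fun x => 𝓕 (g : R3 → F) (-x) := by
      ext x; rw [Real.fourierInv_eq_fourier_neg]
    rw [this]
    exact (VectorFourier.fourierIntegral_continuous Real.continuous_fourierChar continuous_inner
      hg).comp continuous_neg
  refine ae_eq_of_integral_contDiff_smul_eq
    ((Lp.memLp (𝓕⁻ g : Lp F 2 (volume : Measure R3))).locallyIntegrable (by norm_num))
    hc.locallyIntegrable fun φ hφ hφc => ?_
  have hs : HasCompactSupport (fun x => (φ x : ℂ)) := hφc.comp_left (g := Complex.ofReal) rfl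
  let ψ : 𝓢(R3, ℂ) := hs.toSchwartzMap (Complex.ofRealCLM.contDiff.comp hφ)
  have hψ : ∀ x, ψ x = (φ x : ℂ) := fun x => rfl
  have key := congrArg (fun D : 𝓢'(R3, F) => D ψ) (Lp.fourierInv_toTemperedDistribution_eq g)
  simp only [TemperedDistribution.fourierInv_apply, Lp.toTemperedDistribution_apply,
    SchwartzMap.fourierInv_coe] at key
  have h2 : ∫ x, 𝓕⁻ ψ x • g x = ∫ x, ψ x • 𝓕⁻ (g : R3 → F) x := by
    have h := integral_fourier_smul_eq (f := fun x => ψ (-x)) ψ.integrable.comp_neg hg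
    have e1 : ∀ ξ, 𝓕 (fun x => ψ (-x)) ξ = 𝓕⁻ ψ ξ := by
      intro ξ; rw [SchwartzMap.fourierInv_coe, Real.fourierInv_eq_fourier_comp_neg]
    simp only [e1] at h
    rw [h, ← integral_neg_eq_self]
    simp only [neg_neg, Real.fourierInv_eq_fourier_neg]
  simp only [SchwartzMap.fourierInv_coe] at h2
  rw [h2] at key
  simpa only [hψ, Complex.coe_smul] using key.symm

/-- An integrable and square integrable real convolution kernel. -/
structure IsKernel (K : R3 → ℝ) : Prop where
  integrable : Integrable K volume
  memLp : MemLp K 2 volume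

/-- The symbol of a convolution kernel, in the variable `v = ξ / 2π`. -/
def symbol (K : R3 → ℝ) : R3 → ℂ := 𝓕 (fun x => (K x : ℂ))

namespace IsKernel

variable {K : R3 → ℝ}

lemma aesm (hK : IsKernel K) : AEStronglyMeasurable K volume := hK.integrable.aestronglyMeasurable

lemma continuous_symbol (hK : IsKernel K) : Continuous (symbol K) :=
  VectorFourier.fourierIntegral_continuous Real.continuous_fourierChar continuous_inner
    hK.integrable.ofReal

lemma norm_symbol_le (K : R3 → ℝ) (v : R3) : ‖symbol K v‖ ≤ ∫ x, ‖K x‖ := by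
  refine (VectorFourier.norm_fourierIntegral_le_integral_norm _ _ _ _ _).trans (le_of_eq ?_)
  simp

lemma memLp_symbol (hK : IsKernel K) : MemLp (symbol K) 2 volume := by
  have h2 : MemLp (fun x => (K x : ℂ)) 2 volume := hK.memLp.ofReal
  have hi : Integrable (h2.toLp _) volume :=
    (integrable_congr h2.coeFn_toLp).2 hK.integrable.ofReal
  have := fourier_Lp_ae_eq (h2.toLp _) hi
  have e : 𝓕 (h2.toLp _ : R3 → ℂ) = symbol K := by
    ext v
    exact integral_congr_ae (by filter_upwards [h2.coeFn_toLp] with x hx; rw [hx])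
  rw [e] at this
  exact (memLp_congr_ae this).1 (Lp.memLp _)

end IsKernel

lemma toComplex_apply (a : R3) (i : Fin 3) : toComplex a i = ((a i : ℝ) : ℂ) := rfl

lemma norm_toComplex (a : R3) : ‖toComplex a‖ = ‖a‖ := by
  simp [EuclideanSpace.norm_eq, toComplex_apply]

/-- The Fourier transform of the reflected and translated kernel `y ↦ K (x - y)`, which is paired
with a field in order to evaluate the convolution at `x`. -/
lemma fourier_reflect_smul (K : R3 → ℝ) (x v : R3) (e : C3) :
    𝓕 (fun y => ((K (x - y) : ℝ) : ℂ) • e) v =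
      (starRingEnd ℂ) (Real.fourierChar (inner ℝ v x) * symbol K v) • e := by
  rw [Real.fourier_eq, symbol, Real.fourier_eq,
    ← integral_sub_left_eq_self _ _ x]
  simp only [sub_sub_cancel, Circle.smul_def, smul_smul]
  rw [integral_smul_const]
  congr 1
  rw [← integral_const_mul, ← integral_conj]
  refine integral_congr_ae (Eventually.of_forall fun y => ?_)
  simp only [smul_eq_mul, map_mul, Complex.conj_ofReal, ← mul_assoc]
  congr 1
  rw [← Circle.coe_inv_eq_conj, ← Circle.coe_inv_eq_conj, ← Circle.coe_mul,
    ← AddChar.map_neg_eq_inv, ← AddChar.map_neg_eq_inv, ← AddChar.map_add_eq_mul, inner_sub_left,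
    real_inner_comm v x]
  congr 2
  ring

namespace IsKernel
variable {K : R3 → ℝ}

lemma integrable_symbol_smul (hK : IsKernel K) (u : L2Field) :
    Integrable (fun v => symbol K v • fourierL2 u v) volume :=
  memLp_one_iff_integrable.1 ((Lp.memLp (fourierL2 u)).smul hK.memLp_symbol)

lemma convolutionExistsAt (hK : IsKernel K) (u : L2Field) (x : R3) :
    Integrable (fun y => K y • u (x - y)) volume :=
  memLp_one_iff_integrable.1 (((Lp.memLp u).comp_measurePreserving
    (Measure.measurePreserving_sub_left volume x)).smul hK.memLp)

/-- Pointwise Fourier representation of a convolution with a square integrable field; this is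
Parseval's identity. -/
theorem toComplex_conv (hK : IsKernel K) (u : L2Field) (x : R3) :
    toComplex (conv K u x) = 𝓕⁻ (fun v => symbol K v • fourierL2 u v) x := by
  ext i
  let e : C3 := EuclideanSpace.single i 1
  have hmem : ∀ p : ℝ≥0∞, MemLp K p volume →
      MemLp (fun y => ((K (x - y) : ℝ) : ℂ) • e) p volume := by
    intro p hp
    have h1 : MemLp (fun y => ((K (x - y) : ℝ) : ℂ)) p volume :=
      (hp.comp_measurePreserving (Measure.measurePreserving_sub_left volume x)).ofReal
    refine (h1.norm).of_le (h1.1.smul_const e) (Eventually.of_forall fun y => ?_)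
    rw [norm_smul]; simp [e]
  have h2 := hmem 2 hK.memLp
  have h1 : Integrable (fun y => ((K (x - y) : ℝ) : ℂ) • e) volume :=
    memLp_one_iff_integrable.1 (hmem 1 (memLp_one_iff_integrable.2 hK.integrable))
  have hF := fourier_Lp_ae_eq (h2.toLp _) ((integrable_congr h2.coeFn_toLp).2 h1)
  have hFe : 𝓕 (h2.toLp _ : R3 → C3) = 𝓕 (fun y => ((K (x - y) : ℝ) : ℂ) • e) := by
    ext1 v
    exact integral_congr_ae (by filter_upwards [h2.coeFn_toLp] with x hx; rw [hx])
  rw [hFe] at hF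
  have key := Lp.inner_fourier_eq (h2.toLp _) (toComplex.compLp u)
  rw [L2.inner_def, L2.inner_def] at key
  have hL : ∫ y, inner ℂ ((h2.toLp _ : R3 → C3) y) ((toComplex.compLp u : R3 → C3) y) =
      toComplex (conv K u x) i := by
    rw [toComplex_apply, conv_apply]
    have hp : (∫ y, K y • u (x - y)) i = ∫ y, (K y • u (x - y)) i :=
      ((EuclideanSpace.proj i : R3 →L[ℝ] ℝ).integral_comp_comm
        (hK.convolutionExistsAt u x)).symm
    rw [hp, ← integral_complex_ofReal,
      ← integral_sub_left_eq_self (fun y => (((K y • u (x - y)) i : ℝ) : ℂ)) _ x]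
    refine integral_congr_ae ?_
    filter_upwards [h2.coeFn_toLp, toComplex.coeFn_compLp u] with y hy hy'
    rw [hy, hy', sub_sub_cancel, inner_smul_left]
    simp [e, EuclideanSpace.inner_single_left, toComplex_apply]
  have hR : ∫ v, inner ℂ ((𝓕 (h2.toLp _) : Lp C3 2 (volume : Measure R3)) v)
      ((𝓕 (toComplex.compLp u) : Lp C3 2 (volume : Measure R3)) v) =
      (𝓕⁻ (fun v => symbol K v • fourierL2 u v) x) i := by
    rw [Real.fourierInv_eq]
    have hi : Integrable (fun v => Real.fourierChar (inner ℝ v x) •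
        (symbol K v • fourierL2 u v)) volume := by
      have := (Real.fourierIntegral_convergent_iff (V := R3) (-x)).2 (hK.integrable_symbol_smul u)
      simpa using this
    rw [show ∀ z : C3, z i = (EuclideanSpace.proj i : C3 →L[ℂ] ℂ) z from fun _ => rfl,
      ← (EuclideanSpace.proj i : C3 →L[ℂ] ℂ).integral_comp_comm hi]
    refine integral_congr_ae ?_
    filter_upwards [hF] with v hv
    rw [hv, fourier_reflect_smul, inner_smul_left]
    simp only [e, EuclideanSpace.proj, PiLp.proj_apply, EuclideanSpace.inner_single_left,
      map_one, one_mul, Complex.conj_conj, fourierL2,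
      Circle.smul_def, PiLp.smul_apply, smul_eq_mul, mul_assoc]
  rw [← hL, ← key, hR]

lemma memLp_symbol_smul (hK : IsKernel K) (u : L2Field) :
    MemLp (fun v => symbol K v • fourierL2 u v) 2 volume := by
  refine (Lp.memLp (fourierL2 u)).of_le_mul (c := ∫ x, ‖K x‖)
    (hK.continuous_symbol.aestronglyMeasurable.smul (Lp.aestronglyMeasurable _))
    (Eventually.of_forall fun v => ?_)
  rw [norm_smul]
  gcongr
  exact norm_symbol_le K v

lemma memLp_conv (hK : IsKernel K) (u : L2Field) : MemLp (conv K u) 2 volume :=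
  ⟨aestronglyMeasurable_conv hK.aesm (Lp.aestronglyMeasurable u),
    (eLpNorm_conv_le hK.integrable (Lp.aestronglyMeasurable u) (by norm_num)).trans_lt
      (ENNReal.mul_lt_top hK.integrable.2 (Lp.eLpNorm_lt_top u))⟩

/-- The operator of convolution with a kernel on `L²`. -/
def op (hK : IsKernel K) (u : L2Field) : L2Field := (hK.memLp_conv u).toLp _

lemma coeFn_op (hK : IsKernel K) (u : L2Field) : ⇑(hK.op u) =ᵐ[volume] conv K u :=
  MemLp.coeFn_toLp _

/-- Convolution is multiplication by the symbol on the Fourier side. -/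
theorem fourierL2_op (hK : IsKernel K) (u : L2Field) :
    fourierL2 (hK.op u) =ᵐ[volume] fun v => symbol K v • fourierL2 u v := by
  have hm := hK.memLp_symbol_smul u
  let w : Lp C3 2 (volume : Measure R3) := hm.toLp _
  have hw := fourierInv_Lp_ae_eq w
    ((integrable_congr hm.coeFn_toLp).2 (hK.integrable_symbol_smul u))
  have he : 𝓕⁻ (w : R3 → C3) = fun x => toComplex (conv K u x) := by
    ext1 x
    rw [hK.toComplex_conv u x]
    exact integral_congr_ae (by filter_upwards [hm.coeFn_toLp] with x hx; rw [hx])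
  have : toComplex.compLp (hK.op u) = 𝓕⁻ w := by
    refine Lp.ext ?_
    filter_upwards [hw, toComplex.coeFn_compLp (hK.op u), hK.coeFn_op u] with x h1 h2 h3
    rw [h1, h2, h3, he]
  rw [fourierL2, this, FourierTransform.fourier_fourierInv_eq]
  exact hm.coeFn_toLp

end IsKernel

lemma eLpNorm_fourierL2 (u : L2Field) : eLpNorm (fourierL2 u) 2 volume = eLpNorm u 2 volume := by
  have h : ‖fourierL2 u‖ = ‖toComplex.compLp u‖ := Lp.norm_fourier_eq _
  have h1 : eLpNorm (fourierL2 u) 2 volume = eLpNorm (toComplex.compLp u) 2 volume := by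
    rw [Lp.norm_def, Lp.norm_def] at h
    exact (ENNReal.toReal_eq_toReal_iff' (Lp.eLpNorm_ne_top _) (Lp.eLpNorm_ne_top _)).1 h
  rw [h1]
  refine eLpNorm_congr_norm_ae ?_
  filter_upwards [toComplex.coeFn_compLp u] with x hx
  rw [hx, norm_toComplex]

lemma fourierL2_sub (u w : L2Field) : fourierL2 (u - w) = fourierL2 u - fourierL2 w := by
  have h : toComplex.compLp (u - w) = toComplex.compLp u - toComplex.compLp w :=
    (toComplex.compLpL 2 (volume : Measure R3)).map_sub u w
  rw [fourierL2, h]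
  exact (Lp.fourierTransformₗᵢ R3 C3).map_sub _ _

/-- Square integrable fields are determined by their Fourier transforms. -/
lemma ext_fourierL2 {u w : L2Field} (h : fourierL2 u =ᵐ[volume] fourierL2 w) : u = w := by
  have h1 : toComplex.compLp u = toComplex.compLp w :=
    (Lp.fourierTransformₗᵢ R3 C3).injective (Lp.ext h)
  refine Lp.ext ?_
  filter_upwards [toComplex.coeFn_compLp u, toComplex.coeFn_compLp w] with x hx hx'
  rw [h1, hx'] at hx
  ext i
  have := congrArg (fun z : C3 => z i) hx
  simpa [toComplex_apply] using this.symm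

/-- Convolution with a kernel acts on inverse Fourier integrals through its symbol. -/
lemma conv_fourierInv {K : R3 → ℝ} (hK : Integrable K) {c : R3 → ℂ} (hc : Integrable c) (x : R3) :
    ∫ y, (K y : ℂ) * 𝓕⁻ c (x - y) = 𝓕⁻ (fun v => symbol K v * c v) x := by
  have hcx : Integrable (fun v => (Real.fourierChar (inner ℝ v x) : ℂ) * c v) := by
    have := (Real.fourierIntegral_convergent_iff (V := R3) (-x)).2 hc
    simpa [Circle.smul_def] using this
  have key := integral_fourier_smul_eq (f := fun y => (K y : ℂ)) hK.ofReal hcx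
  have h1 : ∀ y, 𝓕 (fun v => (Real.fourierChar (inner ℝ v x) : ℂ) * c v) y = 𝓕⁻ c (x - y) := by
    intro y
    rw [Real.fourier_eq, Real.fourierInv_eq]
    refine integral_congr_ae (Eventually.of_forall fun v => ?_)
    simp only [Circle.smul_def, smul_eq_mul, ← mul_assoc, ← Circle.coe_mul,
      ← AddChar.map_add_eq_mul, inner_sub_right]
    congr 3
    ring
  simp only [h1, smul_eq_mul] at key
  rw [← key, Real.fourierInv_eq]
  refine integral_congr_ae (Eventually.of_forall fun v => ?_)
  simp only [symbol, Circle.smul_def, smul_eq_mul]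
  ring

/-! ### Kernels of smooth compactly supported symbols -/

/-- Even, smooth, compactly supported symbols. -/
structure IsSymbol (m : R3 → ℝ) : Prop where
  smooth : ContDiff ℝ ∞ m
  compact : HasCompactSupport m
  even : ∀ ξ, m (-ξ) = m ξ

namespace IsSymbol

variable {m m' : R3 → ℝ}

lemma comp_smul (hm : IsSymbol m) {a : ℝ} (ha : a ≠ 0) : IsSymbol (fun ξ => m (a • ξ)) where
  smooth := hm.smooth.comp (contDiff_const_smul a)
  compact := hm.compact.comp_smul ha
  even ξ := by rw [smul_neg, hm.even]

lemma sub (hm : IsSymbol m) (hm' : IsSymbol m') : IsSymbol (fun ξ => m ξ - m' ξ) where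
  smooth := hm.smooth.sub hm'.smooth
  compact := hm.compact.sub hm'.compact
  even ξ := by rw [hm.even, hm'.even]

/-- The symbol, in the variable `v = ξ / 2π`, as a complex Schwartz function. -/
def schwartz (hm : IsSymbol m) : 𝓢(R3, ℂ) :=
  HasCompactSupport.toSchwartzMap (f := fun v => ((m ((2 * Real.pi) • v) : ℝ) : ℂ))
    ((hm.comp_smul Real.two_pi_pos.ne').compact.comp_left (g := Complex.ofReal) rfl)
    (Complex.ofRealCLM.contDiff.comp (hm.comp_smul Real.two_pi_pos.ne').smooth)

lemma schwartz_apply (hm : IsSymbol m) (v : R3) :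
    hm.schwartz v = ((m ((2 * Real.pi) • v) : ℝ) : ℂ) := rfl

/-- The kernel of an even symbol is real. -/
lemma ofReal_kernel (hm : IsSymbol m) (x : R3) : (kernel m x : ℂ) = (𝓕⁻ hm.schwartz) x := by
  rw [SchwartzMap.fourierInv_coe, kernel]
  change _ = 𝓕⁻ (fun v : R3 => ((m ((2 * Real.pi) • v) : ℝ) : ℂ)) x
  apply Complex.conj_eq_iff_re.1
  rw [Real.fourierInv_eq, ← integral_conj, ← integral_neg_eq_self]
  refine integral_congr_ae (Eventually.of_forall fun v => ?_)
  simp only [Circle.smul_def, smul_eq_mul, map_mul, Complex.conj_ofReal, smul_neg, hm.even]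
  rw [← Circle.coe_inv_eq_conj, ← AddChar.map_neg_eq_inv, inner_neg_left, neg_neg]

lemma symbol_kernel (hm : IsSymbol m) (v : R3) :
    symbol (kernel m) v = ((m ((2 * Real.pi) • v) : ℝ) : ℂ) := by
  rw [symbol]
  simp only [hm.ofReal_kernel]
  rw [← SchwartzMap.fourier_coe, FourierTransform.fourier_fourierInv_eq, schwartz_apply]

lemma memLp_kernel (hm : IsSymbol m) (p : ℝ≥0∞) : MemLp (kernel m) p volume := by
  have h := (𝓕⁻ hm.schwartz).memLp p volume
  have : (fun x => (kernel m x : ℂ)) = 𝓕⁻ hm.schwartz := funext hm.ofReal_kernel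
  rw [← this] at h
  simpa using h.re

lemma isKernel (hm : IsSymbol m) : IsKernel (kernel m) where
  integrable := memLp_one_iff_integrable.1 (hm.memLp_kernel 1)
  memLp := hm.memLp_kernel 2

lemma kernel_sub (hm : IsSymbol m) (hm' : IsSymbol m') :
    kernel (fun ξ => m ξ - m' ξ) = fun x => kernel m x - kernel m' x := by
  ext x
  have h : (hm.sub hm').schwartz = hm.schwartz - hm'.schwartz := by
    ext v
    simp [schwartz_apply]
  have := (hm.sub hm').ofReal_kernel x
  rw [h, sub_eq_add_neg, FourierTransform.fourierInv_add, FourierTransform.fourierInv_neg,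
    add_apply, neg_apply, ← sub_eq_add_neg, ← hm.ofReal_kernel,
    ← hm'.ofReal_kernel] at this
  exact_mod_cast this

end IsSymbol

/-- Dilating a symbol by `a` dilates its kernel by `1 / a` and preserves the mass. -/
lemma kernel_comp_smul (m : R3 → ℝ) {a : ℝ} (ha : 0 < a) (x : R3) :
    kernel (fun ξ => m (a • ξ)) x = (a ^ 3)⁻¹ * kernel m (a⁻¹ • x) := by
  rw [kernel, kernel, Real.fourierInv_eq, Real.fourierInv_eq]
  have h := Measure.integral_comp_smul (volume : Measure R3)
    (fun v => Real.fourierChar (inner ℝ v (a⁻¹ • x)) • ((m ((2 * Real.pi) • v) : ℝ) : ℂ)) a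
  have e : ∀ v : R3, inner ℝ (a • v) (a⁻¹ • x) = inner ℝ v x := by
    intro v
    rw [inner_smul_left, inner_smul_right]
    simp [ha.ne']
  simp only [e, finrank_euclideanSpace, Fintype.card_fin, abs_inv, abs_pow, abs_of_pos ha] at h
  rw [← smul_eq_mul ((a ^ 3)⁻¹), ← Complex.smul_re, ← h]
  simp only [smul_comm a]

/-- The kernels of all dilations of a symbol have the same `L¹` norm, which makes the bounds for the
dyadic operators uniform in the frequency. -/
lemma lintegral_kernel_comp_smul {m : R3 → ℝ} (hm : IsSymbol m) {a : ℝ} (ha : 0 < a) :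
    ∫⁻ x, ‖kernel (fun ξ => m (a • ξ)) x‖ₑ = ∫⁻ x, ‖kernel m x‖ₑ := by
  have h := Measure.integral_comp_smul (volume : Measure R3) (fun x => ‖kernel m x‖) a⁻¹
  rw [← ofReal_integral_norm_eq_lintegral_enorm (hm.comp_smul ha.ne').isKernel.integrable,
    ← ofReal_integral_norm_eq_lintegral_enorm hm.isKernel.integrable]
  simp only [kernel_comp_smul m ha, norm_mul]
  rw [integral_const_mul, h]
  congr 1
  simp only [finrank_euclideanSpace, Fintype.card_fin, Real.norm_eq_abs, abs_inv, abs_pow,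
    abs_of_pos ha, inv_pow, smul_eq_mul, inv_inv]
  rw [inv_mul_cancel_left₀ (by positivity)]

lemma eLpNorm_top_kernel_comp_smul (m : R3 → ℝ) {a : ℝ} (ha : 0 < a) :
    eLpNorm (kernel (fun ξ => m (a • ξ))) ∞ volume ≤
      ENNReal.ofReal (a ^ 3)⁻¹ * eLpNorm (kernel m) ∞ volume := by
  rw [eLpNorm_exponent_top, eLpNorm_exponent_top]
  refine essSup_le_of_ae_le _ ?_
  have := (Measure.quasiMeasurePreserving_smul (volume : Measure R3) (inv_pos.2 ha).ne').ae
    (enorm_ae_le_eLpNormEssSup (kernel m) volume)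
  filter_upwards [this] with x hx
  rw [kernel_comp_smul m ha, enorm_mul, Real.enorm_eq_ofReal (by positivity)]
  gcongr

/-! ### Littlewood–Paley operators on `L²` -/

lemma ofReal_zpow_cube_inv (j : ℤ) :
    ENNReal.ofReal (((2 : ℝ) ^ (-j)) ^ 3)⁻¹ = (2 : ℝ≥0∞) ^ ((j : ℝ) * 3) := by
  rw [← ENNReal.ofReal_ofNat, ENNReal.ofReal_rpow_of_pos two_pos]
  congr 1
  rw [Real.rpow_mul two_pos.le, Real.rpow_intCast, zpow_neg]
  norm_cast
  simp

lemma eLpNorm_multiplier_le {V : Type*} [NormedAddCommGroup V] [NormedSpace ℝ V] {m : R3 → ℝ}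
    (hm : IsSymbol m) {f : R3 → V}
    (hf : AEStronglyMeasurable f volume) (j : ℤ) {p : ℝ≥0∞} (hp : 1 ≤ p) :
    eLpNorm (multiplier (fun ξ => m ((2 : ℝ) ^ (-j) • ξ)) f) p volume ≤
      (∫⁻ x, ‖kernel m x‖ₑ) * eLpNorm f p volume := by
  have h2 : (0 : ℝ) < (2 : ℝ) ^ (-j) := by positivity
  rw [← lintegral_kernel_comp_smul hm h2]
  exact eLpNorm_conv_le (hm.comp_smul h2.ne').isKernel.integrable hf hp

/-- A dyadic multiplier maps `L^p` to `L^∞` at the cost of the factor `2^{3j/p}`. -/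
lemma enorm_multiplier_le {V : Type*} [NormedAddCommGroup V] [NormedSpace ℝ V] {m : R3 → ℝ}
    (hm : IsSymbol m) {f : R3 → V}
    (hf : AEStronglyMeasurable f volume) {A : ℝ≥0∞} (h1 : ∫⁻ x, ‖kernel m x‖ₑ ≤ A)
    (hi : eLpNorm (kernel m) ∞ volume ≤ A) (j : ℤ) {p : ℝ} (hp : 1 ≤ p) (x : R3) :
    ‖multiplier (fun ξ => m ((2 : ℝ) ^ (-j) • ξ)) f x‖ₑ ≤
      A * 2 ^ ((j : ℝ) * (3 / p)) * eLpNorm f (ENNReal.ofReal p) volume := by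
  have h2 : (0 : ℝ) < (2 : ℝ) ^ (-j) := by positivity
  have hp0 : 0 < p := by linarith
  have hp1 : 0 ≤ 1 - 1 / p := by rw [sub_nonneg, div_le_one hp0]; exact hp
  refine (enorm_conv_le_of_eLpNorm (hm.comp_smul h2.ne').isKernel.aesm hf hp x).trans
    (mul_le_mul_left ?_ _)
  have hi' := (eLpNorm_top_kernel_comp_smul m h2).trans (mul_le_mul_right hi _)
  rw [ofReal_zpow_cube_inv] at hi'
  rw [lintegral_kernel_comp_smul hm h2]
  calc (∫⁻ x, ‖kernel m x‖ₑ) ^ (1 - 1 / p) *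
        eLpNorm (kernel fun ξ => m ((2 : ℝ) ^ (-j) • ξ)) ∞ volume ^ (1 / p)
      ≤ A ^ (1 - 1 / p) * (2 ^ ((j : ℝ) * 3) * A) ^ (1 / p) := by gcongr
    _ = A ^ (1 - 1 / p + 1 / p) * 2 ^ ((j : ℝ) * (3 / p)) := by
        rw [ENNReal.mul_rpow_of_nonneg _ _ (by positivity), ← ENNReal.rpow_mul,
          ENNReal.rpow_add_of_nonneg _ _ hp1 (by positivity)]
        rw [show (j : ℝ) * 3 * (1 / p) = j * (3 / p) by ring]
        ring
    _ = _ := by simp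

lemma IsKernel.conv_sub {K : R3 → ℝ} (hK : IsKernel K) (u w : L2Field) (x : R3) :
    conv K (⇑u - ⇑w) x = conv K u x - conv K w x := by
  rw [conv_apply, conv_apply, conv_apply,
    ← integral_sub (hK.convolutionExistsAt u x) (hK.convolutionExistsAt w x)]
  simp only [Pi.sub_apply, smul_sub]

namespace DyadicPartition

variable (P : DyadicPartition)

/-- The low frequency cut-off is radial because it is `1 - ∑_{j ≥ 0} φ(2^{-j} ·)`. -/
lemma χ_radial {ξ η : R3} (h : ‖ξ‖ = ‖η‖) : P.χ ξ = P.χ η := by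
  have h1 := P.sum_nat ξ
  have h2 := P.sum_nat η
  have : (fun j : ℕ => P.φ ((2 : ℝ) ^ (-(j : ℤ)) • ξ)) =
      fun j : ℕ => P.φ ((2 : ℝ) ^ (-(j : ℤ)) • η) := by
    ext j; exact P.φ_radial _ _ (by rw [norm_smul, norm_smul, h])
  rw [this] at h1
  linarith [h1.unique h2]

lemma φ_eq_zero_of_lt {ξ : R3} (h : ‖ξ‖ < 3 / 4) : P.φ ξ = 0 := by
  by_contra hc
  exact absurd (P.φ_supp (subset_tsupport _ hc)).1 (not_le.2 h)

lemma φ_eq_zero_of_gt {ξ : R3} (h : 8 / 3 < ‖ξ‖) : P.φ ξ = 0 := by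
  by_contra hc
  exact absurd (P.φ_supp (subset_tsupport _ hc)).2 (not_le.2 h)

lemma χ_eq_zero {ξ : R3} (h : 4 / 3 ≤ ‖ξ‖) : P.χ ξ = 0 := by
  by_contra hc
  have := P.χ_supp (subset_tsupport _ hc)
  rw [mem_ball_zero_iff] at this
  linarith

lemma χ_eq_one {ξ : R3} (h : ‖ξ‖ < 3 / 4) : P.χ ξ = 1 := by
  have h1 := P.sum_nat ξ
  have : (fun j : ℕ => P.φ ((2 : ℝ) ^ (-(j : ℤ)) • ξ)) = fun _ => 0 := by
    ext j
    refine P.φ_eq_zero_of_lt ?_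
    rw [norm_smul, zpow_neg, zpow_natCast, norm_inv, norm_pow, Real.norm_two]
    have : ((2 : ℝ) ^ j)⁻¹ ≤ 1 := inv_le_one_of_one_le₀ (one_le_pow₀ one_le_two)
    nlinarith [norm_nonneg ξ]
  rw [this] at h1
  linarith [h1.unique hasSum_zero]

/-- `χ(ξ/2) = χ(ξ) + φ(ξ)`, by comparing the two partitions of unity at `ξ/2` and at `ξ`. -/
lemma χ_half (ξ : R3) : P.χ ((2 : ℝ)⁻¹ • ξ) = P.χ ξ + P.φ ξ := by
  have h1 := P.sum_nat ((2 : ℝ)⁻¹ • ξ)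
  have h2 := (hasSum_nat_add_iff' 1).2 (P.sum_nat ξ)
  have : (fun j : ℕ => P.φ ((2 : ℝ) ^ (-((j + 1 : ℕ) : ℤ)) • ξ)) =
      fun j : ℕ => P.φ ((2 : ℝ) ^ (-(j : ℤ)) • (2 : ℝ)⁻¹ • ξ) := by
    ext j
    rw [smul_smul, Nat.cast_succ, neg_add, zpow_add₀ two_ne_zero, zpow_neg_one]
  rw [this] at h2
  have := h1.unique h2
  simp at this
  linarith

lemma φ_le_one (ξ : R3) : P.φ ξ ≤ 1 := by
  rcases eq_or_ne ξ 0 with rfl | h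
  · rw [P.φ_eq_zero_of_lt (by simp)]; exact zero_le_one
  · have := le_hasSum (P.sum_int ξ h) 0 (fun j _ => P.φ_nonneg _)
    simpa using this

lemma χ_isSymbol : IsSymbol P.χ where
  smooth := P.χ_smooth
  compact := (isCompact_closedBall (0 : R3) (4 / 3)).of_isClosed_subset (isClosed_tsupport _)
    (P.χ_supp.trans Metric.ball_subset_closedBall)
  even ξ := P.χ_radial (norm_neg ξ)

lemma φ_isSymbol : IsSymbol P.φ where
  smooth := P.φ_smooth
  compact := (isCompact_closedBall (0 : R3) (8 / 3)).of_isClosed_subset (isClosed_tsupport _)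
    (P.φ_supp.trans fun _ hξ => mem_closedBall_zero_iff.2 hξ.2)
  even ξ := P.φ_radial _ _ (norm_neg ξ)

/-- The symbol of `Ṡ_j`. -/
lemma χj_isSymbol (j : ℤ) : IsSymbol (fun ξ => P.χ ((2 : ℝ) ^ (-j) • ξ)) :=
  P.χ_isSymbol.comp_smul (by positivity)

/-- The symbol of `Δ̇_j`. -/
lemma φj_isSymbol (j : ℤ) : IsSymbol (fun ξ => P.φ ((2 : ℝ) ^ (-j) • ξ)) :=
  P.φ_isSymbol.comp_smul (by positivity)

/-- `Ṡ_j` as an operator on `L²`. -/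
def S (j : ℤ) (u : L2Field) : L2Field := (P.χj_isSymbol j).isKernel.op u

/-- `Δ̇_j` as an operator on `L²`. -/
def Δ (j : ℤ) (u : L2Field) : L2Field := (P.φj_isSymbol j).isKernel.op u

lemma coeFn_S (j : ℤ) (u : L2Field) : P.S j u =ᵐ[volume] P.trunc j u := IsKernel.coeFn_op _ u

lemma coeFn_Δ (j : ℤ) (u : L2Field) : P.Δ j u =ᵐ[volume] P.block j u := IsKernel.coeFn_op _ u

lemma trunc_congr_ae {V : Type*} [NormedAddCommGroup V] [NormedSpace ℝ V] (j : ℤ) {f g : R3 → V}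
    (h : f =ᵐ[volume] g) : P.trunc j f = P.trunc j g := conv_congr_ae _ h

lemma block_congr_ae {V : Type*} [NormedAddCommGroup V] [NormedSpace ℝ V] (j : ℤ) {f g : R3 → V}
    (h : f =ᵐ[volume] g) : P.block j f = P.block j g := conv_congr_ae _ h

lemma fourierL2_S (j : ℤ) (u : L2Field) : fourierL2 (P.S j u) =ᵐ[volume]
    fun v => ((P.χ ((2 : ℝ) ^ (-j) • (2 * Real.pi) • v) : ℝ) : ℂ) • fourierL2 u v := by
  filter_upwards [(P.χj_isSymbol j).isKernel.fourierL2_op u] with v hv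
  rw [S, hv, (P.χj_isSymbol j).symbol_kernel]

lemma fourierL2_Δ (j : ℤ) (u : L2Field) : fourierL2 (P.Δ j u) =ᵐ[volume]
    fun v => ((P.φ ((2 : ℝ) ^ (-j) • (2 * Real.pi) • v) : ℝ) : ℂ) • fourierL2 u v := by
  filter_upwards [(P.φj_isSymbol j).isKernel.fourierL2_op u] with v hv
  rw [Δ, hv, (P.φj_isSymbol j).symbol_kernel]

lemma aesm_trunc (j : ℤ) (u : L2Field) : AEStronglyMeasurable (P.trunc j u) volume :=
  aestronglyMeasurable_conv (P.χj_isSymbol j).isKernel.aesm (Lp.aestronglyMeasurable u)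

lemma aesm_block (j : ℤ) (u : L2Field) : AEStronglyMeasurable (P.block j u) volume :=
  aestronglyMeasurable_conv (P.φj_isSymbol j).isKernel.aesm (Lp.aestronglyMeasurable u)

/-- `Ṡ_{k+1} - Ṡ_k = Δ̇_k`. -/
lemma trunc_succ (k : ℤ) (u : L2Field) (x : R3) :
    P.trunc (k + 1) u x = P.trunc k u x + P.block k u x := by
  have h : (fun ξ => P.φ ((2 : ℝ) ^ (-k) • ξ)) =
      fun ξ => P.χ ((2 : ℝ) ^ (-(k + 1)) • ξ) - P.χ ((2 : ℝ) ^ (-k) • ξ) := by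
    ext ξ
    rw [neg_add, zpow_add₀ two_ne_zero, mul_comm, zpow_neg_one, ← smul_smul, P.χ_half]
    ring
  have h1 := (P.χj_isSymbol (k + 1)).isKernel.convolutionExistsAt u x
  have h2 := (P.χj_isSymbol k).isKernel.convolutionExistsAt u x
  change conv _ u x = conv _ u x + conv _ u x
  rw [h, (P.χj_isSymbol (k + 1)).kernel_sub (P.χj_isSymbol k), conv_apply, conv_apply, conv_apply]
  simp only [sub_smul]
  rw [integral_sub h1 h2]
  abel

lemma block_sub (k : ℤ) (u w : L2Field) (x : R3) :
    P.block k ⇑(u - w) x = P.block k u x - P.block k w x := by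
  rw [P.block_congr_ae k (Lp.coeFn_sub u w)]
  exact (P.φj_isSymbol k).isKernel.conv_sub u w x

/-- `Ṡ_{k+2} Δ̇_k = Δ̇_k`. -/
lemma trunc_block (k : ℤ) (u : L2Field) :
    P.trunc (k + 2) (P.block k u) =ᵐ[volume] P.block k u := by
  have h : P.S (k + 2) (P.Δ k u) = P.Δ k u := by
    refine ext_fourierL2 ?_
    filter_upwards [P.fourierL2_S (k + 2) (P.Δ k u), P.fourierL2_Δ k u] with v h1 h2
    rw [h1, h2, smul_smul]
    congr 1
    by_cases hv : 8 / 3 < ‖(2 : ℝ) ^ (-k) • (2 * Real.pi) • v‖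
    · rw [P.φ_eq_zero_of_gt hv]; simp
    · rw [P.χ_eq_one, Complex.ofReal_one, one_mul]
      rw [neg_add, zpow_add₀ two_ne_zero, mul_comm, ← smul_smul, norm_smul]
      rw [not_lt] at hv
      rw [show ‖(2 : ℝ) ^ (-2 : ℤ)‖ = 1 / 4 by norm_num]
      linarith
  rw [← P.trunc_congr_ae _ (P.coeFn_Δ k u)]
  refine (P.coeFn_S (k + 2) (P.Δ k u)).symm.trans ?_
  rw [h]
  exact P.coeFn_Δ k u

/-- A finite constant bounding the `L¹` and `L^∞` norms of the kernels of `χ` and `φ`. -/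
def A : ℝ≥0∞ := 1 + (∫⁻ x, ‖kernel P.χ x‖ₑ) + (∫⁻ x, ‖kernel P.φ x‖ₑ) +
  eLpNorm (kernel P.χ) ∞ volume + eLpNorm (kernel P.φ) ∞ volume

lemma A_ne_top : P.A ≠ ⊤ := by
  have h1 := P.χ_isSymbol.isKernel.integrable.2
  have h2 := P.φ_isSymbol.isKernel.integrable.2
  have h3 := (P.χ_isSymbol.memLp_kernel ∞).2
  have h4 := (P.φ_isSymbol.memLp_kernel ∞).2
  rw [HasFiniteIntegral] at h1 h2
  simp only [A, ne_eq, ENNReal.add_eq_top, ENNReal.one_ne_top, h1.ne, h2.ne, h3.ne, h4.ne, or_self,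
    not_false_eq_true]

lemma one_le_A : 1 ≤ P.A := by
  rw [A, add_assoc, add_assoc, add_assoc]; exact le_self_add

lemma kernel_χ_le_A : ∫⁻ x, ‖kernel P.χ x‖ₑ ≤ P.A := by
  rw [A, add_comm 1, add_assoc, add_assoc, add_assoc]; exact le_self_add

lemma kernel_φ_le_A : ∫⁻ x, ‖kernel P.φ x‖ₑ ≤ P.A := by
  rw [A, add_comm _ (∫⁻ x, ‖kernel P.φ x‖ₑ), add_assoc, add_assoc]; exact le_self_add

lemma kernel_χ_top_le_A : eLpNorm (kernel P.χ) ∞ volume ≤ P.A := by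
  rw [A, add_comm _ (eLpNorm (kernel P.χ) ∞ volume), add_assoc]; exact le_self_add

lemma kernel_φ_top_le_A : eLpNorm (kernel P.φ) ∞ volume ≤ P.A := le_add_self

lemma eLpNorm_trunc_le {V : Type*} [NormedAddCommGroup V] [NormedSpace ℝ V] (k : ℤ) {f : R3 → V}
    (hf : AEStronglyMeasurable f volume) {p : ℝ≥0∞} (hp : 1 ≤ p) :
    eLpNorm (P.trunc k f) p volume ≤ P.A * eLpNorm f p volume :=
  (eLpNorm_multiplier_le P.χ_isSymbol hf k hp).trans (mul_le_mul_left P.kernel_χ_le_A _)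

lemma eLpNorm_block_le (k : ℤ) (u : L2Field) {p : ℝ≥0∞} (hp : 1 ≤ p) :
    eLpNorm (P.block k u) p volume ≤ P.A * eLpNorm u p volume :=
  (eLpNorm_multiplier_le P.φ_isSymbol (Lp.aestronglyMeasurable u) k hp).trans
    (mul_le_mul_left P.kernel_φ_le_A _)

lemma eLpNorm_top_trunc_le (k : ℤ) {f : R3 → R3} (hf : AEStronglyMeasurable f volume) {p : ℝ}
    (hp : 1 ≤ p) : eLpNorm (P.trunc k f) ∞ volume ≤
      P.A * 2 ^ ((k : ℝ) * (3 / p)) * eLpNorm f (ENNReal.ofReal p) volume := by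
  rw [eLpNorm_exponent_top]
  exact essSup_le_of_ae_le _ (Eventually.of_forall fun x =>
    enorm_multiplier_le P.χ_isSymbol hf P.kernel_χ_le_A P.kernel_χ_top_le_A k hp x)

lemma eLpNorm_top_block_le_two (k : ℤ) (u : L2Field) :
    eLpNorm (P.block k u) ∞ volume ≤ P.A * 2 ^ ((k : ℝ) * (3 / 2)) * eLpNorm u 2 volume := by
  have := fun x => enorm_multiplier_le P.φ_isSymbol (Lp.aestronglyMeasurable u) P.kernel_φ_le_A
    P.kernel_φ_top_le_A k one_le_two x
  rw [ENNReal.ofReal_ofNat] at this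
  rw [eLpNorm_exponent_top]
  exact essSup_le_of_ae_le _ (Eventually.of_forall this)

/-- Bernstein's inequality. -/
lemma bernstein (k : ℤ) (u : L2Field) {p : ℝ} (hp : 2 ≤ p) :
    eLpNorm (P.block k u) ∞ volume ≤
      8 * P.A * 2 ^ ((k : ℝ) * (3 / p)) * eLpNorm (P.block k u) (ENNReal.ofReal p) volume := by
  -- The truncation at the frequency `2^{k+2}` reproduces the block and maps `L^p` to `L^∞`.
  rw [← eLpNorm_congr_ae (P.trunc_block k u)]
  refine (P.eLpNorm_top_trunc_le (k + 2) (P.aesm_block k u) (by linarith)).trans ?_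
  refine mul_le_mul_left ?_ _
  rw [mul_comm 8, mul_assoc]
  refine mul_le_mul_right ?_ _
  have h8 : (8 : ℝ≥0∞) = 2 ^ (3 : ℝ) := by norm_num
  rw [h8, ← ENNReal.rpow_add _ _ two_ne_zero ENNReal.ofNat_ne_top]
  refine ENNReal.rpow_le_rpow_of_exponent_le one_le_two ?_
  push_cast
  have : 2 * (3 / p) ≤ 3 := by
    rw [mul_div_assoc', div_le_iff₀ (by linarith)]; linarith
  linarith

end DyadicPartition

/-! ### Sequences indexed by the dyadic frequencies -/

lemma eLpNorm_top_count_le {g : ℤ → ℝ≥0∞} {C : ℝ≥0∞} (h : ∀ k, g k ≤ C) :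
    eLpNorm g ∞ Measure.count ≤ C := by
  rw [eLpNorm_exponent_top]
  exact essSup_le_of_ae_le _ (Eventually.of_forall (by simpa using h))

lemma le_eLpNorm_count (g : ℤ → ℝ≥0∞) {q : ℝ≥0∞} (hq : q ≠ 0) (k : ℤ) :
    g k ≤ eLpNorm g q Measure.count := by
  simpa using enorm_le_eLpNorm_count g k hq

lemma two_rpow_ne_top (s : ℝ) : (2 : ℝ≥0∞) ^ s ≠ ⊤ :=
  ENNReal.rpow_ne_top_of_ne_zero two_ne_zero ENNReal.ofNat_ne_top

lemma two_rpow_add (s t : ℝ) : (2 : ℝ≥0∞) ^ (s + t) = 2 ^ s * 2 ^ t :=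
  ENNReal.rpow_add _ _ two_ne_zero ENNReal.ofNat_ne_top

lemma two_rpow_mono {s t : ℝ} (h : s ≤ t) : (2 : ℝ≥0∞) ^ s ≤ 2 ^ t :=
  ENNReal.rpow_le_rpow_of_exponent_le one_le_two h

lemma two_rpow_le_one {s : ℝ} (h : s ≤ 0) : (2 : ℝ≥0∞) ^ s ≤ 1 := by
  rw [← ENNReal.rpow_zero (x := 2)]
  exact two_rpow_mono h

lemma le_two_rpow_neg_mul {s : ℝ} {x B : ℝ≥0∞} (h : (2 : ℝ≥0∞) ^ s * x ≤ B) :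
    x ≤ 2 ^ (-s) * B := by
  calc x = 2 ^ (-s) * (2 ^ s * x) := by
        rw [← mul_assoc, ← two_rpow_add]; simp
    _ ≤ _ := by gcongr

lemma two_rpow_ofReal (s : ℝ) : (2 : ℝ≥0∞) ^ s = ENNReal.ofReal ((2 : ℝ) ^ s) := by
  rw [← ENNReal.ofReal_ofNat, ENNReal.ofReal_rpow_of_pos two_pos]

lemma tendsto_two_rpow_atBot : Tendsto (fun n : ℕ => (2 : ℝ≥0∞) ^ (-(n : ℝ))) atTop (𝓝 0) := by
  have : (fun n : ℕ => (2 : ℝ≥0∞) ^ (-(n : ℝ))) = fun n : ℕ => ((2 : ℝ≥0∞)⁻¹) ^ n := by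
    ext n
    rw [ENNReal.rpow_neg, ENNReal.rpow_natCast, ENNReal.inv_pow]
  rw [this]
  exact ENNReal.tendsto_pow_atTop_nhds_zero_of_lt_one (by simp)

lemma tsum_two_rpow_neg : ∑' i : ℕ, (2 : ℝ≥0∞) ^ (-(i : ℝ)) = 2 := by
  have : (fun n : ℕ => (2 : ℝ≥0∞) ^ (-(n : ℝ))) = fun n : ℕ => ((2 : ℝ≥0∞)⁻¹) ^ n := by
    ext n
    rw [ENNReal.rpow_neg, ENNReal.rpow_natCast, ENNReal.inv_pow]
  rw [this, ENNReal.tsum_geometric, ENNReal.one_sub_inv_two, inv_inv]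

/-! ### Estimates of blocks and truncations -/

namespace DyadicPartition

variable (P : DyadicPartition)

/-- A block gains `2^{-kα}` on `Ḣ^α`. -/
lemma eLpNorm_block_le_homSobolev (k : ℤ) (u : L2Field) {α : ℝ} (hα : 0 ≤ α) :
    eLpNorm (P.block k u) 2 volume ≤
      ENNReal.ofReal ((4 / 3) ^ α) * 2 ^ (-((k : ℝ) * α)) * homSobolevNorm α u := by
  rw [← eLpNorm_congr_ae (P.coeFn_Δ k u), ← eLpNorm_fourierL2, two_rpow_ofReal,
    ← ENNReal.ofReal_mul (by positivity)]
  refine eLpNorm_le_mul_eLpNorm_of_ae_le_mul ?_ 2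
  filter_upwards [P.fourierL2_Δ k u] with v hv
  rw [hv, norm_smul, norm_smul, ← mul_assoc]
  gcongr
  rw [Complex.norm_real, Real.norm_of_nonneg (P.φ_nonneg _), Real.norm_of_nonneg (by positivity),
    neg_mul_eq_neg_mul, Real.rpow_mul two_pos.le, ← Real.mul_rpow (by positivity) (by positivity),
    ← Real.mul_rpow (by positivity) (by positivity)]
  by_cases h : ‖(2 : ℝ) ^ (-k) • (2 * Real.pi) • v‖ < 3 / 4
  · rw [P.φ_eq_zero_of_lt h]; positivity
  · refine (P.φ_le_one _).trans (Real.one_le_rpow ?_ hα)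
    rw [norm_smul, norm_smul, Real.norm_of_nonneg (by positivity),
      Real.norm_of_nonneg (by positivity)] at h
    rw [← Int.cast_neg, Real.rpow_intCast]
    linarith

/-- `Ṡ_n u → u` in `L²` as `n → ∞`. -/
lemma tendsto_trunc (k : ℤ) (u : L2Field) :
    Tendsto (fun n : ℕ => eLpNorm (P.trunc (k + n) u - ⇑u) 2 volume) atTop (𝓝 0) := by
  have h1 : ∀ n : ℕ, eLpNorm (P.trunc (k + n) u - ⇑u) 2 volume =
      (∫⁻ v, ‖(((P.χ ((2 : ℝ) ^ (-(k + n)) • (2 * Real.pi) • v) : ℝ) : ℂ) - 1) •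
        fourierL2 u v‖ₑ ^ (2 : ℝ)) ^ (1 / 2 : ℝ) := by
    intro n
    have e1 : P.trunc (k + n) u - ⇑u =ᵐ[volume] ⇑(P.S (k + n) u - u) := by
      filter_upwards [P.coeFn_S (k + n) u, Lp.coeFn_sub (P.S (k + n) u) u] with x h h'
      rw [h', Pi.sub_apply, Pi.sub_apply, h]
    rw [eLpNorm_congr_ae e1, ← eLpNorm_fourierL2, fourierL2_sub,
      eLpNorm_eq_lintegral_rpow_enorm_toReal two_ne_zero ENNReal.ofNat_ne_top]
    simp only [ENNReal.toReal_ofNat]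
    congr 1
    refine lintegral_congr_ae ?_
    filter_upwards [P.fourierL2_S (k + n) u,
      Lp.coeFn_sub (fourierL2 (P.S (k + n) u)) (fourierL2 u)] with v h h'
    rw [h', Pi.sub_apply, h, sub_smul, one_smul]
  simp only [h1]
  obtain ⟨M, hM⟩ := P.χ_isSymbol.compact.exists_bound_of_continuous P.χ_smooth.continuous
  have hM0 : 0 ≤ M := (norm_nonneg _).trans (hM 0)
  have hfin : ∫⁻ v, ‖fourierL2 u v‖ₑ ^ (2 : ℝ) ≠ ⊤ := by
    have := (Lp.memLp (fourierL2 u)).2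
    rw [eLpNorm_lt_top_iff_lintegral_rpow_enorm_lt_top two_ne_zero ENNReal.ofNat_ne_top] at this
    simpa using this.ne
  have hlim := tendsto_lintegral_of_dominated_convergence' (μ := (volume : Measure R3))
    (F := fun (n : ℕ) v => ‖(((P.χ ((2 : ℝ) ^ (-(k + n)) • (2 * Real.pi) • v) : ℝ) : ℂ) - 1) •
        fourierL2 u v‖ₑ ^ (2 : ℝ)) (f := fun _ => 0)
    (fun v => ENNReal.ofReal (M + 1) ^ (2 : ℝ) * ‖fourierL2 u v‖ₑ ^ (2 : ℝ)) ?_ ?_ ?_ ?_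
  · have := (ENNReal.continuous_rpow_const (y := (1 / 2 : ℝ))).tendsto 0 |>.comp
      (by simpa using hlim)
    simpa [Function.comp_def] using this
  · intro n
    have hc : Continuous fun v : R3 =>
        (((P.χ ((2 : ℝ) ^ (-(k + n)) • (2 * Real.pi) • v) : ℝ) : ℂ) - 1) := by
      have := P.χ_smooth.continuous
      fun_prop
    exact ((hc.aestronglyMeasurable.smul (Lp.aestronglyMeasurable _)).enorm).pow_const _
  · intro n
    refine Eventually.of_forall fun v => ?_
    dsimp only
    rw [← ENNReal.mul_rpow_of_nonneg _ _ zero_le_two, enorm_smul]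
    gcongr
    rw [← ofReal_norm]
    refine ENNReal.ofReal_le_ofReal ((norm_sub_le _ _).trans ?_)
    rw [Complex.norm_real, norm_one]
    gcongr
    exact hM _
  · rw [lintegral_const_mul' _ _ (by finiteness)]
    exact ENNReal.mul_ne_top (by finiteness) hfin
  · refine Eventually.of_forall fun v => ?_
    refine tendsto_const_nhds.congr' ?_
    have hsm : Tendsto (fun n : ℕ => ‖(2 : ℝ) ^ (-(k + n)) • (2 * Real.pi) • v‖) atTop (𝓝 0) := by
      have : (fun n : ℕ => ‖(2 : ℝ) ^ (-(k + n)) • (2 * Real.pi) • v‖) =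
          fun n : ℕ => (2⁻¹ : ℝ) ^ n * ‖(2 : ℝ) ^ (-k) • (2 * Real.pi) • v‖ := by
        ext n
        rw [neg_add, zpow_add₀ two_ne_zero, mul_comm, ← smul_smul, norm_smul]
        simp
      rw [this]
      simpa using (tendsto_pow_atTop_nhds_zero_of_lt_one (by norm_num)
        (by norm_num : (2⁻¹ : ℝ) < 1)).mul_const ‖(2 : ℝ) ^ (-k) • (2 * Real.pi) • v‖
    filter_upwards [hsm.eventually_lt_const (by norm_num : (0 : ℝ) < 3 / 4)] with n hn
    rw [P.χ_eq_one hn]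
    simp

/-- The low frequencies are controlled by `Ḃ^{-1}_{∞,∞}`. -/
lemma eLpNorm_top_trunc_le_of_block (u : L2Field) {B : ℝ≥0∞}
    (hB : ∀ k : ℤ, eLpNorm (P.block k u) ∞ volume ≤ 2 ^ (k : ℝ) * B) (k : ℤ) :
    eLpNorm (P.trunc k u) ∞ volume ≤ 2 ^ (k : ℝ) * B := by
  -- The low frequencies are split into `n` blocks and a remainder which vanishes as `n → ∞`, by the
  -- embedding of `L²` at low frequencies.
  have hstep : ∀ n : ℕ, eLpNorm (P.trunc k u) ∞ volume ≤
      eLpNorm (P.trunc (k - n) u) ∞ volume +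
        ∑ i ∈ Finset.range n, eLpNorm (P.block (k - 1 - i) u) ∞ volume := by
    intro n
    induction n with
    | zero => simp
    | succ n ih =>
      refine ih.trans ?_
      rw [Finset.sum_range_succ, add_comm (Finset.sum _ _), ← add_assoc]
      gcongr
      have : P.trunc (k - n) u = P.trunc (k - (n + 1 : ℕ)) u + P.block (k - 1 - n) u := by
        ext1 x
        have := P.trunc_succ (k - (n + 1 : ℕ)) u x
        push_cast at this ⊢
        rw [show k - n = k - (n + 1) + 1 by ring, this, Pi.add_apply]
        rw [show k - 1 - (n : ℤ) = k - (n + 1) by ring]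
      rw [this]
      exact eLpNorm_add_le (P.aesm_trunc _ u) (P.aesm_block _ u) le_top
  have hlow : Tendsto (fun n : ℕ => eLpNorm (P.trunc (k - n) u) ∞ volume + 2 ^ (k : ℝ) * B) atTop
      (𝓝 (0 + 2 ^ (k : ℝ) * B)) := by
    refine Tendsto.add_const _ ?_
    have hb : ∀ n : ℕ, eLpNorm (P.trunc (k - n) u) ∞ volume ≤
        (P.A * 2 ^ ((k : ℝ) * (3 / 2)) * eLpNorm u 2 volume) * 2 ^ (-(n : ℝ)) := by
      intro n
      have := P.eLpNorm_top_trunc_le (k - n) (Lp.aestronglyMeasurable u) one_le_two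
      rw [ENNReal.ofReal_ofNat] at this
      refine this.trans ?_
      have h : (2 : ℝ≥0∞) ^ (((k - n : ℤ) : ℝ) * (3 / 2)) ≤
          2 ^ ((k : ℝ) * (3 / 2)) * 2 ^ (-(n : ℝ)) := by
        rw [← two_rpow_add]
        refine two_rpow_mono ?_
        push_cast
        nlinarith [(Nat.cast_nonneg n : (0 : ℝ) ≤ n)]
      calc _ ≤ P.A * (2 ^ ((k : ℝ) * (3 / 2)) * 2 ^ (-(n : ℝ))) * eLpNorm u 2 volume := by gcongr
        _ = _ := by ring
    refine tendsto_of_tendsto_of_tendsto_of_le_of_le tendsto_const_nhds ?_ (fun _ => zero_le) hb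
    have hc : P.A * 2 ^ ((k : ℝ) * (3 / 2)) * eLpNorm u 2 volume ≠ ⊤ :=
      ENNReal.mul_ne_top (ENNReal.mul_ne_top P.A_ne_top (two_rpow_ne_top _)) (Lp.eLpNorm_ne_top u)
    simpa using ENNReal.Tendsto.const_mul tendsto_two_rpow_atBot (Or.inr hc)
  rw [zero_add] at hlow
  refine ge_of_tendsto' hlow fun n => (hstep n).trans ?_
  gcongr
  refine (ENNReal.sum_le_tsum (f := fun i : ℕ => eLpNorm (P.block (k - 1 - i) u) ∞ volume)
    _).trans ?_
  calc ∑' i : ℕ, eLpNorm (P.block (k - 1 - i) u) ∞ volume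
      ≤ ∑' i : ℕ, 2 ^ ((k : ℝ) - 1) * B * 2 ^ (-(i : ℝ)) := by
        refine ENNReal.tsum_le_tsum fun i => (hB _).trans (le_of_eq ?_)
        push_cast
        rw [sub_eq_add_neg _ (i : ℝ), two_rpow_add]
        ring
    _ = 2 ^ ((k : ℝ) - 1) * B * 2 := by rw [ENNReal.tsum_mul_left, tsum_two_rpow_neg]
    _ = 2 ^ (k : ℝ) * B := by
        nth_rewrite 2 [← ENNReal.rpow_one 2]
        rw [mul_right_comm, ← two_rpow_add]
        simp

/-- Low frequencies up to `2^n`: the frequencies below `1` are measured in `Ḃ^{-1}_{∞,∞}` and the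
remaining `n` blocks separately. -/
lemma eLpNorm_top_trunc_le_sum (u : L2Field) {B : ℝ≥0∞}
    (hB : ∀ k : ℤ, eLpNorm (P.block k u) ∞ volume ≤ 2 ^ (k : ℝ) * B) {l : ℤ} {n : ℕ}
    (hl : l ≤ n) : eLpNorm (P.trunc l u) ∞ volume ≤
      B + ∑ i ∈ Finset.range n, eLpNorm (P.block i u) ∞ volume := by
  rcases le_total l 0 with h0 | h0
  · refine (P.eLpNorm_top_trunc_le_of_block u hB l).trans (le_add_right ?_)
    exact mul_le_of_le_one_left' (two_rpow_le_one (by exact_mod_cast h0))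
  · lift l to ℕ using h0
    have hm : ∀ m : ℕ, eLpNorm (P.trunc m u) ∞ volume ≤
        B + ∑ i ∈ Finset.range m, eLpNorm (P.block i u) ∞ volume := by
      intro m
      induction m with
      | zero => simpa using P.eLpNorm_top_trunc_le_of_block u hB 0
      | succ m ih =>
        have : P.trunc (m + 1 : ℕ) u = P.trunc m u + P.block m u := by
          ext1 x
          push_cast
          exact P.trunc_succ m u x
        rw [this, Finset.sum_range_succ, ← add_assoc]
        exact (eLpNorm_add_le (P.aesm_trunc _ u) (P.aesm_block _ u) le_top).trans
          (add_le_add_left ih _)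
    refine (hm l).trans (add_le_add_right ?_ _)
    exact Finset.sum_le_sum_of_subset (Finset.range_mono (by exact_mod_cast hl))

end DyadicPartition

/-! ### The heat flow -/

lemma heatKernel_eq_cexp (t : ℝ) (x : R3) :
    (heatKernel t x : ℂ) = ((4 * Real.pi * t) ^ (-(3 / 2) : ℝ) : ℝ) •
      Complex.exp (-((1 / (4 * t) : ℝ) : ℂ) * ‖x‖ ^ 2) := by
  rw [heatKernel, Complex.real_smul]
  push_cast
  congr 2
  field_simp

lemma heatKernel_nonneg {t : ℝ} (ht : 0 < t) (x : R3) : 0 ≤ heatKernel t x := by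
  have := Real.pi_pos
  unfold heatKernel
  positivity

lemma continuous_heatKernel (t : ℝ) : Continuous (heatKernel t) := by
  unfold heatKernel
  fun_prop

lemma heatKernel_le {t : ℝ} (ht : 0 < t) (x : R3) :
    heatKernel t x ≤ (4 * Real.pi * t) ^ (-(3 / 2) : ℝ) := by
  have := Real.pi_pos
  unfold heatKernel
  refine mul_le_of_le_one_right (by positivity) (Real.exp_le_one_iff.2 ?_)
  rw [neg_div]
  have : 0 ≤ ‖x‖ ^ 2 / (4 * t) := by positivity
  linarith

lemma integrable_heatKernel {t : ℝ} (ht : 0 < t) : Integrable (heatKernel t) volume := by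
  have h := GaussianFourier.integrable_cexp_neg_mul_sq_norm_add (V := R3)
    (b := ((1 / (4 * t) : ℝ) : ℂ)) (by rw [Complex.ofReal_re]; positivity) 0 0
  have h2 := (h.smul ((4 * Real.pi * t) ^ (-(3 / 2) : ℝ) : ℝ)).re
  refine h2.congr (Eventually.of_forall fun x => ?_)
  have := heatKernel_eq_cexp t x
  simp only [Pi.smul_apply, inner_zero_left, Complex.ofReal_zero, mul_zero, add_zero]
  rw [← this]
  simp

lemma isKernel_heatKernel {t : ℝ} (ht : 0 < t) : IsKernel (heatKernel t) where
  integrable := integrable_heatKernel ht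
  memLp := by
    rw [memLp_two_iff_integrable_sq (continuous_heatKernel t).aestronglyMeasurable]
    simp only [sq]
    refine (integrable_heatKernel ht).bdd_mul (c := (4 * Real.pi * t) ^ (-(3 / 2) : ℝ))
      (continuous_heatKernel t).aestronglyMeasurable (Eventually.of_forall fun x => ?_)
    rw [Real.norm_of_nonneg (heatKernel_nonneg ht x)]
    exact heatKernel_le ht x

lemma symbol_heatKernel {t : ℝ} (ht : 0 < t) (v : R3) :
    symbol (heatKernel t) v = (Real.exp (-t * ‖(2 * Real.pi) • v‖ ^ 2) : ℂ) := by
  have hb : 0 < (((1 / (4 * t) : ℝ) : ℂ)).re := by rw [Complex.ofReal_re]; positivity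
  have h := fourier_gaussian_innerProductSpace hb v
  have e : (fun x => (heatKernel t x : ℂ)) = ((4 * Real.pi * t) ^ (-(3 / 2) : ℝ) : ℝ) •
      fun x : R3 => Complex.exp (-((1 / (4 * t) : ℝ) : ℂ) * ‖x‖ ^ 2) := by
    ext x; exact heatKernel_eq_cexp t x
  have hpi := Real.pi_pos
  rw [symbol, e, Real.fourier_eq]
  simp only [Pi.smul_apply, smul_comm _ ((4 * Real.pi * t) ^ (-(3 / 2) : ℝ) : ℝ)]
  rw [integral_smul, ← Real.fourier_eq, h, finrank_euclideanSpace, Fintype.card_fin]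
  have h1 : (Real.pi / ((1 / (4 * t) : ℝ) : ℂ)) = ((4 * Real.pi * t : ℝ) : ℂ) := by
    push_cast; field_simp
  have h2 : (((3 : ℕ) : ℂ) / 2) = ((3 / 2 : ℝ) : ℂ) := by push_cast; ring
  rw [h1, h2, ← Complex.ofReal_cpow (by positivity), Complex.real_smul, ← mul_assoc,
    ← Complex.ofReal_mul, ← Real.rpow_add (by positivity)]
  norm_num
  congr 1
  rw [norm_smul]
  push_cast
  rw [Real.norm_of_nonneg (by positivity)]
  push_cast
  rw [one_div, ← mul_inv, div_inv_eq_mul]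
  ring

lemma integral_heatKernel {t : ℝ} (ht : 0 < t) : ∫ x, heatKernel t x = 1 := by
  have h := symbol_heatKernel ht 0
  rw [symbol, Real.fourier_eq] at h
  simp only [inner_zero_right, neg_zero, AddChar.map_zero_eq_one, one_smul] at h
  rw [integral_complex_ofReal] at h
  have : ((∫ x, heatKernel t x : ℝ) : ℂ) = ((1 : ℝ) : ℂ) := by rw [h]; simp
  exact_mod_cast this

lemma lintegral_heatKernel {t : ℝ} (ht : 0 < t) : ∫⁻ x, ‖heatKernel t x‖ₑ = 1 := by
  rw [← ofReal_integral_norm_eq_lintegral_enorm (integrable_heatKernel ht)]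
  simp only [Real.norm_of_nonneg (heatKernel_nonneg ht _)]
  rw [integral_heatKernel ht, ENNReal.ofReal_one]

lemma heatKernel_le_mul {s t : ℝ} (ht : 0 < t) (hts : t ≤ s) (x : R3) :
    heatKernel t x ≤ (s / t) ^ (3 / 2 : ℝ) * heatKernel s x := by
  have hs : 0 < s := ht.trans_le hts
  have hpi := Real.pi_pos
  unfold heatKernel
  rw [← mul_assoc]
  have h1 : (s / t) ^ (3 / 2 : ℝ) * (4 * Real.pi * s) ^ (-(3 / 2) : ℝ) =
      (4 * Real.pi * t) ^ (-(3 / 2) : ℝ) := by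
    rw [Real.rpow_neg (by positivity), Real.rpow_neg (by positivity),
      ← Real.inv_rpow (by positivity), ← Real.inv_rpow (by positivity),
      ← Real.mul_rpow (by positivity) (by positivity)]
    congr 1
    field_simp
  rw [h1]
  gcongr ?_ * ?_
  rw [Real.exp_le_exp, neg_div, neg_div]
  gcongr

/-- The heat kernels at comparable times are close in `L¹`. Since `h_t ≤ (s/t)^{3/2} h_s` and both
kernels have mass one, no derivative of the kernel is needed. -/
lemma lintegral_heatKernel_sub_le {s t : ℝ} (ht : 0 < t) (hts : t ≤ s) :
    ∫⁻ x, ‖heatKernel t x - heatKernel s x‖ₑ ≤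
      ENNReal.ofReal (2 * ((s / t) ^ (3 / 2 : ℝ) - 1)) := by
  have hs : 0 < s := ht.trans_le hts
  have hit := integrable_heatKernel ht
  have his := integrable_heatKernel hs
  change ∫⁻ x, ‖(heatKernel t - heatKernel s) x‖ₑ ≤ _
  rw [← ofReal_integral_norm_eq_lintegral_enorm (hit.sub his)]
  simp only [Pi.sub_apply]
  refine ENNReal.ofReal_le_ofReal ?_
  have hr : 1 ≤ (s / t) ^ (3 / 2 : ℝ) :=
    Real.one_le_rpow ((one_le_div ht).2 hts) (by norm_num)
  set r := (s / t) ^ (3 / 2 : ℝ)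
  -- By `h_t ≤ r h_s`, the positive part of `h_t - h_s` is at most `(r - 1) h_s`, and
  -- `|f| = 2 f⁺ - f`.
  have hpt : ∀ x, ‖heatKernel t x - heatKernel s x‖ ≤
      2 * (r - 1) * heatKernel s x - (heatKernel t x - heatKernel s x) := by
    intro x
    have h1 := heatKernel_le_mul ht hts x
    have h2 := heatKernel_nonneg hs x
    rw [Real.norm_eq_abs, abs_le']
    constructor <;> nlinarith
  calc ∫ x, ‖heatKernel t x - heatKernel s x‖
      ≤ ∫ x, (2 * (r - 1) * heatKernel s x - (heatKernel t x - heatKernel s x)) :=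
        integral_mono (hit.sub his).norm ((his.const_mul _).sub (hit.sub his)) hpt
    _ = 2 * (r - 1) := by
        have hsub : Integrable (fun x => heatKernel t x - heatKernel s x) volume := hit.sub his
        rw [integral_sub (his.const_mul _) hsub, integral_sub hit his,
          integral_const_mul, integral_heatKernel ht, integral_heatKernel hs]
        ring

/-- The heat flow as a curve in `L²`, extended by zero to nonpositive times. -/
def heat (u : L2Field) (t : ℝ) : L2Field :=
  if ht : 0 < t then (isKernel_heatKernel ht).op u else 0

lemma coeFn_heat (u : L2Field) {t : ℝ} (ht : 0 < t) : heat u t =ᵐ[volume] heatFlow u t := by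
  rw [heat, dif_pos ht]
  exact IsKernel.coeFn_op _ u

lemma eLpNorm_heatFlow_le {f : R3 → R3} (hf : AEStronglyMeasurable f volume) {t : ℝ} (ht : 0 < t)
    {p : ℝ≥0∞} (hp : 1 ≤ p) : eLpNorm (heatFlow f t) p volume ≤ eLpNorm f p volume := by
  refine (eLpNorm_conv_le (integrable_heatKernel ht) hf hp).trans ?_
  rw [lintegral_heatKernel ht, one_mul]

lemma conv_sub_kernel {K L : R3 → ℝ} (hK : IsKernel K) (hL : IsKernel L) (u : L2Field) :
    conv (fun x => K x - L x) u = conv K u - conv L u := by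
  ext1 x
  rw [Pi.sub_apply, conv_apply, conv_apply, conv_apply,
    ← integral_sub (hK.convolutionExistsAt u x) (hL.convolutionExistsAt u x)]
  simp only [sub_smul]

lemma eLpNorm_heatFlow_sub_le (u : L2Field) {s t : ℝ} (ht : 0 < t) (hts : t ≤ s)
    {p : ℝ≥0∞} (hp : 1 ≤ p) : eLpNorm (heatFlow u t - heatFlow u s) p volume ≤
      ENNReal.ofReal (2 * ((s / t) ^ (3 / 2 : ℝ) - 1)) * eLpNorm u p volume := by
  have hs : 0 < s := ht.trans_le hts
  change eLpNorm (conv (heatKernel t) u - conv (heatKernel s) u) p volume ≤ _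
  rw [← conv_sub_kernel (isKernel_heatKernel ht) (isKernel_heatKernel hs)]
  exact (eLpNorm_conv_le ((integrable_heatKernel ht).sub (integrable_heatKernel hs))
    (Lp.aestronglyMeasurable u) hp).trans (mul_le_mul_left (lintegral_heatKernel_sub_le ht hts) _)

lemma continuousOn_heat (u : L2Field) : ContinuousOn (heat u) (Ioi 0) := by
  intro t₀ ht₀
  refine ContinuousAt.continuousWithinAt ?_
  have ht₀ : 0 < t₀ := ht₀
  rw [ContinuousAt, tendsto_iff_edist_tendsto_0]
  have hb : Tendsto (fun t => ENNReal.ofReal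
      (2 * ((max t t₀ / min t t₀) ^ (3 / 2 : ℝ) - 1)) * eLpNorm u 2 volume) (𝓝 t₀) (𝓝 0) := by
    have hc : ContinuousAt (fun t => 2 * ((max t t₀ / min t t₀) ^ (3 / 2 : ℝ) - 1)) t₀ := by
      have h1 : ContinuousAt (fun t => max t t₀ / min t t₀) t₀ := by
        refine ContinuousAt.div (by fun_prop) (by fun_prop) ?_
        simp [ht₀.ne']
      exact ((h1.rpow_const (Or.inr (by norm_num))).sub continuousAt_const).const_mul 2
    have h2 := (ENNReal.continuous_ofReal.tendsto _).comp hc.tendsto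
    have h3 := ENNReal.Tendsto.mul_const h2 (Or.inr (Lp.eLpNorm_ne_top u))
    simpa [Function.comp_def, ht₀.ne'] using h3
  refine tendsto_of_tendsto_of_tendsto_of_le_of_le' tendsto_const_nhds hb
    (Eventually.of_forall fun _ => zero_le) ?_
  filter_upwards [lt_mem_nhds ht₀] with t ht
  rw [Lp.edist_def]
  have hae : ⇑(heat u t) - ⇑(heat u t₀) =ᵐ[volume] heatFlow u t - heatFlow u t₀ :=
    (coeFn_heat u ht).sub (coeFn_heat u ht₀)
  rw [eLpNorm_congr_ae hae]
  rcases le_total t t₀ with h | h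
  · rw [max_eq_right h, min_eq_left h]
    exact eLpNorm_heatFlow_sub_le u ht h (by norm_num)
  · rw [max_eq_left h, min_eq_right h, eLpNorm_sub_comm]
    exact eLpNorm_heatFlow_sub_le u ht₀ h (by norm_num)

lemma aestronglyMeasurable_heat (u : L2Field) (T : ℝ) :
    AEStronglyMeasurable (heat u) (volume.restrict (Ioo 0 T)) :=
  ((continuousOn_heat u).mono Ioo_subset_Ioi_self).aestronglyMeasurable measurableSet_Ioo

lemma fourierL2_heat (u : L2Field) {t : ℝ} (ht : 0 < t) : fourierL2 (heat u t) =ᵐ[volume]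
    fun v => (Real.exp (-t * ‖(2 * Real.pi) • v‖ ^ 2) : ℂ) • fourierL2 u v := by
  rw [heat, dif_pos ht]
  filter_upwards [(isKernel_heatKernel ht).fourierL2_op u] with v hv
  rw [hv, symbol_heatKernel ht]

namespace DyadicPartition

variable (P : DyadicPartition)

/-- A symbol which inverts `1 - exp(-|ξ|²)` on the support of `φ`. The numerator is one there and
vanishes near the origin, where the denominator is zero. -/
def heatInv (ξ : R3) : ℝ :=
  (P.χ ((4 : ℝ)⁻¹ • ξ) - P.χ ((4 : ℝ) • ξ)) / (1 - Real.exp (-‖ξ‖ ^ 2))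

lemma heatInv_isSymbol : IsSymbol P.heatInv where
  smooth := by
    rw [contDiff_iff_contDiffAt]
    intro ξ
    by_cases hξ : ξ = 0
    · subst hξ
      refine (contDiffAt_const (c := (0 : ℝ))).congr_of_eventuallyEq ?_
      filter_upwards [Metric.ball_mem_nhds (0 : R3) (by norm_num : (0 : ℝ) < 3 / 16)] with η hη
      rw [mem_ball_zero_iff] at hη
      rw [heatInv, P.χ_eq_one, P.χ_eq_one, sub_self, zero_div] <;>
      · rw [norm_smul]
        norm_num
        linarith [norm_nonneg η]
    · have hexp : ContDiffAt ℝ ∞ (fun η : R3 => 1 - Real.exp (-‖η‖ ^ 2)) ξ :=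
        (contDiff_const.sub (Real.contDiff_exp.comp (contDiff_norm_sq ℝ).neg)).contDiffAt
      refine ContDiffAt.div (ContDiff.contDiffAt ?_) hexp ?_
      · exact ((P.χ_isSymbol.comp_smul (by norm_num)).sub
          (P.χ_isSymbol.comp_smul (by norm_num))).smooth
      · have : 0 < ‖ξ‖ ^ 2 := by positivity
        exact (sub_pos.2 (Real.exp_lt_one_iff.2 (by linarith : -‖ξ‖ ^ 2 < 0))).ne'
  compact := by
    have := ((P.χ_isSymbol.comp_smul (a := (4 : ℝ)⁻¹) (by norm_num)).sub
      (P.χ_isSymbol.comp_smul (a := 4) (by norm_num))).compact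
    unfold heatInv
    simp only [div_eq_mul_inv]
    exact this.mul_right
  even ξ := by
    rw [heatInv, heatInv, norm_neg, smul_neg, smul_neg, P.χ_isSymbol.even, P.χ_isSymbol.even]

lemma heatInv_mul {ξ : R3} (h1 : 3 / 4 ≤ ‖ξ‖) (h2 : ‖ξ‖ ≤ 8 / 3) :
    P.heatInv ξ * (1 - Real.exp (-‖ξ‖ ^ 2)) = 1 := by
  have h3 : 1 - Real.exp (-‖ξ‖ ^ 2) ≠ 0 := by
    have : 0 < ‖ξ‖ ^ 2 := by positivity
    exact (sub_pos.2 (Real.exp_lt_one_iff.2 (by linarith : -‖ξ‖ ^ 2 < 0))).ne'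
  rw [heatInv, div_mul_cancel₀ _ h3, P.χ_eq_one, P.χ_eq_zero, sub_zero]
  · rw [norm_smul]; norm_num; linarith
  · rw [norm_smul]; norm_num; linarith

lemma Δ_heat (k : ℤ) (u : L2Field) {t : ℝ} (ht : 0 < t) :
    P.Δ k (heat u t) = heat (P.Δ k u) t := by
  refine ext_fourierL2 ?_
  filter_upwards [P.fourierL2_Δ k (heat u t), fourierL2_heat u ht, fourierL2_heat (P.Δ k u) ht,
    P.fourierL2_Δ k u] with v h1 h2 h3 h4
  rw [h1, h2, h3, h4, smul_comm]

/-- The constant in the smoothing estimate for the heat flow. The factor `6` comes from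
`2 ((1 + x)^{3/2} - 1) ≤ 6 x` for `0 ≤ x ≤ 1`. -/
def H : ℝ≥0∞ := 1 + 6 * ∫⁻ x, ‖kernel P.heatInv x‖ₑ

lemma H_ne_top : P.H ≠ ⊤ := by
  have := P.heatInv_isSymbol.isKernel.integrable.2
  rw [HasFiniteIntegral] at this
  rw [H]
  finiteness

/-- On the frequencies `|ξ| ∼ 2^k`, the heat flow at time `t` is a multiplier of order zero applied
to the difference of the flows at the times `t` and `t + 4^{-k}`. -/
lemma heat_Δ_eq (k : ℤ) (u : L2Field) {t : ℝ} (ht : 0 < t) :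
    heat (P.Δ k u) t = (P.heatInv_isSymbol.comp_smul (a := (2 : ℝ) ^ (-k))
      (by positivity)).isKernel.op
        (heat (P.Δ k u) t - heat (P.Δ k u) (t + ((2 : ℝ) ^ (-k)) ^ 2)) := by
  have hs : 0 < t + ((2 : ℝ) ^ (-k)) ^ 2 := by positivity
  refine ext_fourierL2 ?_
  have hψ := P.heatInv_isSymbol.comp_smul (a := (2 : ℝ) ^ (-k)) (by positivity)
  have h6 := fourierL2_sub (heat (P.Δ k u) t) (heat (P.Δ k u) (t + ((2 : ℝ) ^ (-k)) ^ 2))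
  filter_upwards [fourierL2_heat (P.Δ k u) ht, fourierL2_heat (P.Δ k u) hs, P.fourierL2_Δ k u,
    hψ.isKernel.fourierL2_op
      (heat (P.Δ k u) t - heat (P.Δ k u) (t + ((2 : ℝ) ^ (-k)) ^ 2)),
    Lp.coeFn_sub (fourierL2 (heat (P.Δ k u) t))
      (fourierL2 (heat (P.Δ k u) (t + ((2 : ℝ) ^ (-k)) ^ 2)))] with v h1 h2 h3 h4 h5
  rw [h4, h6, h5, Pi.sub_apply, h1, h2, h3, hψ.symbol_kernel]
  generalize (2 * Real.pi) • v = ξ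
  rw [← sub_smul, smul_smul, smul_smul, smul_smul]
  congr 1
  by_cases hv1 : ‖(2 : ℝ) ^ (-k) • ξ‖ < 3 / 4
  · rw [P.φ_eq_zero_of_lt hv1]; simp
  by_cases hv2 : 8 / 3 < ‖(2 : ℝ) ^ (-k) • ξ‖
  · rw [P.φ_eq_zero_of_gt hv2]; simp
  have h := P.heatInv_mul (not_lt.1 hv1) (not_lt.1 hv2)
  have he : Real.exp (-(t + ((2 : ℝ) ^ (-k)) ^ 2) * ‖ξ‖ ^ 2) =
      Real.exp (-t * ‖ξ‖ ^ 2) * Real.exp (-‖(2 : ℝ) ^ (-k) • ξ‖ ^ 2) := by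
    rw [← Real.exp_add, norm_smul, Real.norm_of_nonneg (by positivity)]
    congr 1; ring
  rw [he]
  norm_cast
  linear_combination -(Real.exp (-t * ‖ξ‖ ^ 2) * P.φ ((2 : ℝ) ^ (-k) • ξ)) * h

/-- Smoothing of the heat flow on a dyadic block: the flow at the time `t` contracts, and gains
`4^{-k}/t` for large times. -/
theorem eLpNorm_block_heat_le (k : ℤ) (u : L2Field) {t : ℝ} (ht : 0 < t) {p : ℝ≥0∞} (hp : 1 ≤ p) :
    eLpNorm (P.block k (heat u t)) p volume ≤
      P.H * ENNReal.ofReal (min 1 (((2 : ℝ) ^ (-k)) ^ 2 / t)) * eLpNorm (P.block k u) p volume := by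
  set τ : ℝ := ((2 : ℝ) ^ (-k)) ^ 2 with hτ
  have hτ0 : 0 < τ := by positivity
  have e1 : eLpNorm (P.block k (heat u t)) p volume = eLpNorm (heat (P.Δ k u) t) p volume := by
    rw [← P.Δ_heat k u ht, eLpNorm_congr_ae (P.coeFn_Δ k (heat u t))]
  rw [e1, ← eLpNorm_congr_ae (P.coeFn_Δ k u)]
  rcases le_total 1 (τ / t) with h | h
  · rw [min_eq_left h, ENNReal.ofReal_one, mul_one, eLpNorm_congr_ae (coeFn_heat _ ht)]
    refine (eLpNorm_heatFlow_le (Lp.aestronglyMeasurable _) ht hp).trans ?_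
    exact le_mul_of_one_le_left' le_self_add
  · rw [min_eq_right h]
    have hs : 0 < t + τ := by positivity
    have hae : ⇑(heat (P.Δ k u) t - heat (P.Δ k u) (t + τ)) =ᵐ[volume]
        heatFlow (P.Δ k u) t - heatFlow (P.Δ k u) (t + τ) :=
      (Lp.coeFn_sub _ _).trans ((coeFn_heat _ ht).sub (coeFn_heat _ hs))
    have h2 : eLpNorm (heat (P.Δ k u) t) p volume ≤ (∫⁻ x, ‖kernel P.heatInv x‖ₑ) *
        eLpNorm ⇑(heat (P.Δ k u) t - heat (P.Δ k u) (t + τ)) p volume := by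
      nth_rewrite 1 [P.heat_Δ_eq k u ht]
      rw [eLpNorm_congr_ae (IsKernel.coeFn_op _ _)]
      exact eLpNorm_multiplier_le P.heatInv_isSymbol (Lp.aestronglyMeasurable _) k hp
    refine h2.trans ?_
    rw [eLpNorm_congr_ae hae]
    refine (mul_le_mul_right (eLpNorm_heatFlow_sub_le _ ht (by linarith) hp) _).trans ?_
    rw [← mul_assoc]
    refine mul_le_mul_left ?_ _
    have hx : 2 * (((t + τ) / t) ^ (3 / 2 : ℝ) - 1) ≤ 6 * (τ / t) := by
      have hx0 : 0 ≤ τ / t := by positivity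
      have hd : (t + τ) / t = 1 + τ / t := by field_simp
      have h3 : (1 + τ / t) ^ (3 / 2 : ℝ) ≤ (1 + τ / t) ^ (2 : ℝ) :=
        Real.rpow_le_rpow_of_exponent_le (by linarith) (by norm_num)
      rw [Real.rpow_two] at h3
      rw [hd]
      nlinarith
    calc (∫⁻ x, ‖kernel P.heatInv x‖ₑ) * ENNReal.ofReal (2 * (((t + τ) / t) ^ (3 / 2 : ℝ) - 1))
        ≤ (∫⁻ x, ‖kernel P.heatInv x‖ₑ) * ENNReal.ofReal (6 * (τ / t)) := by gcongr
      _ = (6 * ∫⁻ x, ‖kernel P.heatInv x‖ₑ) * ENNReal.ofReal (τ / t) := by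
          rw [ENNReal.ofReal_mul (by norm_num), ENNReal.ofReal_ofNat]; ring
      _ ≤ P.H * ENNReal.ofReal (τ / t) := by
          gcongr
          exact le_add_self

end DyadicPartition

lemma lintegral_min_one_div_sq_le (T : ℝ) {τ : ℝ} (hτ : 0 < τ) :
    ∫⁻ t in Ioo 0 T, ENNReal.ofReal (min 1 (τ / t)) ^ (2 : ℝ) ≤
      min (ENNReal.ofReal T) (ENNReal.ofReal (2 * τ)) := by
  have hle : ∀ t, ENNReal.ofReal (min 1 (τ / t)) ^ (2 : ℝ) ≤ 1 := fun t =>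
    ENNReal.rpow_le_one (ENNReal.ofReal_le_one.2 (min_le_left _ _)) zero_le_two
  refine le_min ?_ ?_
  · calc _ ≤ ∫⁻ t in Ioo 0 T, 1 := lintegral_mono hle
      _ = _ := by simp
  · have hsub : Ioo 0 T ⊆ Ioc 0 τ ∪ Ioi τ := fun t ht => by
      rcases le_or_gt t τ with h | h
      · exact Or.inl ⟨ht.1, h⟩
      · exact Or.inr h
    refine (lintegral_mono_set hsub).trans ((lintegral_union_le _ _ _).trans ?_)
    rw [two_mul, ENNReal.ofReal_add hτ.le hτ.le]
    gcongr
    · calc _ ≤ ∫⁻ t in Ioc 0 τ, 1 := lintegral_mono hle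
        _ = _ := by simp
    · have hint : IntegrableOn (fun t : ℝ => τ ^ 2 * t ^ (-2 : ℝ)) (Ioi τ) :=
        (integrableOn_Ioi_rpow_of_lt (by norm_num) hτ).const_mul _
      have hval : ∫ t in Ioi τ, τ ^ 2 * t ^ (-2 : ℝ) = τ := by
        rw [integral_const_mul, integral_Ioi_rpow_of_lt (by norm_num) hτ]
        norm_num
        rw [Real.rpow_neg_one]
        field_simp
      calc _ ≤ ∫⁻ t in Ioi τ, ENNReal.ofReal (τ ^ 2 * t ^ (-2 : ℝ)) := by
            refine setLIntegral_mono' measurableSet_Ioi fun t ht => ?_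
            have ht0 : 0 < t := hτ.trans ht
            rw [ENNReal.ofReal_rpow_of_nonneg (le_min zero_le_one (by positivity)) zero_le_two]
            refine ENNReal.ofReal_le_ofReal ?_
            rw [Real.rpow_neg ht0.le, Real.rpow_two, Real.rpow_two]
            calc min 1 (τ / t) ^ 2 ≤ (τ / t) ^ 2 := by
                  gcongr
                  exact min_le_right _ _
              _ = _ := by field_simp
        _ = ENNReal.ofReal τ := by
            rw [← ofReal_integral_eq_lintegral_ofReal hint
              ((ae_restrict_mem measurableSet_Ioi).mono fun t ht => ?_), hval]
            have ht0 : 0 < t := hτ.trans ht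
            show 0 ≤ _
            positivity

/-- The smoothing estimate in `L²(0,T; L^p)` for a dyadic block. -/
theorem DyadicPartition.timeNorm_block_heat_le (P : DyadicPartition) (k : ℤ) (u : L2Field) (T : ℝ)
    {p : ℝ≥0∞} (hp : 1 ≤ p) :
    timeNorm 2 T (fun t => eLpNorm (P.block k (heat u t)) p volume) ≤
      P.H * min (ENNReal.ofReal T) (2 * 2 ^ (-(2 * k : ℝ))) ^ (1 / 2 : ℝ) *
        eLpNorm (P.block k u) p volume := by
  have h1 : timeNorm 2 T (fun t => eLpNorm (P.block k (heat u t)) p volume) ≤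
      timeNorm 2 T (fun t => (P.H * eLpNorm (P.block k u) p volume) *
        ENNReal.ofReal (min 1 (((2 : ℝ) ^ (-k)) ^ 2 / t))) := by
    refine timeNorm_mono ((ae_restrict_mem measurableSet_Ioo).mono fun t ht => ?_)
    refine (P.eLpNorm_block_heat_le k u ht.1 hp).trans (le_of_eq ?_)
    ring
  refine h1.trans ?_
  rw [timeNorm_const_mul (by fun_prop), mul_right_comm]
  gcongr
  rw [timeNorm_two_eq]
  gcongr
  refine (lintegral_min_one_div_sq_le T (by positivity)).trans (le_of_eq ?_)
  congr 1
  rw [ENNReal.ofReal_mul zero_le_two, ENNReal.ofReal_ofNat, two_rpow_ofReal]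
  congr 2
  rw [← zpow_natCast, ← zpow_mul, ← Real.rpow_intCast]
  congr 1
  push_cast
  ring

/-! ### Products of fields -/

lemma norm_tensor (a b : R3 → R3) (x : R3) : ‖tensor a b x‖ = ‖a x‖ * ‖b x‖ := by
  rw [EuclideanSpace.norm_eq, EuclideanSpace.norm_eq, EuclideanSpace.norm_eq,
    ← Real.sqrt_mul (Finset.sum_nonneg fun i _ => sq_nonneg _), Fintype.sum_prod_type,
    Finset.sum_mul_sum]
  simp [tensor, mul_pow]

lemma continuous_tensor_apply :
    Continuous fun z : R3 × R3 =>
      (WithLp.toLp 2 fun ik : Fin 3 × Fin 3 => z.1 ik.1 * z.2 ik.2 : M3) := by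
  fun_prop

lemma aesm_tensor {a b : R3 → R3} (ha : AEStronglyMeasurable a volume)
    (hb : AEStronglyMeasurable b volume) : AEStronglyMeasurable (tensor a b) volume :=
  continuous_tensor_apply.comp_aestronglyMeasurable (ha.prodMk hb)

lemma eLpNorm_tensor_comm (a b : R3 → R3) (p : ℝ≥0∞) :
    eLpNorm (tensor a b) p volume = eLpNorm (tensor b a) p volume :=
  eLpNorm_congr_norm_ae (Eventually.of_forall fun x => by
    rw [norm_tensor, norm_tensor, mul_comm])

lemma eLpNorm_tensor_le {a b : R3 → R3} (ha : AEStronglyMeasurable a volume)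
    (hb : AEStronglyMeasurable b volume) (p q r : ℝ≥0∞) [ENNReal.HolderTriple p q r] :
    eLpNorm (tensor a b) r volume ≤ eLpNorm a p volume * eLpNorm b q volume := by
  refine le_trans (le_of_eq ?_) (eLpNorm_smul_le_mul_eLpNorm (p := p) (q := q) (r := r)
    (φ := fun x => ‖a x‖) (f := b) hb ha.norm |>.trans (le_of_eq ?_))
  · refine eLpNorm_congr_norm_ae (Eventually.of_forall fun x => ?_)
    rw [norm_tensor, Pi.smul_apply', norm_smul, norm_norm]
  · rw [eLpNorm_norm]

lemma memLp_tensor {a b : R3 → R3} (ha : MemLp a 2 volume) (hb : MemLp b 2 volume) :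
    MemLp (tensor a b) 1 volume :=
  ⟨aesm_tensor ha.1 hb.1, (eLpNorm_tensor_le ha.1 hb.1 2 2 1).trans_lt
    (ENNReal.mul_lt_top ha.2 hb.2)⟩

lemma tensor_add_add (a a' b b' : R3 → R3) (x : R3) :
    tensor (a + a') (b + b') x - tensor a b x = tensor a' (b + b') x + tensor a b' x := by
  ext ik
  simp [tensor]
  ring

lemma tendsto_tensor {a b : R3} {f g : ℕ → R3 → R3} {u w : R3 → R3} {x : R3}
    (hf : Tendsto (fun i => f i x) atTop (𝓝 a)) (hg : Tendsto (fun i => g i x) atTop (𝓝 b))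
    (ha : u x = a) (hb : w x = b) :
    Tendsto (fun i => tensor (f i) (g i) x) atTop (𝓝 (tensor u w x)) := by
  have := (continuous_tensor_apply.tendsto (a, b)).comp (hf.prodMk_nhds hg)
  simp only [tensor, ha, hb]
  exact this

namespace DyadicPartition

variable (P : DyadicPartition)

/-- The size in `L²` of the paraproducts `Δ̇_k a ⊗ Ṡ_l b` with `l ≤ k + 1`. -/
def paraNorm (k : ℤ) (a b : L2Field) : ℝ≥0∞ :=
  ⨆ (l : ℤ) (_ : l ≤ k + 1), eLpNorm (tensor (P.block k a) (P.trunc l b)) 2 volume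

lemma le_paraNorm {k l : ℤ} (h : l ≤ k + 1) (a b : L2Field) :
    eLpNorm (tensor (P.block k a) (P.trunc l b)) 2 volume ≤ P.paraNorm k a b :=
  le_iSup₂_of_le l h le_rfl

/-- The sum of all paraproducts of `a` and `b` at frequencies at least `2^J`. -/
def paraSum (J : ℤ) (a b : L2Field) : ℝ≥0∞ :=
  ∑' i : ℕ, (P.paraNorm (J + i) a b + P.paraNorm (J + i) b a)

lemma paraSum_comm (J : ℤ) (a b : L2Field) : P.paraSum J a b = P.paraSum J b a := by
  simp only [paraSum, add_comm]

lemma memLp_trunc (k : ℤ) (u : L2Field) : MemLp (P.trunc k u) 2 volume :=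
  (P.χj_isSymbol k).isKernel.memLp_conv u

lemma aesm_tensor_trunc (k l : ℤ) (a b : L2Field) :
    AEStronglyMeasurable (tensor (P.trunc k a) (P.trunc l b)) volume :=
  aesm_tensor (P.aesm_trunc k a) (P.aesm_trunc l b)

/-- The telescoping bound between two truncations, in which
`a_{n+1} ⊗ b_{n+1} - a_n ⊗ b_n = Δ̇a ⊗ b_{n+1} + a_n ⊗ Δ̇b`. -/
lemma eLpNorm_tensor_trunc_sub_le (J : ℤ) (n : ℕ) (a b : L2Field) :
    eLpNorm (tensor (P.trunc (J + n) a) (P.trunc (J + n) b) -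
      tensor (P.trunc J a) (P.trunc J b)) 2 volume ≤ P.paraSum J a b := by
  refine le_trans ?_ (ENNReal.sum_le_tsum (Finset.range n))
  induction n with
  | zero => simp
  | succ n ih =>
    rw [Finset.sum_range_succ]
    have hs : ∀ u : L2Field, P.trunc (J + (n + 1 : ℕ)) u =
        P.trunc (J + n) u + P.block (J + n) u := by
      intro u
      ext1 x
      push_cast
      rw [← add_assoc]
      exact P.trunc_succ (J + n) u x
    have e : tensor (P.trunc (J + (n + 1 : ℕ)) a) (P.trunc (J + (n + 1 : ℕ)) b) -
        tensor (P.trunc J a) (P.trunc J b) =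
        (tensor (P.trunc (J + n) a) (P.trunc (J + n) b) - tensor (P.trunc J a) (P.trunc J b)) +
        (tensor (P.block (J + n) a) (P.trunc (J + n + 1) b) +
          tensor (P.trunc (J + n) a) (P.block (J + n) b)) := by
      have hb : P.trunc (J + n + 1) b = P.trunc (J + n) b + P.block (J + n) b := by
        rw [← hs b]; push_cast; rw [add_assoc]
      rw [hb, hs a, hs b]
      ext1 x
      simp only [Pi.add_apply, Pi.sub_apply]
      rw [← tensor_add_add]
      abel
    rw [e]
    have m1 := aesm_tensor (P.aesm_block (J + n) a) (P.aesm_trunc (J + n + 1) b)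
    have m2 := aesm_tensor (P.aesm_trunc (J + n) a) (P.aesm_block (J + n) b)
    refine (eLpNorm_add_le ((P.aesm_tensor_trunc _ _ a b).sub (P.aesm_tensor_trunc _ _ a b))
      (m1.add m2) (by norm_num)).trans (add_le_add ih ?_)
    refine (eLpNorm_add_le m1 m2 (by norm_num)).trans (add_le_add (P.le_paraNorm le_rfl a b) ?_)
    rw [eLpNorm_tensor_comm]
    exact P.le_paraNorm (by linarith) b a

lemma exists_seq_tendsto_trunc (J : ℤ) (a b : L2Field) : ∃ ns : ℕ → ℕ, ∀ᵐ x,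
    Tendsto (fun i => P.trunc (J + ns i) a x) atTop (𝓝 (a x)) ∧
      Tendsto (fun i => P.trunc (J + ns i) b x) atTop (𝓝 (b x)) := by
  obtain ⟨ns, hns, ha⟩ := (tendstoInMeasure_of_tendsto_eLpNorm two_ne_zero
    (fun n : ℕ => P.aesm_trunc (J + n) a) (Lp.aestronglyMeasurable a)
    (P.tendsto_trunc J a)).exists_seq_tendsto_ae
  obtain ⟨ms, hms, hb⟩ := (tendstoInMeasure_of_tendsto_eLpNorm two_ne_zero
    (fun n : ℕ => P.aesm_trunc (J + ns n) b) (Lp.aestronglyMeasurable b)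
    ((P.tendsto_trunc J b).comp hns.tendsto_atTop)).exists_seq_tendsto_ae
  refine ⟨fun i => ns (ms i), ?_⟩
  filter_upwards [ha, hb] with x hx hx'
  exact ⟨hx.comp hms.tendsto_atTop, hx'⟩

/-- The high frequency part of a product, by telescoping and Fatou's lemma. -/
lemma eLpNorm_tensor_sub_le (J : ℤ) (a b : L2Field) :
    eLpNorm (tensor a b - tensor (P.trunc J a) (P.trunc J b)) 2 volume ≤ P.paraSum J a b := by
  obtain ⟨ns, hns⟩ := P.exists_seq_tendsto_trunc J a b
  refine (Lp.eLpNorm_lim_le_liminf_eLpNorm (p := 2) (f := fun i =>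
    tensor (P.trunc (J + ns i) a) (P.trunc (J + ns i) b) - tensor (P.trunc J a) (P.trunc J b))
    (fun i => (P.aesm_tensor_trunc _ _ a b).sub (P.aesm_tensor_trunc _ _ a b)) _ ?_).trans ?_
  · filter_upwards [hns] with x hx
    exact (tendsto_tensor hx.1 hx.2 rfl rfl).sub_const _
  · exact liminf_le_of_le (by isBoundedDefault) fun c hc =>
      (hc.exists.choose_spec).trans (P.eLpNorm_tensor_trunc_sub_le J _ a b)

/-- The product of the high frequencies of one field with the low frequencies of another one is a
sum of paraproducts. -/
lemma eLpNorm_tensor_sub_trunc_le (j : ℤ) (a b : L2Field) :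
    eLpNorm (tensor (a - P.trunc j a) (P.trunc j b)) 2 volume ≤
      ∑' i : ℕ, P.paraNorm (j + i) a b := by
  have hfin : ∀ n : ℕ, eLpNorm (tensor (P.trunc (j + n) a - P.trunc j a) (P.trunc j b)) 2 volume ≤
      ∑' i : ℕ, P.paraNorm (j + i) a b := by
    intro n
    refine le_trans ?_ (ENNReal.sum_le_tsum (Finset.range n))
    induction n with
    | zero =>
      have : tensor (P.trunc (j + (0 : ℕ)) a - P.trunc j a) (P.trunc j b) = 0 := by
        ext x ik; simp [tensor]
      rw [this]; simp
    | succ n ih =>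
      rw [Finset.sum_range_succ]
      have e : tensor (P.trunc (j + (n + 1 : ℕ)) a - P.trunc j a) (P.trunc j b) =
          tensor (P.trunc (j + n) a - P.trunc j a) (P.trunc j b) +
            tensor (P.block (j + n) a) (P.trunc j b) := by
        ext x ik
        have := P.trunc_succ (j + n) a x
        push_cast
        rw [add_assoc] at this
        simp only [tensor, Pi.sub_apply, this, Pi.add_apply, PiLp.sub_apply, PiLp.add_apply]
        ring
      rw [e]
      refine (eLpNorm_add_le (aesm_tensor ((P.aesm_trunc _ a).sub (P.aesm_trunc _ a))
        (P.aesm_trunc _ b)) (aesm_tensor (P.aesm_block _ a) (P.aesm_trunc _ b))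
        (by norm_num)).trans
          (add_le_add ih (P.le_paraNorm (by linarith [Int.natCast_nonneg n]) a b))
  obtain ⟨ns, hns⟩ := P.exists_seq_tendsto_trunc j a b
  refine (Lp.eLpNorm_lim_le_liminf_eLpNorm (p := 2) (f := fun i =>
    tensor (P.trunc (j + ns i) a - P.trunc j a) (P.trunc j b))
    (fun i => aesm_tensor ((P.aesm_trunc _ a).sub (P.aesm_trunc _ a)) (P.aesm_trunc _ b)) _
    ?_).trans ?_
  · filter_upwards [hns] with x hx
    exact tendsto_tensor (f := fun i => P.trunc (j + ns i) a - P.trunc j a)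
      (g := fun _ => P.trunc j b) (hx.1.sub_const (P.trunc j a x)) tendsto_const_nhds rfl rfl
  · exact liminf_le_of_le (by isBoundedDefault) fun c hc =>
      (hc.exists.choose_spec).trans (hfin _)

/-! ### Frequency localization of products -/

lemma integrable_kernel_smul {F : R3 → M3} (hF : MemLp F 1 volume) (j : ℤ) (x : R3) :
    Integrable (fun y => kernel (fun ξ => P.χ ((2 : ℝ) ^ (-j) • ξ)) y • F (x - y)) volume :=
  memLp_one_iff_integrable.1 ((hF.comp_measurePreserving
    (Measure.measurePreserving_sub_left volume x)).smul ((P.χj_isSymbol j).memLp_kernel ∞))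

lemma trunc_tensor_sub {F G : R3 → M3} (hF : MemLp F 1 volume) (hG : MemLp G 1 volume) (j : ℤ) :
    P.trunc j (F - G) = P.trunc j F - P.trunc j G := by
  ext1 x
  change conv (kernel _) (F - G) x = conv (kernel _) F x - conv (kernel _) G x
  rw [conv_apply, conv_apply, conv_apply, ← integral_sub (P.integrable_kernel_smul hF j x)
    (P.integrable_kernel_smul hG j x)]
  simp only [Pi.sub_apply, smul_sub]

/-- The frequencies of a component of `Ṡ_J a`. -/
def truncHat (J : ℤ) (a : L2Field) (i : Fin 3) (v : R3) : ℂ :=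
  (symbol (kernel (fun ξ => P.χ ((2 : ℝ) ^ (-J) • ξ))) v • fourierL2 a v) i

lemma integrable_truncHat (J : ℤ) (a : L2Field) (i : Fin 3) :
    Integrable (P.truncHat J a i) volume :=
  (EuclideanSpace.proj i : C3 →L[ℂ] ℂ).integrable_comp
    ((P.χj_isSymbol J).isKernel.integrable_symbol_smul a)

lemma ofReal_trunc_apply (J : ℤ) (a : L2Field) (i : Fin 3) (x : R3) :
    ((P.trunc J a x i : ℝ) : ℂ) = 𝓕⁻ (P.truncHat J a i) x := by
  rw [← toComplex_apply]
  change toComplex (conv _ _ x) i = _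
  rw [(P.χj_isSymbol J).isKernel.toComplex_conv, Real.fourierInv_eq, Real.fourierInv_eq]
  have hi : Integrable (fun v => Real.fourierChar (inner ℝ v x) •
      (symbol (kernel (fun ξ => P.χ ((2 : ℝ) ^ (-J) • ξ))) v • fourierL2 a v)) volume := by
    have := (Real.fourierIntegral_convergent_iff (V := R3) (-x)).2
      ((P.χj_isSymbol J).isKernel.integrable_symbol_smul a)
    simpa using this
  exact ((EuclideanSpace.proj i : C3 →L[ℂ] ℂ).integral_comp_comm hi).symm

lemma truncHat_eq_zero {J : ℤ} (a : L2Field) (i : Fin 3) {v : R3}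
    (h : 4 / 3 ≤ ‖(2 : ℝ) ^ (-J) • (2 * Real.pi) • v‖) : P.truncHat J a i v = 0 := by
  rw [truncHat, (P.χj_isSymbol J).symbol_kernel, P.χ_eq_zero h]
  simp

/-- A product of fields with frequencies below `2^{j-3}·4/3` is unchanged by `Ṡ_j`. -/
lemma trunc_tensor_trunc (j : ℤ) (a b : L2Field) :
    P.trunc j (tensor (P.trunc (j - 3) a) (P.trunc (j - 3) b)) =
      tensor (P.trunc (j - 3) a) (P.trunc (j - 3) b) := by
  ext x ik
  set K := kernel (fun ξ => P.χ ((2 : ℝ) ^ (-j) • ξ)) with hK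
  have hKi : Integrable K volume := (P.χj_isSymbol j).isKernel.integrable
  -- The Fourier transform of a component of the product.
  let c : R3 → ℂ := P.truncHat (j - 3) a ik.1 ⋆[ContinuousLinearMap.mul ℂ ℂ, volume]
    P.truncHat (j - 3) b ik.2
  have ha := P.integrable_truncHat (j - 3) a ik.1
  have hb := P.integrable_truncHat (j - 3) b ik.2
  have hc : Integrable c volume := ha.integrable_convolution _ hb
  have hprod : ∀ w, ((tensor (P.trunc (j - 3) a) (P.trunc (j - 3) b) w ik : ℝ) : ℂ) = 𝓕⁻ c w := by
    intro w
    simp only [tensor, Complex.ofReal_mul, P.ofReal_trunc_apply, c]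
    rw [Real.fourierInv_eq_fourier_neg, Real.fourierInv_eq_fourier_neg,
      Real.fourierInv_eq_fourier_neg, Real.fourier_mul_convolution_eq ha hb]
  -- Two frequencies below `2^{j-3} · 4/3` add up to one below `2^j · 1/3`, where the symbol is one.
  have hsupp : ∀ v, symbol K v * c v = c v := by
    intro v
    by_cases hv : ‖(2 : ℝ) ^ (-j) • (2 * Real.pi) • v‖ < 3 / 4
    · rw [hK, (P.χj_isSymbol j).symbol_kernel, P.χ_eq_one hv]; simp
    · have : c v = 0 := by
        refine integral_eq_zero_of_ae (Eventually.of_forall fun w => ?_)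
        simp only [ContinuousLinearMap.mul_apply', Pi.zero_apply, mul_eq_zero]
        by_contra! hne
        have h1 := lt_of_not_ge fun h => hne.1 (P.truncHat_eq_zero a ik.1 h)
        have h2 := lt_of_not_ge fun h => hne.2 (P.truncHat_eq_zero b ik.2 h)
        apply hv
        have h8 : ∀ z : R3, ‖(2 : ℝ) ^ (-(j - 3)) • (2 * Real.pi) • z‖ =
            8 * ‖(2 : ℝ) ^ (-j) • (2 * Real.pi) • z‖ := by
          intro z
          rw [show -(j - 3) = 3 + -j by ring, zpow_add₀ two_ne_zero, ← smul_smul, norm_smul]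
          norm_num
        rw [h8] at h1 h2
        have h3 : (2 : ℝ) ^ (-j) • (2 * Real.pi) • v = (2 : ℝ) ^ (-j) • (2 * Real.pi) • w +
            (2 : ℝ) ^ (-j) • (2 * Real.pi) • (v - w) := by
          rw [← smul_add, ← smul_add, add_sub_cancel]
        rw [h3]
        exact (norm_add_le _ _).trans_lt (by linarith)
      rw [this, mul_zero]
  have hF := memLp_tensor (P.memLp_trunc (j - 3) a) (P.memLp_trunc (j - 3) b)
  have hcomm := (EuclideanSpace.proj ik : M3 →L[ℝ] ℝ).integral_comp_comm
    (P.integrable_kernel_smul hF j x)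
  have hgoal : ((P.trunc j (tensor (P.trunc (j - 3) a) (P.trunc (j - 3) b)) x ik : ℝ) : ℂ) =
      ((tensor (P.trunc (j - 3) a) (P.trunc (j - 3) b) x ik : ℝ) : ℂ) := by
    change (((EuclideanSpace.proj ik : M3 →L[ℝ] ℝ) (conv _ _ x) : ℝ) : ℂ) = _
    rw [conv_apply, ← hcomm, ← integral_complex_ofReal, hprod]
    have h1 := conv_fourierInv hKi hc x
    simp only [hsupp] at h1
    rw [← h1]
    refine integral_congr_ae (Eventually.of_forall fun y => ?_)
    simp only [← hprod]
    simp [hK]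
  exact_mod_cast hgoal

/-! ### The Reynolds stress at a fixed time -/

/-- If `X` is close to `Ṡ_{j-3} a ⊗ Ṡ_{j-3} b` then it is close to `Ṡ_j (a ⊗ b)`, since `Ṡ_j`
reproduces the truncated product. -/
lemma eLpNorm_sub_trunc_tensor_le (j : ℤ) (a b : L2Field) {X : R3 → M3}
    (hX : AEStronglyMeasurable X volume)
    (h : eLpNorm (X - tensor (P.trunc (j - 3) a) (P.trunc (j - 3) b)) 2 volume ≤
      P.paraSum (j - 3) a b) :
    eLpNorm (X - P.trunc j (tensor a b)) 2 volume ≤ 2 * P.A * P.paraSum (j - 3) a b := by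
  set Y := tensor (P.trunc (j - 3) a) (P.trunc (j - 3) b) with hY
  have hYm : AEStronglyMeasurable Y volume := P.aesm_tensor_trunc _ _ a b
  have hab : AEStronglyMeasurable (tensor a b) volume :=
    aesm_tensor (Lp.aestronglyMeasurable a) (Lp.aestronglyMeasurable b)
  have e : X - P.trunc j (tensor a b) = (X - Y) - P.trunc j (tensor a b - Y) := by
    rw [P.trunc_tensor_sub (memLp_tensor (Lp.memLp a) (Lp.memLp b))
      (memLp_tensor (P.memLp_trunc _ a) (P.memLp_trunc _ b)), hY, P.trunc_tensor_trunc]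
    abel
  rw [e]
  have hm : AEStronglyMeasurable (P.trunc j (tensor a b - Y)) volume :=
    aestronglyMeasurable_conv (P.χj_isSymbol j).isKernel.aesm (hab.sub hYm)
  refine (eLpNorm_sub_le (hX.sub hYm) hm (by norm_num)).trans ?_
  rw [two_mul, add_mul]
  gcongr
  · exact h.trans (le_mul_of_one_le_left' P.one_le_A)
  · exact (P.eLpNorm_trunc_le j (hab.sub hYm) (by norm_num)).trans
      (mul_le_mul_right (P.eLpNorm_tensor_sub_le _ a b) _)

lemma eLpNorm_tensor_trunc_sub_trunc_tensor_le (j : ℤ) (a b : L2Field) :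
    eLpNorm (tensor (P.trunc j a) (P.trunc j b) - P.trunc j (tensor a b)) 2 volume ≤
      2 * P.A * P.paraSum (j - 3) a b := by
  refine P.eLpNorm_sub_trunc_tensor_le j a b (P.aesm_tensor_trunc _ _ a b) ?_
  have := P.eLpNorm_tensor_trunc_sub_le (j - 3) 3 a b
  simpa using this

lemma eLpNorm_tensor_sub_trunc_le_paraSum (j : ℤ) (a b : L2Field) :
    eLpNorm (tensor (a - P.trunc j a) (P.trunc j b)) 2 volume ≤ P.paraSum (j - 3) a b := by
  refine (P.eLpNorm_tensor_sub_trunc_le j a b).trans ?_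
  refine le_trans (ENNReal.tsum_le_tsum fun i => ?_)
    (ENNReal.tsum_comp_le_tsum_of_injective (add_left_injective 3)
      fun i : ℕ => P.paraNorm (j - 3 + i) a b + P.paraNorm (j - 3 + i) b a)
  have : j - 3 + ((i + 3 : ℕ) : ℤ) = j + i := by push_cast; ring
  simp only [this]
  exact le_self_add

lemma stress_congr_ae (j : ℤ) (U : R3 → R3) {e e' : R3 → R3} (h : e =ᵐ[volume] e') :
    stress P j U e =ᵐ[volume] stress P j U e' := by
  have h1 : tensor e U =ᵐ[volume] tensor e' U := by
    filter_upwards [h] with x hx; simp only [tensor, hx]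
  have h2 : tensor U e =ᵐ[volume] tensor U e' := by
    filter_upwards [h] with x hx; simp only [tensor, hx]
  have h3 : tensor e e =ᵐ[volume] tensor e' e' := by
    filter_upwards [h] with x hx; simp only [tensor, hx]
  unfold stress
  rw [P.trunc_congr_ae j h, P.trunc_congr_ae j h1, P.trunc_congr_ae j h2, P.trunc_congr_ae j h3]
  filter_upwards [h] with x hx
  simp only [Pi.add_apply, Pi.sub_apply, tensor, hx]

/-- The Reynolds stress is controlled by the paraproducts at frequencies at least `2^{j-3}`. -/
theorem eLpNorm_stress_le (j : ℤ) (U E : L2Field) :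
    eLpNorm (stress P j U E) 2 volume ≤ 12 * P.A *
      ∑' i : ℕ, (P.paraNorm (j - 3 + i) U U + P.paraNorm (j - 3 + i) U E +
        P.paraNorm (j - 3 + i) E U + P.paraNorm (j - 3 + i) E E) := by
  have mU := Lp.aestronglyMeasurable U
  have mE := Lp.aestronglyMeasurable E
  have mS : ∀ a b : L2Field, AEStronglyMeasurable (P.trunc j (tensor a b)) volume := fun a b =>
    aestronglyMeasurable_conv (P.χj_isSymbol j).isKernel.aesm
      (aesm_tensor (Lp.aestronglyMeasurable a) (Lp.aestronglyMeasurable b))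
  have mT := fun a b : L2Field => (P.aesm_tensor_trunc j j a b).sub (mS a b)
  have m2 : AEStronglyMeasurable (tensor (E - P.trunc j E) (P.trunc j U)) volume :=
    aesm_tensor (mE.sub (P.aesm_trunc j E)) (P.aesm_trunc j U)
  have m4 : AEStronglyMeasurable (tensor (P.trunc j U) (E - P.trunc j E)) volume :=
    aesm_tensor (P.aesm_trunc j U) (mE.sub (P.aesm_trunc j E))
  have m6 : AEStronglyMeasurable (tensor E E - P.trunc j (tensor E E)) volume :=
    (aesm_tensor mE mE).sub (mS E E)
  have b2 := P.eLpNorm_tensor_sub_trunc_le_paraSum j E U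
  have b4 := b2
  rw [eLpNorm_tensor_comm] at b4
  have b6 := P.eLpNorm_sub_trunc_tensor_le j E E (aesm_tensor mE mE)
    (P.eLpNorm_tensor_sub_le (j - 3) E E)
  unfold stress
  refine (eLpNorm_add_le (((((mT U U).add m2).add (mT E U)).add m4).add (mT U E)) m6
    (by norm_num)).trans ?_
  refine (add_le_add_left (eLpNorm_add_le ((((mT U U).add m2).add (mT E U)).add m4) (mT U E)
    (by norm_num)) _).trans ?_
  refine (add_le_add_left (add_le_add_left (eLpNorm_add_le (((mT U U).add m2).add (mT E U)) m4
    (by norm_num)) _) _).trans ?_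
  refine (add_le_add_left (add_le_add_left (add_le_add_left (eLpNorm_add_le ((mT U U).add m2)
    (mT E U) (by norm_num)) _) _) _).trans ?_
  refine (add_le_add_left (add_le_add_left (add_le_add_left (add_le_add_left (eLpNorm_add_le
    (mT U U) m2 (by norm_num)) _) _) _) _).trans ?_
  have b1 := P.eLpNorm_tensor_trunc_sub_trunc_tensor_le j U U
  have b3 := P.eLpNorm_tensor_trunc_sub_trunc_tensor_le j E U
  have b5 := P.eLpNorm_tensor_trunc_sub_trunc_tensor_le j U E
  rw [P.paraSum_comm _ E U] at b2 b3 b4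
  have hA : P.paraSum (j - 3) U E ≤ P.A * P.paraSum (j - 3) U E :=
    le_mul_of_one_le_left' P.one_le_A
  refine (add_le_add (add_le_add (add_le_add (add_le_add (add_le_add b1 (b2.trans hA)) b3)
    (b4.trans hA)) b5) b6).trans ?_
  have hUU : P.paraSum (j - 3) U U = 2 * ∑' i : ℕ, P.paraNorm (j - 3 + i) U U := by
    rw [paraSum, ENNReal.tsum_add, two_mul]
  have hEE : P.paraSum (j - 3) E E = 2 * ∑' i : ℕ, P.paraNorm (j - 3 + i) E E := by
    rw [paraSum, ENNReal.tsum_add, two_mul]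
  rw [hUU, hEE, paraSum]
  simp only [ENNReal.tsum_add]
  generalize (∑' i : ℕ, P.paraNorm (j - 3 + i) U U) = x
  generalize (∑' i : ℕ, P.paraNorm (j - 3 + i) U E) = y
  generalize (∑' i : ℕ, P.paraNorm (j - 3 + i) E U) = z
  generalize (∑' i : ℕ, P.paraNorm (j - 3 + i) E E) = w
  calc _ = P.A * (4 * x) + P.A * (6 * y) + P.A * (6 * z) + P.A * (4 * w) := by ring
    _ ≤ P.A * (12 * x) + P.A * (12 * y) + P.A * (12 * z) + P.A * (12 * w) := by
        gcongr <;> norm_num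
    _ = _ := by ring

end DyadicPartition

/-! ### Estimates in time -/

/-- The sum `8^s ∑ 2^{-is} (1 + i)`. The factor `8^s` accounts for the series of paraproducts
starting at the frequency `2^{j-3}`. -/
def geomSum (s : ℝ) : ℝ≥0∞ := 2 ^ (3 * s) * ∑' i : ℕ, 2 ^ (-((i : ℝ) * s)) * (1 + (i : ℝ≥0∞))

lemma tsum_two_rpow_mul_ne_top {s : ℝ} (hs : 0 < s) :
    ∑' i : ℕ, (2 : ℝ≥0∞) ^ (-((i : ℝ) * s)) * (1 + (i : ℝ≥0∞)) ≠ ⊤ := by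
  have hr : ‖(2 : ℝ) ^ (-s)‖ < 1 := by
    rw [Real.norm_of_nonneg (by positivity)]
    exact Real.rpow_lt_one_of_one_lt_of_neg one_lt_two (by linarith)
  have h1 := summable_geometric_of_norm_lt_one hr
  have h2 := summable_pow_mul_geometric_of_norm_lt_one 1 hr
  have h3 : Summable fun i : ℕ => ((2 : ℝ) ^ (-s)) ^ i * (1 + i) := by
    refine (h1.add h2).congr fun i => ?_
    ring
  have h4 : ∀ i : ℕ, (2 : ℝ≥0∞) ^ (-(i * s)) * (1 + i) =
      ENNReal.ofReal (((2 : ℝ) ^ (-s)) ^ i * (1 + i)) := by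
    intro i
    rw [ENNReal.ofReal_mul (by positivity), ENNReal.ofReal_add zero_le_one (by positivity),
      ENNReal.ofReal_one, ENNReal.ofReal_natCast, two_rpow_ofReal, ← Real.rpow_natCast,
      ← Real.rpow_mul two_pos.le]
    congr 4
    ring
  simp only [h4]
  exact h3.tsum_ofReal_ne_top

lemma geomSum_ne_top {s : ℝ} (hs : 0 < s) : geomSum s ≠ ⊤ :=
  ENNReal.mul_ne_top (two_rpow_ne_top _) (tsum_two_rpow_mul_ne_top hs)

lemma tsum_two_rpow_shift (j : ℕ) (s : ℝ) :
    ∑' i : ℕ, (2 : ℝ≥0∞) ^ (-(((j - 3 + i : ℤ) : ℝ) * s)) * (1 + i) =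
      2 ^ (-(j * s)) * geomSum s := by
  rw [geomSum, ← mul_assoc, ← two_rpow_add, ← ENNReal.tsum_mul_left]
  refine tsum_congr fun i => ?_
  rw [← mul_assoc, ← two_rpow_add]
  congr 2
  push_cast
  ring

lemma tsum_two_rpow_shift_le (j : ℕ) (s : ℝ) :
    ∑' i : ℕ, (2 : ℝ≥0∞) ^ (-(((j - 3 + i : ℤ) : ℝ) * s)) ≤ 2 ^ (-(j * s)) * geomSum s := by
  rw [← tsum_two_rpow_shift]
  refine ENNReal.tsum_le_tsum fun i => ?_
  exact le_mul_of_one_le_right' le_self_add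

namespace DyadicPartition

variable (P : DyadicPartition)

lemma le_besovNorm (s : ℝ) (p : ℝ≥0∞) {q : ℝ≥0∞} (hq : q ≠ 0) (f : R3 → R3) (k : ℤ) :
    (2 : ℝ≥0∞) ^ ((k : ℝ) * s) * eLpNorm (P.block k f) p volume ≤ P.besovNorm s p q f :=
  le_eLpNorm_count (fun j : ℤ => (2 : ℝ≥0∞) ^ ((j : ℝ) * s) * eLpNorm (P.block j f) p volume) hq k

lemma le_cheminLernerNorm (r : ℝ≥0∞) (T s : ℝ) (p : ℝ≥0∞) (u : ℝ → R3 → R3) (k : ℤ) :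
    (2 : ℝ≥0∞) ^ ((k : ℝ) * s) * timeNorm r T (fun t => eLpNorm (P.block k (u t)) p volume) ≤
      P.cheminLernerNorm r T s p ∞ u :=
  le_eLpNorm_count (fun j : ℤ => (2 : ℝ≥0∞) ^ ((j : ℝ) * s) *
    timeNorm r T (fun t => eLpNorm (P.block j (u t)) p volume)) ENNReal.top_ne_zero k

lemma eLpNorm_block_le_sub (k : ℤ) (u v : L2Field) {p : ℝ≥0∞} (hp : 1 ≤ p) :
    eLpNorm (P.block k u) p volume ≤
      eLpNorm (P.block k v) p volume + eLpNorm (P.block k ⇑(u - v)) p volume := by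
  have : P.block k u = P.block k v + P.block k ⇑(u - v) := by
    ext1 x
    rw [Pi.add_apply, P.block_sub, add_sub_cancel]
  nth_rewrite 1 [this]
  exact eLpNorm_add_le (P.aesm_block k v) (P.aesm_block k _) hp

lemma continuous_eLpNorm_top_block (k : ℤ) :
    Continuous fun u : L2Field => eLpNorm (P.block k u) ∞ volume := by
  refine continuous_of_subadditive (C := P.A * 2 ^ ((k : ℝ) * (3 / 2)))
    (ENNReal.mul_ne_top P.A_ne_top (two_rpow_ne_top _))
    (fun u v => P.eLpNorm_block_le_sub k u v le_top) fun u => ?_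
  rw [Lp.enorm_def]
  exact P.eLpNorm_top_block_le_two k u

lemma continuous_eLpNorm_block (k : ℤ) {p : ℝ} (hp : 2 ≤ p) :
    Continuous fun u : L2Field => eLpNorm (P.block k u) (ENNReal.ofReal p) volume := by
  have hp0 : 0 < p := by linarith
  have h1 : 0 ≤ 1 - 2 / p := by rw [sub_nonneg, div_le_one hp0]; exact hp
  refine continuous_of_subadditive (C := P.A * 2 ^ ((k : ℝ) * (3 / 2)) + P.A)
    (ENNReal.add_ne_top.2 ⟨ENNReal.mul_ne_top P.A_ne_top (two_rpow_ne_top _), P.A_ne_top⟩)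
    (fun u v => P.eLpNorm_block_le_sub k u v
      (ENNReal.one_le_ofReal.2 (by linarith))) fun u => ?_
  rw [Lp.enorm_def]
  refine (eLpNorm_le_interpolation (P.aesm_block k u) hp).trans ?_
  have e1 := P.eLpNorm_top_block_le_two k u
  have e2 := P.eLpNorm_block_le k u (p := 2) (by norm_num)
  set C := P.A * 2 ^ ((k : ℝ) * (3 / 2)) + P.A
  calc eLpNorm (P.block k u) ∞ volume ^ (1 - 2 / p) * eLpNorm (P.block k u) 2 volume ^ (2 / p)
      ≤ (C * eLpNorm u 2 volume) ^ (1 - 2 / p) * (C * eLpNorm u 2 volume) ^ (2 / p) := by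
        gcongr
        · exact e1.trans (mul_le_mul_left le_self_add _)
        · exact e2.trans (mul_le_mul_left le_add_self _)
    _ = C * eLpNorm u 2 volume := by
        rw [← ENNReal.rpow_add_of_nonneg _ _ h1 (by positivity)]
        simp

/-- Paraproducts whose high frequency factor is bounded in `Ḣ^α`. -/
lemma paraNorm_le_homSobolev (k : ℤ) (a b : L2Field) {α : ℝ} (hα : 0 ≤ α) {B : ℝ≥0∞}
    (hB : ∀ k : ℤ, eLpNorm (P.block k b) ∞ volume ≤ 2 ^ (k : ℝ) * B) {n : ℕ} (hn : k + 1 ≤ n) :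
    P.paraNorm k a b ≤ ENNReal.ofReal ((4 / 3) ^ α) * 2 ^ (-((k : ℝ) * α)) * homSobolevNorm α a *
      (B + ∑ i ∈ Finset.range n, eLpNorm (P.block i b) ∞ volume) := by
  refine iSup₂_le fun l hl => ?_
  refine (eLpNorm_tensor_le (P.aesm_block k a) (P.aesm_trunc l b) 2 ∞ 2).trans ?_
  gcongr
  · exact P.eLpNorm_block_le_homSobolev k a hα
  · exact P.eLpNorm_top_trunc_le_sum b hB (hl.trans hn)

/-- Paraproducts whose high frequency factor is in `L^p`, the low frequency factor being
interpolated between `L²` and `Ḃ^{-1}_{∞,∞}`. -/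
lemma paraNorm_le_interpolation (k : ℤ) (a b : L2Field) {p : ℝ} (hp : 2 < p) {B : ℝ≥0∞}
    (hB : ∀ k : ℤ, eLpNorm (P.block k b) ∞ volume ≤ 2 ^ (k : ℝ) * B) :
    P.paraNorm k a b ≤ (2 * P.A * 2 ^ ((k : ℝ) * (2 / p)) * B ^ (2 / p) *
      eLpNorm b 2 volume ^ (1 - 2 / p)) * eLpNorm (P.block k a) (ENNReal.ofReal p) volume := by
  refine iSup₂_le fun l hl => ?_
  have hp0 : 0 < p := by linarith
  have hp2 : 0 < p - 2 := by linarith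
  have h1 : 0 ≤ 1 - 2 / p := by rw [sub_nonneg, div_le_one hp0]; linarith
  -- The exponent `q = 2p / (p - 2)` is the one with `1/p + 1/q = 1/2`.
  have hq : 2 ≤ 2 * p / (p - 2) := by rw [le_div_iff₀ hp2]; linarith
  have : ENNReal.HolderTriple (ENNReal.ofReal p) (ENNReal.ofReal (2 * p / (p - 2))) 2 := by
    constructor
    rw [← ENNReal.ofReal_inv_of_pos hp0, ← ENNReal.ofReal_inv_of_pos (by positivity),
      ← ENNReal.ofReal_add (by positivity) (by positivity), ← ENNReal.ofReal_ofNat,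
      ← ENNReal.ofReal_inv_of_pos two_pos]
    congr 1
    field_simp
    ring
  refine (eLpNorm_tensor_le (P.aesm_block k a) (P.aesm_trunc l b) (ENNReal.ofReal p)
    (ENNReal.ofReal (2 * p / (p - 2))) 2).trans ?_
  rw [mul_comm]
  refine mul_le_mul_left ?_ _
  refine (eLpNorm_le_interpolation (P.aesm_trunc l b) hq).trans ?_
  have e1 : 1 - 2 / (2 * p / (p - 2)) = 2 / p := by field_simp; ring
  have e2 : 2 / (2 * p / (p - 2)) = 1 - 2 / p := by field_simp
  rw [e1, e2]
  have b1 : eLpNorm (P.trunc l b) ∞ volume ≤ 2 ^ ((k : ℝ) + 1) * B := by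
    refine (P.eLpNorm_top_trunc_le_of_block b hB l).trans ?_
    gcongr
    · exact one_le_two
    · exact_mod_cast hl
  have b2 := P.eLpNorm_trunc_le l (Lp.aestronglyMeasurable b) (p := 2) (by norm_num)
  calc eLpNorm (P.trunc l b) ∞ volume ^ (2 / p) * eLpNorm (P.trunc l b) 2 volume ^ (1 - 2 / p)
      ≤ (2 ^ ((k : ℝ) + 1) * B) ^ (2 / p) * (P.A * eLpNorm b 2 volume) ^ (1 - 2 / p) := by
        gcongr
    _ = 2 ^ (2 / p) * P.A ^ (1 - 2 / p) * 2 ^ ((k : ℝ) * (2 / p)) * B ^ (2 / p) *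
          eLpNorm b 2 volume ^ (1 - 2 / p) := by
        rw [ENNReal.mul_rpow_of_nonneg _ _ (by positivity), ENNReal.mul_rpow_of_nonneg _ _ h1,
          ← ENNReal.rpow_mul, add_mul, one_mul, two_rpow_add]
        ring
    _ ≤ 2 ^ (1 : ℝ) * P.A ^ (1 : ℝ) * 2 ^ ((k : ℝ) * (2 / p)) * B ^ (2 / p) *
          eLpNorm b 2 volume ^ (1 - 2 / p) := by
        gcongr
        · exact one_le_two
        · rw [div_le_one hp0]; linarith
        · exact P.one_le_A
        · have : 0 ≤ 2 / p := by positivity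
          linarith
    _ = _ := by simp

/-- Paraproducts whose low frequency factor is bounded in `L²`. -/
lemma paraNorm_le_two (k : ℤ) (a b : L2Field) :
    P.paraNorm k a b ≤ P.A * eLpNorm b 2 volume * eLpNorm (P.block k a) ∞ volume := by
  refine iSup₂_le fun l hl => ?_
  refine (eLpNorm_tensor_le (P.aesm_block k a) (P.aesm_trunc l b) ∞ 2 2).trans ?_
  rw [mul_comm]
  gcongr
  exact P.eLpNorm_trunc_le l (Lp.aestronglyMeasurable b) (by norm_num)

end DyadicPartition

lemma min_rpow_half_le {x y : ℝ≥0∞} {θ : ℝ} (h0 : 0 ≤ θ) (h1 : θ ≤ 1 / 2) :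
    min x y ^ (1 / 2 : ℝ) ≤ x ^ θ * y ^ (1 / 2 - θ) := by
  have : (1 / 2 : ℝ) = θ + (1 / 2 - θ) := by ring
  nth_rewrite 1 [this]
  rw [ENNReal.rpow_add_of_nonneg _ _ h0 (by linarith)]
  have h2 : 0 ≤ 1 / 2 - θ := by linarith
  gcongr
  · exact min_le_left _ _
  · exact min_le_right _ _

namespace DyadicPartition

variable (P : DyadicPartition)

/-- The heat flow of a datum in `Ḃ^{-1+3/p+δ}_{p,p}` on a dyadic block. -/
lemma timeNorm_block_heat_le_besov (k : ℤ) (u : L2Field) (T : ℝ) {p δ : ℝ} (hp : 2 ≤ p)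
    (hδ : 0 < δ) (hδ1 : δ < 1) :
    timeNorm 2 T (fun t => eLpNorm (P.block k (heat u t)) (ENNReal.ofReal p) volume) ≤
      2 * P.H * ENNReal.ofReal T ^ (δ / 4) * 2 ^ (-((k : ℝ) * (3 / p + δ / 2))) *
        P.besovNorm (-1 + 3 / p + δ) (ENNReal.ofReal p) (ENNReal.ofReal p) u := by
  have hp0 : 0 < p := by linarith
  refine (P.timeNorm_block_heat_le k u T (ENNReal.one_le_ofReal.2 (by linarith))).trans ?_
  have h1 := le_two_rpow_neg_mul (P.le_besovNorm (-1 + 3 / p + δ) (ENNReal.ofReal p)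
    (q := ENNReal.ofReal p) (by simpa using hp0) u k)
  set B := P.besovNorm (-1 + 3 / p + δ) (ENNReal.ofReal p) (ENNReal.ofReal p) u
  -- The power `δ/4` of `T` leaves `4^{-k(1/2 - δ/4)} = 2^{-k(1 - δ/2)}` from the smoothing.
  have h2 : min (ENNReal.ofReal T) (2 * 2 ^ (-(2 * k : ℝ))) ^ (1 / 2 : ℝ) ≤
      ENNReal.ofReal T ^ (δ / 4) * (2 * 2 ^ (-((k : ℝ) * (1 - δ / 2)))) := by
    refine (min_rpow_half_le (θ := δ / 4) (by positivity) (by linarith)).trans ?_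
    gcongr
    nth_rewrite 1 [← ENNReal.rpow_one 2]
    nth_rewrite 3 [← ENNReal.rpow_one 2]
    rw [← two_rpow_add, ← two_rpow_add, ← ENNReal.rpow_mul]
    exact two_rpow_mono (by nlinarith)
  calc P.H * min (ENNReal.ofReal T) (2 * 2 ^ (-(2 * k : ℝ))) ^ (1 / 2 : ℝ) *
        eLpNorm (P.block k u) (ENNReal.ofReal p) volume
      ≤ P.H * (ENNReal.ofReal T ^ (δ / 4) * (2 * 2 ^ (-((k : ℝ) * (1 - δ / 2))))) *
        (2 ^ (-((k : ℝ) * (-1 + 3 / p + δ))) * B) := by gcongr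
    _ = 2 * P.H * ENNReal.ofReal T ^ (δ / 4) *
        (2 ^ (-((k : ℝ) * (1 - δ / 2))) * 2 ^ (-((k : ℝ) * (-1 + 3 / p + δ)))) * B := by ring
    _ = _ := by
        rw [← two_rpow_add]
        congr 3
        ring

/-- The heat flow of a datum in `Ḃ^{-1+3/p+δ}_{p,p}` on a dyadic block, in `L²(0,T; L^∞)`. -/
lemma timeNorm_top_block_heat_le_besov (k : ℤ) (u : L2Field) (T : ℝ) {p δ : ℝ} (hp : 2 ≤ p)
    (hδ : 0 < δ) (hδ1 : δ < 1) :
    timeNorm 2 T (fun t => eLpNorm (P.block k (heat u t)) ∞ volume) ≤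
      16 * P.A * P.H * ENNReal.ofReal T ^ (δ / 4) * 2 ^ (-((k : ℝ) * (δ / 2))) *
        P.besovNorm (-1 + 3 / p + δ) (ENNReal.ofReal p) (ENNReal.ofReal p) u := by
  have h1 := P.timeNorm_block_heat_le_besov k u T hp hδ hδ1
  set B := P.besovNorm (-1 + 3 / p + δ) (ENNReal.ofReal p) (ENNReal.ofReal p) u
  refine (timeNorm_mono (Eventually.of_forall fun t => P.bernstein k (heat u t) hp)).trans ?_
  rw [timeNorm_const_mul (((P.continuous_eLpNorm_block k hp).comp_aestronglyMeasurable
    (aestronglyMeasurable_heat u T)).aemeasurable)]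
  refine (mul_le_mul_right h1 _).trans (le_of_eq ?_)
  calc _ = 16 * P.A * P.H * ENNReal.ofReal T ^ (δ / 4) *
        (2 ^ ((k : ℝ) * (3 / p)) * 2 ^ (-((k : ℝ) * (3 / p + δ / 2)))) * B := by ring
    _ = _ := by
        rw [← two_rpow_add]
        congr 3
        ring

end DyadicPartition

/-! ### Series of paraproducts -/

/-- The functions `f i` of time have measurable majorants whose norms in `L²(0,T)` sum up to at
most `C`. The functions `f i` themselves need not be measurable. -/
def DominatedSeries (T : ℝ) (f : ℕ → ℝ → ℝ≥0∞) (C : ℝ≥0∞) : Prop :=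
  ∃ g : ℕ → ℝ → ℝ≥0∞, (∀ i, AEMeasurable (g i) (volume.restrict (Ioo 0 T))) ∧
    (∀ᵐ t ∂(volume.restrict (Ioo 0 T)), ∀ i, f i t ≤ g i t) ∧ ∑' i, timeNorm 2 T (g i) ≤ C

namespace DominatedSeries

variable {T : ℝ} {f f' : ℕ → ℝ → ℝ≥0∞} {C C' : ℝ≥0∞}

lemma add (h : DominatedSeries T f C) (h' : DominatedSeries T f' C') :
    DominatedSeries T (fun i t => f i t + f' i t) (C + C') := by
  obtain ⟨g, hg, hfg, hC⟩ := h
  obtain ⟨g', hg', hfg', hC'⟩ := h'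
  refine ⟨fun i t => g i t + g' i t, fun i => (hg i).add (hg' i), ?_, ?_⟩
  · filter_upwards [hfg, hfg'] with t h1 h2 i
    exact add_le_add (h1 i) (h2 i)
  · refine le_trans ?_ (add_le_add hC hC')
    rw [← ENNReal.tsum_add]
    exact ENNReal.tsum_le_tsum fun i => eLpNorm_add_le (hg i).aestronglyMeasurable
      (hg' i).aestronglyMeasurable (by norm_num)

lemma timeNorm_le (h : DominatedSeries T f C) (c : ℝ≥0∞) :
    timeNorm 2 T (fun t => c * ∑' i, f i t) ≤ c * C := by
  obtain ⟨g, hg, hfg, hC⟩ := h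
  calc timeNorm 2 T (fun t => c * ∑' i, f i t)
      ≤ timeNorm 2 T (fun t => c * ∑' i, g i t) := by
        refine timeNorm_mono ?_
        filter_upwards [hfg] with t ht
        exact mul_le_mul_right (ENNReal.tsum_le_tsum ht) _
    _ = c * timeNorm 2 T (fun t => ∑' i, g i t) :=
        timeNorm_const_mul (AEMeasurable.tsum hg)
    _ ≤ c * C := mul_le_mul_right ((timeNorm_tsum_le hg).trans hC) _

end DominatedSeries

namespace DyadicPartition

variable (P : DyadicPartition)

/-- One null set of times serves all blocks. -/
lemma ae_block_le_besov (T : ℝ) (b : ℝ → L2Field) :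
    ∀ᵐ t ∂(volume.restrict (Ioo 0 T)), ∀ k : ℤ, eLpNorm (P.block k (b t)) ∞ volume ≤
      2 ^ (k : ℝ) * timeNorm ∞ T (fun t => P.besovNorm (-1) ∞ ∞ (b t)) := by
  filter_upwards [ae_le_timeNorm_top T (fun t => P.besovNorm (-1) ∞ ∞ (b t))] with t ht k
  have := le_two_rpow_neg_mul (P.le_besovNorm (-1) ∞ ENNReal.top_ne_zero (b t) k)
  rw [mul_neg_one, neg_neg] at this
  exact this.trans (mul_le_mul_right ht _)

lemma ae_block_le_cheminLerner (T : ℝ) (b : ℝ → L2Field) :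
    ∀ᵐ t ∂(volume.restrict (Ioo 0 T)), ∀ k : ℤ, eLpNorm (P.block k (b t)) ∞ volume ≤
      2 ^ (k : ℝ) * P.cheminLernerNorm ∞ T (-1) ∞ ∞ (fun t => b t) := by
  rw [ae_all_iff]
  intro k
  filter_upwards [ae_le_timeNorm_top T (fun t => eLpNorm (P.block k (b t)) ∞ volume)] with t ht
  have := le_two_rpow_neg_mul (P.le_cheminLernerNorm ∞ T (-1) ∞ (fun t => b t) k)
  rw [mul_neg_one, neg_neg] at this
  exact ht.trans this

lemma aemeasurable_top_block {T : ℝ} {b : ℝ → L2Field}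
    (hb : AEStronglyMeasurable b (volume.restrict (Ioo 0 T))) (k : ℤ) :
    AEMeasurable (fun t => eLpNorm (P.block k (b t)) ∞ volume) (volume.restrict (Ioo 0 T)) :=
  ((P.continuous_eLpNorm_top_block k).comp_aestronglyMeasurable hb).aemeasurable

lemma aemeasurable_block {T : ℝ} {b : ℝ → L2Field}
    (hb : AEStronglyMeasurable b (volume.restrict (Ioo 0 T))) (k : ℤ) {p : ℝ} (hp : 2 ≤ p) :
    AEMeasurable (fun t => eLpNorm (P.block k (b t)) (ENNReal.ofReal p) volume)
      (volume.restrict (Ioo 0 T)) :=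
  ((P.continuous_eLpNorm_block k hp).comp_aestronglyMeasurable hb).aemeasurable

/-- The paraproducts `Δ̇_k U ⊗ Ṡ_l b`, by means of the regularity of `U` in `Ḣ^α`. Each of the
low frequency blocks of `b` contributes once, whence the factor `j`. -/
lemma dominatedSeries_homSobolev {T : ℝ} (U b : ℝ → L2Field)
    (hb : AEStronglyMeasurable b (volume.restrict (Ioo 0 T))) {α : ℝ} (hα : 0 < α) {j : ℕ}
    (hj : 1 ≤ j) :
    DominatedSeries T (fun i t => P.paraNorm (j - 3 + i) (U t) (b t))
      (ENNReal.ofReal ((4 / 3) ^ α) * geomSum α * 2 ^ (-(j * α)) *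
        timeNorm ∞ T (fun t => homSobolevNorm α (U t)) *
        (j * P.cheminLernerNorm 2 T 0 ∞ ∞ (fun t => b t) + ENNReal.ofReal T ^ (1 / 2 : ℝ) *
          timeNorm ∞ T (fun t => P.besovNorm (-1) ∞ ∞ (b t)))) := by
  set S := timeNorm ∞ T (fun t => homSobolevNorm α (U t))
  set B := timeNorm ∞ T (fun t => P.besovNorm (-1) ∞ ∞ (b t))
  set X := P.cheminLernerNorm 2 T 0 ∞ ∞ (fun t => b t) with hX
  set c := ENNReal.ofReal ((4 / 3) ^ α)
  have hm : ∀ n : ℕ, AEMeasurable (fun t => ∑ m ∈ Finset.range n,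
      eLpNorm (P.block m (b t)) ∞ volume) (volume.restrict (Ioo 0 T)) := fun n =>
    Finset.aemeasurable_fun_sum _ fun m _ => P.aemeasurable_top_block hb m
  have hblock : ∀ k : ℤ, timeNorm 2 T (fun t => eLpNorm (P.block k (b t)) ∞ volume) ≤ X := by
    intro k
    have := P.le_cheminLernerNorm 2 T 0 ∞ (fun t => b t) k
    simpa using this
  have hsum : ∀ n : ℕ, timeNorm 2 T (fun t => ∑ m ∈ Finset.range n,
      eLpNorm (P.block m (b t)) ∞ volume) ≤ n * X := by
    intro n
    induction n with
    | zero => simp [timeNorm]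
    | succ n ih =>
      simp only [Finset.sum_range_succ]
      push_cast
      rw [add_mul, one_mul]
      exact (eLpNorm_add_le (hm n).aestronglyMeasurable
        (P.aemeasurable_top_block hb n).aestronglyMeasurable (by norm_num)).trans
        (add_le_add ih (hblock n))
  refine ⟨fun i t => (c * 2 ^ (-(((j - 3 + i : ℤ) : ℝ) * α)) * S) *
    (B + ∑ m ∈ Finset.range (j + i), eLpNorm (P.block m (b t)) ∞ volume), fun i =>
      ((hm (j + i)).const_add B).const_mul _, ?_, ?_⟩
  · filter_upwards [ae_le_timeNorm_top T (fun t => homSobolevNorm α (U t)),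
      P.ae_block_le_besov T b] with t h1 h2 i
    refine (P.paraNorm_le_homSobolev (j - 3 + i) (U t) (b t) hα.le h2 (n := j + i) ?_).trans ?_
    -- With `k = j - 3 + i`, the truncations satisfy `l ≤ k + 1 ≤ j + i`.
    · push_cast; linarith
    · gcongr
  · calc _ ≤ ∑' i : ℕ, (c * S * (j * X + ENNReal.ofReal T ^ (1 / 2 : ℝ) * B)) *
          (2 ^ (-(((j - 3 + i : ℤ) : ℝ) * α)) * (1 + i)) := by
          refine ENNReal.tsum_le_tsum fun i => ?_
          rw [timeNorm_const_mul ((hm (j + i)).const_add B)]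
          have h1 : timeNorm 2 T (fun t => B + ∑ m ∈ Finset.range (j + i),
              eLpNorm (P.block m (b t)) ∞ volume) ≤
              (j * X + ENNReal.ofReal T ^ (1 / 2 : ℝ) * B) * (1 + i) := by
            refine (eLpNorm_add_le (f := fun _ => B) aestronglyMeasurable_const
              (hm (j + i)).aestronglyMeasurable (by norm_num)).trans ?_
            refine (add_le_add (le_of_eq (timeNorm_const B)) (hsum (j + i))).trans ?_
            -- This is where `j ≥ 1` is needed.
            have h2 : ((j + i : ℕ) : ℝ≥0∞) ≤ j * (1 + i) := by
              have : j + i ≤ j * (1 + i) := by nlinarith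
              exact_mod_cast this
            calc _ ≤ ENNReal.ofReal T ^ (1 / 2 : ℝ) * B * (1 + i) + j * (1 + i) * X := by
                  refine add_le_add ?_ (mul_le_mul_left h2 X)
                  exact le_mul_of_one_le_right' (le_self_add : (1 : ℝ≥0∞) ≤ 1 + i)
              _ = _ := by ring
          calc _ ≤ c * 2 ^ (-(((j - 3 + i : ℤ) : ℝ) * α)) * S *
                ((j * X + ENNReal.ofReal T ^ (1 / 2 : ℝ) * B) * (1 + i)) := by gcongr
            _ = _ := by ring
      _ = _ := by
          rw [ENNReal.tsum_mul_left, tsum_two_rpow_shift]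
          ring

/-- The paraproducts `Δ̇_k e ⊗ Ṡ_l U`, where `e` is measured in `L^p`. -/
lemma dominatedSeries_interpolation {T : ℝ} (e U : ℝ → L2Field)
    (he : AEStronglyMeasurable e (volume.restrict (Ioo 0 T))) {p : ℝ} (hp : 2 < p) (j : ℕ) :
    DominatedSeries T (fun i t => P.paraNorm (j - 3 + i) (e t) (U t))
      (2 * P.A * geomSum (1 / p) * 2 ^ (-(j / p)) *
        P.cheminLernerNorm 2 T (3 / p) (ENNReal.ofReal p) ∞ (fun t => e t) *
        P.cheminLernerNorm ∞ T (-1) ∞ ∞ (fun t => U t) ^ (2 / p) *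
        timeNorm ∞ T (fun t => eLpNorm (U t) 2 volume) ^ (1 - 2 / p)) := by
  have hp0 : 0 < p := by linarith
  have h1 : 0 ≤ 1 - 2 / p := by rw [sub_nonneg, div_le_one hp0]; linarith
  set M := P.cheminLernerNorm ∞ T (-1) ∞ ∞ (fun t => U t)
  set N := timeNorm ∞ T (fun t => eLpNorm (U t) 2 volume)
  set Y := P.cheminLernerNorm 2 T (3 / p) (ENNReal.ofReal p) ∞ (fun t => e t)
  refine ⟨fun i t => (2 * P.A * 2 ^ (((j - 3 + i : ℤ) : ℝ) * (2 / p)) * M ^ (2 / p) *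
      N ^ (1 - 2 / p)) * eLpNorm (P.block (j - 3 + i) (e t)) (ENNReal.ofReal p) volume, fun i =>
        (P.aemeasurable_block he _ hp.le).const_mul _, ?_, ?_⟩
  · filter_upwards [ae_le_timeNorm_top T (fun t => eLpNorm (U t) 2 volume),
      P.ae_block_le_cheminLerner T U] with t h2 h3 i
    refine (P.paraNorm_le_interpolation (j - 3 + i) (e t) (U t) hp h3).trans ?_
    gcongr
  · calc _ ≤ ∑' i : ℕ, (2 * P.A * Y * M ^ (2 / p) * N ^ (1 - 2 / p)) *
          2 ^ (-(((j - 3 + i : ℤ) : ℝ) * (1 / p))) := by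
          refine ENNReal.tsum_le_tsum fun i => ?_
          rw [timeNorm_const_mul (P.aemeasurable_block he _ hp.le)]
          have h2 := le_two_rpow_neg_mul (P.le_cheminLernerNorm 2 T (3 / p) (ENNReal.ofReal p)
            (fun t => e t) (j - 3 + i))
          refine (mul_le_mul_right h2 _).trans (le_of_eq ?_)
          calc _ = (2 * P.A * Y * M ^ (2 / p) * N ^ (1 - 2 / p)) *
                (2 ^ (((j - 3 + i : ℤ) : ℝ) * (2 / p)) *
                  2 ^ (-(((j - 3 + i : ℤ) : ℝ) * (3 / p)))) := by ring
            _ = _ := by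
              rw [← two_rpow_add]
              congr 2
              ring
      _ ≤ (2 * P.A * Y * M ^ (2 / p) * N ^ (1 - 2 / p)) *
          (2 ^ (-(j * (1 / p))) * geomSum (1 / p)) := by
          rw [ENNReal.tsum_mul_left]
          exact mul_le_mul_right (tsum_two_rpow_shift_le j _) _
      _ = _ := by
          rw [mul_one_div]
          ring

/-- The paraproducts of the heat flow with itself. -/
lemma dominatedSeries_heat (T : ℝ) (u : L2Field) {p δ : ℝ} (hp : 2 ≤ p) (hδ : 0 < δ) (hδ1 : δ < 1)
    (j : ℕ) :
    DominatedSeries T (fun i t => P.paraNorm (j - 3 + i) (heat u t) (heat u t))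
      (16 * P.A ^ 2 * P.H * geomSum (δ / 2) * ENNReal.ofReal T ^ (δ / 4) * 2 ^ (-(j * (δ / 2))) *
        eLpNorm u 2 volume *
        P.besovNorm (-1 + 3 / p + δ) (ENNReal.ofReal p) (ENNReal.ofReal p) u) := by
  have hm := fun k => P.aemeasurable_top_block (aestronglyMeasurable_heat u T) k
  set B := P.besovNorm (-1 + 3 / p + δ) (ENNReal.ofReal p) (ENNReal.ofReal p) u
  refine ⟨fun i t => (P.A * eLpNorm u 2 volume) *
    eLpNorm (P.block (j - 3 + i) (heat u t)) ∞ volume, fun i => (hm _).const_mul _, ?_, ?_⟩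
  · filter_upwards [ae_restrict_mem measurableSet_Ioo] with t ht i
    refine (P.paraNorm_le_two (j - 3 + i) (heat u t) (heat u t)).trans ?_
    gcongr
    rw [eLpNorm_congr_ae (coeFn_heat u ht.1)]
    exact eLpNorm_heatFlow_le (Lp.aestronglyMeasurable u) ht.1 (by norm_num)
  · calc _ ≤ ∑' i : ℕ, (16 * P.A ^ 2 * P.H * ENNReal.ofReal T ^ (δ / 4) * eLpNorm u 2 volume * B) *
          2 ^ (-(((j - 3 + i : ℤ) : ℝ) * (δ / 2))) := by
          refine ENNReal.tsum_le_tsum fun i => ?_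
          rw [timeNorm_const_mul (hm _)]
          refine (mul_le_mul_right (P.timeNorm_top_block_heat_le_besov (j - 3 + i) u T hp hδ hδ1)
            _).trans (le_of_eq ?_)
          ring
      _ ≤ (16 * P.A ^ 2 * P.H * ENNReal.ofReal T ^ (δ / 4) * eLpNorm u 2 volume * B) *
          (2 ^ (-(j * (δ / 2))) * geomSum (δ / 2)) := by
          rw [ENNReal.tsum_mul_left]
          exact mul_le_mul_right (tsum_two_rpow_shift_le j _) _
      _ = _ := by ring

end DyadicPartition

/-! ### Finiteness of the norms -/

lemma homSobolevNorm_le {α : ℝ} (hα : 0 ≤ α) (u : L2Field) :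
    homSobolevNorm α u ≤ sobolevNorm α u := by
  refine eLpNorm_mono fun v => ?_
  rw [norm_smul, norm_smul]
  gcongr
  have h0 : 0 ≤ 2 * Real.pi * ‖v‖ := by positivity
  rw [Real.norm_of_nonneg (by positivity), Real.norm_of_nonneg (by positivity),
    show α = 2 * (α / 2) by ring, Real.rpow_mul h0, Real.rpow_two]
  rw [show 2 * (α / 2) / 2 = α / 2 by ring]
  gcongr
  linarith

lemma eLpNorm_le_sobolevNorm {α : ℝ} (hα : 0 ≤ α) (u : L2Field) :
    eLpNorm u 2 volume ≤ sobolevNorm α u := by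
  rw [← eLpNorm_fourierL2]
  refine eLpNorm_mono fun v => ?_
  rw [norm_smul, Real.norm_of_nonneg (by positivity)]
  refine le_mul_of_one_le_left (norm_nonneg _) (Real.one_le_rpow ?_ (by positivity))
  have : 0 ≤ (2 * Real.pi * ‖v‖) ^ 2 := by positivity
  linarith

/-- Interpolation of `L²(0,T)` between `L¹(0,T)` and `L^∞(0,T)`. -/
lemma timeNorm_two_le (T : ℝ) {f : ℝ → ℝ≥0∞} (hf : AEMeasurable f (volume.restrict (Ioo 0 T))) :
    timeNorm 2 T f ≤ timeNorm ∞ T f ^ (1 / 2 : ℝ) * timeNorm 1 T f ^ (1 / 2 : ℝ) := by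
  rw [timeNorm_two_eq, ← ENNReal.mul_rpow_of_nonneg _ _ (by norm_num)]
  gcongr
  have h1 : timeNorm 1 T f = ∫⁻ t in Ioo 0 T, f t := by
    rw [timeNorm, eLpNorm_one_eq_lintegral_enorm]
    simp only [enorm_eq_self]
  rw [h1, ← lintegral_const_mul'' _ hf]
  refine lintegral_mono_ae ?_
  filter_upwards [ae_le_timeNorm_top T f] with t ht
  rw [ENNReal.rpow_two, sq]
  gcongr

namespace DyadicPartition

variable (P : DyadicPartition)

/-- Interpolation of `L̃²Ḃ⁰_{∞,∞}` between `L̃^∞Ḃ^{-1}_{∞,∞}` and `L̃¹Ḃ¹_{∞,∞}`. -/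
lemma cheminLerner_two_lt_top {T : ℝ} {U : ℝ → L2Field}
    (hU : AEStronglyMeasurable U (volume.restrict (Ioo 0 T)))
    (h1 : P.cheminLernerNorm ∞ T (-1) ∞ ∞ (fun t => U t) < ⊤)
    (h2 : P.cheminLernerNorm 1 T 1 ∞ ∞ (fun t => U t) < ⊤) :
    P.cheminLernerNorm 2 T 0 ∞ ∞ (fun t => U t) < ⊤ := by
  set M := P.cheminLernerNorm ∞ T (-1) ∞ ∞ (fun t => U t)
  set M' := P.cheminLernerNorm 1 T 1 ∞ ∞ (fun t => U t)
  refine lt_of_le_of_lt (b := (M * M') ^ (1 / 2 : ℝ)) (eLpNorm_top_count_le fun k => ?_)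
    (ENNReal.rpow_lt_top_of_nonneg (by norm_num) (ENNReal.mul_lt_top h1 h2).ne)
  rw [mul_zero, ENNReal.rpow_zero, one_mul]
  refine (timeNorm_two_le T (P.aemeasurable_top_block hU k)).trans ?_
  rw [← ENNReal.mul_rpow_of_nonneg _ _ (by norm_num)]
  refine ENNReal.rpow_le_rpow ?_ (by norm_num)
  have e1 := le_two_rpow_neg_mul (P.le_cheminLernerNorm ∞ T (-1) ∞ (fun t => U t) k)
  have e2 := le_two_rpow_neg_mul (P.le_cheminLernerNorm 1 T 1 ∞ (fun t => U t) k)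
  refine (mul_le_mul' e1 e2).trans (le_of_eq ?_)
  calc _ = (2 ^ (-((k : ℝ) * -1)) * 2 ^ (-((k : ℝ) * 1))) * (M * M') := by ring
    _ = M * M' := by
      rw [← two_rpow_add]
      simp

lemma timeNorm_besov_le (T : ℝ) (U : ℝ → L2Field) {C : ℝ≥0∞}
    (h : ∀ᵐ t ∂(volume.restrict (Ioo 0 T)), ∀ k : ℤ,
      eLpNorm (P.block k (U t)) ∞ volume ≤ 2 ^ (k : ℝ) * C) :
    timeNorm ∞ T (fun t => P.besovNorm (-1) ∞ ∞ (U t)) ≤ C := by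
  refine timeNorm_top_le ?_
  filter_upwards [h] with t ht
  refine eLpNorm_top_count_le fun k => ?_
  calc (2 : ℝ≥0∞) ^ ((k : ℝ) * -1) * eLpNorm (P.block k (U t)) ∞ volume
      ≤ 2 ^ ((k : ℝ) * -1) * (2 ^ (k : ℝ) * C) := by gcongr; exact ht k
    _ = C := by rw [← mul_assoc, ← two_rpow_add]; simp

section Heat

variable {T p δ : ℝ} {u : L2Field}

/-- Blocks at low frequencies, where the datum is only controlled in `L²`. -/
lemma eLpNorm_top_block_heat_le (k : ℤ) (hk : k ≤ 0) {t : ℝ} (ht : 0 < t) :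
    eLpNorm (P.block k (heat u t)) ∞ volume ≤ 2 ^ (k : ℝ) * (P.A * eLpNorm u 2 volume) := by
  refine (P.eLpNorm_top_block_le_two k (heat u t)).trans ?_
  have h1 : eLpNorm (heat u t) 2 volume ≤ eLpNorm u 2 volume := by
    rw [eLpNorm_congr_ae (coeFn_heat u ht)]
    exact eLpNorm_heatFlow_le (Lp.aestronglyMeasurable u) ht (by norm_num)
  have h2 : (2 : ℝ≥0∞) ^ ((k : ℝ) * (3 / 2)) ≤ 2 ^ (k : ℝ) := by
    refine two_rpow_mono ?_
    have : (k : ℝ) ≤ 0 := by exact_mod_cast hk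
    linarith
  calc _ ≤ P.A * 2 ^ (k : ℝ) * eLpNorm u 2 volume := by gcongr
    _ = _ := by ring

/-- The frequencies above one are controlled by the Besov norm of the datum, and those below one by
its `L²` norm. -/
lemma cheminLerner_heat_lt_top (hp : 2 ≤ p) (hδ : 0 < δ) (hδ1 : δ < 1)
    (hu : P.besovNorm (-1 + 3 / p + δ) (ENNReal.ofReal p) (ENNReal.ofReal p) u < ⊤) :
    P.cheminLernerNorm 2 T 0 ∞ ∞ (fun t => heat u t) < ⊤ := by
  set B := P.besovNorm (-1 + 3 / p + δ) (ENNReal.ofReal p) (ENNReal.ofReal p) u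
  have hA := P.A_ne_top
  have hH := P.H_ne_top
  have hu2 := Lp.eLpNorm_ne_top u
  have hB := hu.ne
  refine lt_of_le_of_lt (b := 16 * P.A * P.H * ENNReal.ofReal T ^ (δ / 4) * B +
    ENNReal.ofReal T ^ (1 / 2 : ℝ) * (P.A * eLpNorm u 2 volume))
    (eLpNorm_top_count_le fun k => ?_) (by finiteness)
  rw [mul_zero, ENNReal.rpow_zero, one_mul]
  rcases le_total 0 k with hk | hk
  · refine (P.timeNorm_top_block_heat_le_besov k u T hp hδ hδ1).trans (le_add_right ?_)
    have h1 : (2 : ℝ≥0∞) ^ (-((k : ℝ) * (δ / 2))) ≤ 1 := by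
      refine two_rpow_le_one (neg_nonpos.2 ?_)
      have : (0 : ℝ) ≤ k := by exact_mod_cast hk
      positivity
    refine mul_le_mul_left ?_ _
    exact mul_le_of_le_one_right' h1
  · refine le_add_left ?_
    rw [← timeNorm_const]
    refine timeNorm_mono ((ae_restrict_mem measurableSet_Ioo).mono fun t ht => ?_)
    refine (P.eLpNorm_top_block_heat_le k hk ht.1).trans (mul_le_of_le_one_left' ?_)
    exact two_rpow_le_one (by exact_mod_cast hk)

lemma timeNorm_besov_heat_lt_top (hp : 2 ≤ p) (hδ : 0 < δ)
    (hu : P.besovNorm (-1 + 3 / p + δ) (ENNReal.ofReal p) (ENNReal.ofReal p) u < ⊤) :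
    timeNorm ∞ T (fun t => P.besovNorm (-1) ∞ ∞ (heat u t)) < ⊤ := by
  have hp0 : 0 < p := by linarith
  set B := P.besovNorm (-1 + 3 / p + δ) (ENNReal.ofReal p) (ENNReal.ofReal p) u
  have hA := P.A_ne_top
  have hH := P.H_ne_top
  have hu2 := Lp.eLpNorm_ne_top u
  have hB := hu.ne
  refine lt_of_le_of_lt (b := 8 * P.A * P.H * B + P.A * eLpNorm u 2 volume)
    (P.timeNorm_besov_le T _ ?_) (by finiteness)
  filter_upwards [ae_restrict_mem measurableSet_Ioo] with t ht k
  rcases le_total 0 k with hk | hk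
  · refine le_trans ?_ (mul_le_mul_right le_self_add _)
    have h1 := le_two_rpow_neg_mul (P.le_besovNorm (-1 + 3 / p + δ) (ENNReal.ofReal p)
      (q := ENNReal.ofReal p) (by simpa using hp0) u k)
    have h2 : eLpNorm (P.block k (heat u t)) (ENNReal.ofReal p) volume ≤
        P.H * eLpNorm (P.block k u) (ENNReal.ofReal p) volume := by
      refine (P.eLpNorm_block_heat_le k u ht.1 (ENNReal.one_le_ofReal.2 (by linarith))).trans ?_
      gcongr
      exact mul_le_of_le_one_right' (ENNReal.ofReal_le_one.2 (min_le_left _ _))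
    calc _ ≤ 8 * P.A * 2 ^ ((k : ℝ) * (3 / p)) *
          (P.H * (2 ^ (-((k : ℝ) * (-1 + 3 / p + δ))) * B)) :=
          (P.bernstein k (heat u t) hp).trans
            (mul_le_mul_right (h2.trans (mul_le_mul_right h1 _)) _)
      _ = 2 ^ ((k : ℝ) * (3 / p) + -((k : ℝ) * (-1 + 3 / p + δ))) * (8 * P.A * P.H * B) := by
          rw [two_rpow_add]; ring
      _ ≤ _ := by
          gcongr
          · exact one_le_two
          · have : (0 : ℝ) ≤ k := by exact_mod_cast hk
            nlinarith
  · exact (P.eLpNorm_top_block_heat_le k hk ht.1).trans (mul_le_mul_right le_add_self _)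

/-- The smoothing `4^{-k}/t` is used at frequencies above one only. Below one, `T^{1/2}` and the
Besov norm of the datum suffice, as `-1 + 3/p + δ < 3/p`. -/
lemma cheminLerner_heat_Lp_lt_top (hp : 2 ≤ p) (hδ : 0 < δ) (hδ1 : δ < 1)
    (hu : P.besovNorm (-1 + 3 / p + δ) (ENNReal.ofReal p) (ENNReal.ofReal p) u < ⊤) :
    P.cheminLernerNorm 2 T (3 / p) (ENNReal.ofReal p) ∞ (fun t => heat u t) < ⊤ := by
  have hp0 : 0 < p := by linarith
  set B := P.besovNorm (-1 + 3 / p + δ) (ENNReal.ofReal p) (ENNReal.ofReal p) u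
  have hH := P.H_ne_top
  have hB := hu.ne
  refine lt_of_le_of_lt (b := 2 * P.H * ENNReal.ofReal T ^ (δ / 4) * B +
    P.H * ENNReal.ofReal T ^ (1 / 2 : ℝ) * B)
    (eLpNorm_top_count_le fun k => ?_) (by finiteness)
  rcases le_total 0 k with hk | hk
  · refine (mul_le_mul_right (P.timeNorm_block_heat_le_besov k u T hp hδ hδ1) _).trans
      (le_add_right ?_)
    calc _ = 2 ^ ((k : ℝ) * (3 / p) + -((k : ℝ) * (3 / p + δ / 2))) *
          (2 * P.H * ENNReal.ofReal T ^ (δ / 4) * B) := by rw [two_rpow_add]; ring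
      _ ≤ _ := by
          refine mul_le_of_le_one_left' (two_rpow_le_one ?_)
          have : (0 : ℝ) ≤ k := by exact_mod_cast hk
          nlinarith
  · refine (mul_le_mul_right (P.timeNorm_block_heat_le k u T
      (ENNReal.one_le_ofReal.2 (by linarith))) _).trans (le_add_left ?_)
    have h1 := le_two_rpow_neg_mul (P.le_besovNorm (-1 + 3 / p + δ) (ENNReal.ofReal p)
      (q := ENNReal.ofReal p) (by simpa using hp0) u k)
    calc _ ≤ 2 ^ ((k : ℝ) * (3 / p)) * (P.H * ENNReal.ofReal T ^ (1 / 2 : ℝ) *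
          (2 ^ (-((k : ℝ) * (-1 + 3 / p + δ))) * B)) := by
          gcongr
          exact min_le_left _ _
      _ = 2 ^ ((k : ℝ) * (3 / p) + -((k : ℝ) * (-1 + 3 / p + δ))) *
          (P.H * ENNReal.ofReal T ^ (1 / 2 : ℝ) * B) := by rw [two_rpow_add]; ring
      _ ≤ _ := by
          refine mul_le_of_le_one_left' (two_rpow_le_one ?_)
          have : (k : ℝ) ≤ 0 := by exact_mod_cast hk
          nlinarith

end Heat

end DyadicPartition

/-! ### The estimate of the Reynolds stress -/

namespace DyadicPartition

variable (P : DyadicPartition)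

lemma block_heat (k : ℤ) (u : L2Field) {t : ℝ} (ht : 0 < t) :
    P.block k (heat u t) = P.block k (heatFlow u t) :=
  P.block_congr_ae k (coeFn_heat u ht)

lemma cheminLernerNorm_heat (r : ℝ≥0∞) (T s : ℝ) (p q : ℝ≥0∞) (u : L2Field) :
    P.cheminLernerNorm r T s p q (fun t => heat u t) =
      P.cheminLernerNorm r T s p q (heatFlow u) := by
  have h : ∀ k : ℤ, timeNorm r T (fun t => eLpNorm (P.block k (heat u t)) p volume) =
      timeNorm r T (fun t => eLpNorm (P.block k (heatFlow u t)) p volume) := fun k =>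
    eLpNorm_congr_ae ((ae_restrict_mem measurableSet_Ioo).mono fun t ht => by
      simp only [P.block_heat k u ht.1])
  simp only [cheminLernerNorm, h]

lemma timeNorm_besovNorm_heat (r : ℝ≥0∞) (T s : ℝ) (p q : ℝ≥0∞) (u : L2Field) :
    timeNorm r T (fun t => P.besovNorm s p q (heat u t)) =
      timeNorm r T (fun t => P.besovNorm s p q (heatFlow u t)) :=
  eLpNorm_congr_ae ((ae_restrict_mem measurableSet_Ioo).mono fun t ht => by
    simp only [besovNorm, P.block_heat _ u ht.1])

/-- The stress of the pointwise heat flow, bounded by the paraproducts of the heat flow as a curve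
in `L²`. -/
lemma timeNorm_stress_le (j : ℤ) (T : ℝ) (U : ℝ → L2Field) (u : L2Field) :
    timeNorm 2 T (fun t => eLpNorm (stress P j (U t) (heatFlow u t)) 2 volume) ≤
      timeNorm 2 T (fun t => 12 * P.A * ∑' i : ℕ, (P.paraNorm (j - 3 + i) (U t) (U t) +
        P.paraNorm (j - 3 + i) (U t) (heat u t) + P.paraNorm (j - 3 + i) (heat u t) (U t) +
        P.paraNorm (j - 3 + i) (heat u t) (heat u t))) := by
  refine timeNorm_mono ((ae_restrict_mem measurableSet_Ioo).mono fun t ht => ?_)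
  rw [← eLpNorm_congr_ae (P.stress_congr_ae j (U t) (coeFn_heat u ht.1))]
  exact P.eLpNorm_stress_le j (U t) (heat u t)

/-- The constant of the terms measured in `Ḣ^α`. It has the indicated value for `α > 0`; otherwise
the geometric series diverges and `toNNReal` returns zero. The same applies to the other two
constants. -/
def homSobolevConst (α : ℝ) : ℝ≥0 :=
  (12 * P.A * (ENNReal.ofReal ((4 / 3) ^ α) * geomSum α)).toNNReal

/-- The constant of the term obtained by interpolation. -/
def interpolationConst (p : ℝ) : ℝ≥0 := (12 * P.A * (2 * P.A * geomSum (1 / p))).toNNReal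

/-- The constant of the term that is quadratic in the heat flow. -/
def heatConst (δ : ℝ) : ℝ≥0 := (12 * P.A * (16 * P.A ^ 2 * P.H * geomSum (δ / 2))).toNNReal

lemma coe_homSobolevConst {α : ℝ} (hα : 0 < α) : (P.homSobolevConst α : ℝ≥0∞) =
    12 * P.A * (ENNReal.ofReal ((4 / 3) ^ α) * geomSum α) := by
  have := P.A_ne_top
  have := geomSum_ne_top hα
  exact ENNReal.coe_toNNReal (by finiteness)

lemma coe_interpolationConst {p : ℝ} (hp : 0 < p) : (P.interpolationConst p : ℝ≥0∞) =
    12 * P.A * (2 * P.A * geomSum (1 / p)) := by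
  have := P.A_ne_top
  have := geomSum_ne_top (one_div_pos.2 hp)
  exact ENNReal.coe_toNNReal (by finiteness)

lemma coe_heatConst {δ : ℝ} (hδ : 0 < δ) : (P.heatConst δ : ℝ≥0∞) =
    12 * P.A * (16 * P.A ^ 2 * P.H * geomSum (δ / 2)) := by
  have := P.A_ne_top
  have := P.H_ne_top
  have := geomSum_ne_top (half_pos hδ)
  exact ENNReal.coe_toNNReal (by finiteness)

/-- The four terms come from the paraproducts of `U` with `U`, of `U` with the heat flow, of the
heat flow with `U`, and of the heat flow with itself. -/
theorem timeNorm_stress_le_norms {α p δ T : ℝ} (hα : 0 < α) (hp : 2 < p) (hδ : 0 < δ) (hδ1 : δ < 1)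
    {U : ℝ → L2Field} (hU : AEStronglyMeasurable U (volume.restrict (Ioo 0 T))) (u₀ : L2Field)
    {j : ℕ} (hj : 1 ≤ j) :
    timeNorm 2 T (fun t => eLpNorm (stress P j (U t) (heatFlow u₀ t)) 2 volume) ≤
      P.homSobolevConst α * 2 ^ (-(j * α)) * timeNorm ∞ T (fun t => homSobolevNorm α (U t)) *
          (j * P.cheminLernerNorm 2 T 0 ∞ ∞ (fun t => U t) + ENNReal.ofReal T ^ (1 / 2 : ℝ) *
            timeNorm ∞ T (fun t => P.besovNorm (-1) ∞ ∞ (U t)))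
        + P.homSobolevConst α * 2 ^ (-(j * α)) * timeNorm ∞ T (fun t => homSobolevNorm α (U t)) *
          (j * P.cheminLernerNorm 2 T 0 ∞ ∞ (heatFlow u₀) + ENNReal.ofReal T ^ (1 / 2 : ℝ) *
            timeNorm ∞ T (fun t => P.besovNorm (-1) ∞ ∞ (heatFlow u₀ t)))
        + P.interpolationConst p * 2 ^ (-(j / p)) *
          P.cheminLernerNorm 2 T (3 / p) (ENNReal.ofReal p) ∞ (heatFlow u₀) *
          P.cheminLernerNorm ∞ T (-1) ∞ ∞ (fun t => U t) ^ (2 / p) *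
          timeNorm ∞ T (fun t => eLpNorm (U t) 2 volume) ^ (1 - 2 / p)
        + P.heatConst δ * ENNReal.ofReal T ^ (δ / 4) * 2 ^ (-(j * (δ / 2))) *
          eLpNorm u₀ 2 volume *
          P.besovNorm (-1 + 3 / p + δ) (ENNReal.ofReal p) (ENNReal.ofReal p) u₀ := by
  have hE := aestronglyMeasurable_heat u₀ T
  have key := (((P.dominatedSeries_homSobolev U U hU hα hj).add
    (P.dominatedSeries_homSobolev U (heat u₀) hE hα hj)).add
    (P.dominatedSeries_interpolation (heat u₀) U hE hp j)).add
    (P.dominatedSeries_heat T u₀ hp.le hδ hδ1 j)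
  refine (P.timeNorm_stress_le j T U u₀).trans
    ((key.timeNorm_le (12 * P.A)).trans (le_of_eq ?_))
  rw [P.coe_homSobolevConst hα, P.coe_interpolationConst (by linarith), P.coe_heatConst hδ,
    P.cheminLernerNorm_heat, P.cheminLernerNorm_heat, P.timeNorm_besovNorm_heat]
  ring

end DyadicPartition

/-- The logarithmic factor `j` costs at most half of the exponential decay. -/
lemma exists_natCast_mul_two_rpow_le {α : ℝ} (hα : 0 < α) : ∃ G : ℝ≥0∞, G ≠ ⊤ ∧
    ∀ j : ℕ, 2 ^ (-(j * α)) * (1 + (j : ℝ≥0∞)) ≤ G * 2 ^ (-(j * (α / 2))) := by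
  refine ⟨_, tsum_two_rpow_mul_ne_top (half_pos hα), fun j => ?_⟩
  calc (2 : ℝ≥0∞) ^ (-(j * α)) * (1 + (j : ℝ≥0∞))
      = 2 ^ (-(j * (α / 2))) * (1 + (j : ℝ≥0∞)) * 2 ^ (-(j * (α / 2))) := by
        rw [mul_right_comm, ← two_rpow_add]
        congr 2
        ring
    _ ≤ _ := mul_le_mul_left (ENNReal.le_tsum
        (f := fun j : ℕ => (2 : ℝ≥0∞) ^ (-(j * (α / 2))) * (1 + (j : ℝ≥0∞))) j) _

/-- Every term of the estimate decays at least like `2^{-jγ}`, `γ = min(α/2, 1/p, δ/2)`. -/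
lemma exists_decay_bound {α p δ : ℝ} (hα : 0 < α) {a X B Y Z : ℝ≥0∞} (ha : a ≠ ⊤) (hX : X ≠ ⊤)
    (hB : B ≠ ⊤) (hY : Y ≠ ⊤) (hZ : Z ≠ ⊤) :
    ∃ K : ℝ≥0, ∀ j : ℕ, a * 2 ^ (-(j * α)) * (j * X + B) + 2 ^ (-(j / p)) * Y +
      2 ^ (-(j * (δ / 2))) * Z ≤ K * 2 ^ (-(j * min (α / 2) (min (1 / p) (δ / 2)))) := by
  obtain ⟨G, hG, hj⟩ := exists_natCast_mul_two_rpow_le hα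
  refine ⟨(a * (X + B) * G + Y + Z).toNNReal, fun j => ?_⟩
  rw [ENNReal.coe_toNNReal (by finiteness)]
  set γ := min (α / 2) (min (1 / p) (δ / 2))
  have hmono : ∀ s, γ ≤ s → (2 : ℝ≥0∞) ^ (-(j * s)) ≤ 2 ^ (-(j * γ)) := fun s hs =>
    two_rpow_mono (neg_le_neg (mul_le_mul_of_nonneg_left hs j.cast_nonneg))
  have h1 : a * 2 ^ (-(j * α)) * (j * X + B) ≤ a * (X + B) * G * 2 ^ (-(j * γ)) := by
    have h : j * X + B ≤ (1 + j) * (X + B) := by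
      rw [show (1 + (j : ℝ≥0∞)) * (X + B) = (j * X + B) + (X + j * B) by ring]
      exact le_self_add
    calc _ ≤ a * 2 ^ (-(j * α)) * ((1 + j) * (X + B)) := mul_le_mul_right h _
      _ = a * (X + B) * (2 ^ (-(j * α)) * (1 + (j : ℝ≥0∞))) := by ring
      _ ≤ a * (X + B) * (G * 2 ^ (-(j * γ))) := mul_le_mul_right
          ((hj j).trans (mul_le_mul_right (hmono _ (min_le_left _ _)) _)) _
      _ = _ := by ring
  have h2 : (2 : ℝ≥0∞) ^ (-(j / p)) * Y ≤ Y * 2 ^ (-(j * γ)) := by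
    rw [mul_comm, ← mul_one_div (j : ℝ) p]
    exact mul_le_mul_right (hmono _ ((min_le_right _ _).trans (min_le_left _ _))) _
  have h3 : (2 : ℝ≥0∞) ^ (-(j * (δ / 2))) * Z ≤ Z * 2 ^ (-(j * γ)) := by
    rw [mul_comm]
    exact mul_le_mul_right (hmono _ ((min_le_right _ _).trans (min_le_right _ _))) _
  rw [add_mul, add_mul]
  exact add_le_add (add_le_add h1 h2) h3

end ReynoldsStress

end

theorem mainTheorem3 (P : DyadicPartition) :
    ∃ cα Cp Cδ : ℝ → ℝ≥0,
      ∀ (α p δ T : ℝ), 0 < α → α < 3 / 2 → 4 < p → 0 < δ → δ < 1 - 3 / p → 0 < T →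
      ∀ (U : ℝ → L2Field) (u₀ : L2Field),
        P.cheminLernerNorm ∞ T (-1) ∞ ∞ (fun t => U t) < ⊤ →
        P.cheminLernerNorm 1 T 1 ∞ ∞ (fun t => U t) < ⊤ →
        MemLinftySobolev T α U →
        u₀ ∈ J →
        P.MemBesov (-1 + 3 / p + δ) (ENNReal.ofReal p) (ENNReal.ofReal p) u₀ →
        (∀ j : ℕ, 1 ≤ j →
          timeNorm 2 T (fun t => eLpNorm (stress P j (U t) (heatFlow u₀ t)) 2 volume) ≤
            cα α * 2 ^ (-(j * α)) * timeNorm ∞ T (fun t => homSobolevNorm α (U t)) *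
                (j * P.cheminLernerNorm 2 T 0 ∞ ∞ (fun t => U t) +
                  ENNReal.ofReal T ^ (1 / 2 : ℝ) *
                    timeNorm ∞ T (fun t => P.besovNorm (-1) ∞ ∞ (U t)))
              + cα α * 2 ^ (-(j * α)) * timeNorm ∞ T (fun t => homSobolevNorm α (U t)) *
                (j * P.cheminLernerNorm 2 T 0 ∞ ∞ (heatFlow u₀) +
                  ENNReal.ofReal T ^ (1 / 2 : ℝ) *
                    timeNorm ∞ T (fun t => P.besovNorm (-1) ∞ ∞ (heatFlow u₀ t)))
              + Cp p * 2 ^ (-(j / p)) *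
                P.cheminLernerNorm 2 T (3 / p) (ENNReal.ofReal p) ∞ (heatFlow u₀) *
                P.cheminLernerNorm ∞ T (-1) ∞ ∞ (fun t => U t) ^ (2 / p) *
                timeNorm ∞ T (fun t => eLpNorm (U t) 2 volume) ^ (1 - 2 / p)
              + Cδ δ * ENNReal.ofReal T ^ (δ / 4) * 2 ^ (-(j * (δ / 2))) *
                eLpNorm u₀ 2 volume *
                P.besovNorm (-1 + 3 / p + δ) (ENNReal.ofReal p) (ENNReal.ofReal p) u₀) ∧
        ∃ K : ℝ≥0, ∀ j : ℕ, 1 ≤ j →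
          timeNorm 2 T (fun t => eLpNorm (stress P j (U t) (heatFlow u₀ t)) 2 volume) ≤
            K * 2 ^ (-(j * min (α / 2) (min (1 / p) (δ / 2)))) := by
  refine ⟨P.homSobolevConst, P.interpolationConst, P.heatConst, ?_⟩
  intro α p δ T hα _ hp hδ hδp _ U u₀ hM hM' hU _ hu₀
  have hp0 : 0 < p := by linarith
  have hδ1 : δ < 1 := by
    have : 0 < 3 / p := by positivity
    linarith
  have hest := fun (j : ℕ) (hj : 1 ≤ j) =>
    P.timeNorm_stress_le_norms hα (show 2 < p by linarith) hδ hδ1 hU.1 u₀ hj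
  refine ⟨hest, ?_⟩
  -- It remains to see that all the norms on the right-hand side are finite.
  have hS : timeNorm ∞ T (fun t => homSobolevNorm α (U t)) ≠ ⊤ :=
    ((timeNorm_mono (Eventually.of_forall fun t => homSobolevNorm_le hα.le (U t))).trans_lt hU.2).ne
  have hN : timeNorm ∞ T (fun t => eLpNorm (U t) 2 volume) ≠ ⊤ :=
    ((timeNorm_mono (Eventually.of_forall fun t =>
      eLpNorm_le_sobolevNorm hα.le (U t))).trans_lt hU.2).ne
  have hX := (P.cheminLerner_two_lt_top hU.1 hM hM').ne
  have hB : timeNorm ∞ T (fun t => P.besovNorm (-1) ∞ ∞ (U t)) ≠ ⊤ :=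
    ((P.timeNorm_besov_le T U (P.ae_block_le_cheminLerner T U)).trans_lt hM).ne
  have hXe := (P.cheminLerner_heat_lt_top (T := T) (by linarith) hδ hδ1 hu₀.1).ne
  have hBe := (P.timeNorm_besov_heat_lt_top (T := T) (by linarith) hδ hu₀.1).ne
  have hYe := (P.cheminLerner_heat_Lp_lt_top (T := T) (by linarith) hδ hδ1 hu₀.1).ne
  rw [P.cheminLernerNorm_heat] at hXe hYe
  rw [P.timeNorm_besovNorm_heat] at hBe
  have hMp := ENNReal.rpow_ne_top_of_nonneg (by positivity : 0 ≤ 2 / p) hM.ne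
  have hNp := ENNReal.rpow_ne_top_of_nonneg
    (by rw [sub_nonneg, div_le_one hp0]; linarith : 0 ≤ 1 - 2 / p) hN
  have hu := Lp.eLpNorm_ne_top u₀
  have hu' := hu₀.1.ne
  have hT : ENNReal.ofReal T ^ (1 / 2 : ℝ) ≠ ⊤ := by finiteness
  have hT' : ENNReal.ofReal T ^ (δ / 4) ≠ ⊤ := by finiteness
  have hc : ∀ x : ℝ≥0, (x : ℝ≥0∞) ≠ ⊤ := fun x => ENNReal.coe_ne_top
  obtain ⟨K, hK⟩ := exists_decay_bound (p := p) (δ := δ) hα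
    (ENNReal.mul_ne_top (hc (P.homSobolevConst α)) hS) (ENNReal.add_ne_top.2 ⟨hX, hXe⟩)
    (ENNReal.mul_ne_top hT (ENNReal.add_ne_top.2 ⟨hB, hBe⟩))
    (ENNReal.mul_ne_top (ENNReal.mul_ne_top (ENNReal.mul_ne_top
      (hc (P.interpolationConst p)) hYe) hMp) hNp)
    (ENNReal.mul_ne_top (ENNReal.mul_ne_top (ENNReal.mul_ne_top
      (hc (P.heatConst δ)) hT') hu) hu')
  refine ⟨K, fun j hj => (hest j hj).trans (le_trans (le_of_eq ?_) (hK j))⟩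
  ring
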